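/- For coprime integers $p>q>0$ let $p/q=a_1-\cfrac{1}{a_2-\cfrac{1}{\ddots-\cfrac{1}{a_n}}}$ with all $a_j\ge 2$ be the negative continued fraction expansion. Let $X(p,q)$ be the canonical negative-definite plumbing bounded by the lens space $L(p,q)$, that is, the plumbing of disk bundles over spheres along the path on $n$ vertices with weights $-a_1,\dots,-a_n$. The canonical plumbing graph of a connected sum $L=\#_i L(p_i,q_i)$ (finitely many summands) is the disjoint union of these weighted paths, and it is the plumbing graph of the boundary connected sum $\natural_i X(p_i,q_i)$. For a plumbing $X$ along a weighted graph, the lattice $Q_X$ is the free abelian group on the vertices with the intersection form for which $v\cdot v$ is the weight of $v$, and, for $u\neq v$, $u\cdot v=1$ if $u,v$ are adjacent and $u\cdot v=0$ otherwise; $b_2(X)$ is its rank. For a positive integer $k$, say that $L$ has Property $X_k$ if the lattice $Q_{\natural_i X(p_i,p_i-q_i)}$ does not embed isometrically in the standard negative lattice $(\mathbb{Z}^{n_k},-\mathrm{Id})$, where $$n_k=b_2(\natural_i X(p_i,q_i))+b_2(\natural_i X(p_i,p_i-q_i))-k$$ (if $n_k<0$, there is no such embedding and the property holds). A minimal configuration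 for $k$ is a weighted graph that is the canonical plumbing graph of some connected sum of lens spaces without Property $X_k$, and that contains no other such graph, up to isomorphism of weighted graphs, as an induced subgraph (with the induced weights). Theorem A. For each positive integer $k$ there is a finite set $S_k$ of pairwise non-isomorphic minimal configurations for $k$ such that: 1. a connected sum of lens spaces $L$ has Property $X_k$ if and only if its canonical plumbing graph contains no configuration from $S_k$ as an induced subgraph; 2. every vertex weight of every configuration in $S_k$ has absolute value at most $2k+7$; 3. every configuration in $S_k$ has at most $13k$ vertices. -/

import Mathlib

/-- The parameters of a lens space `L(p,q)`: coprime integers `p > q > 0`. -/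
structure LensSpace where
  p : ℕ
  q : ℕ
  q_pos : 0 < q
  q_lt_p : q < p
  coprime : Nat.Coprime p q

/-- The parameters `(p, p - q)` of the orientation reversal `-L(p,q) = L(p,p-q)`. -/
def LensSpace.reverse (L : LensSpace) : LensSpace where
  p := L.p
  q := L.p - L.q
  q_pos := Nat.sub_pos_of_lt L.q_lt_p
  q_lt_p := Nat.sub_lt (lt_trans L.q_pos L.q_lt_p) L.q_pos
  coprime := (Nat.coprime_self_sub_right L.q_lt_p.le).mpr L.coprime

/-- The negative (Hirzebruch–Jung) continued fraction expansion `[a₁, …, aₙ]` of `p / q`: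
`a₁ = ⌈p / q⌉`, followed by the expansion of `q / (a₁ q - p)`, where `a₁ q - p < q`.
(For a denominator `q + 1` one has `⌈p / (q + 1)⌉ = ⌊(p + q) / (q + 1)⌋` and
`⌈p / (q + 1)⌉ (q + 1) - p = q - (p + q) % (q + 1)`.) -/
def hjExpansion (p : ℕ) : ℕ → List ℕ
  | 0 => []
  | q + 1 => ((p + q) / (q + 1)) :: hjExpansion (q + 1) (q - (p + q) % (q + 1))
termination_by q => q
decreasing_by omega

/-- The value `a₁ - 1 / (a₂ - 1 / (⋯ - 1 / aₙ))` of a negative continued fraction. -/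
def hjValue : List ℕ → ℚ
  | [] => 0
  | [a] => a
  | a :: b :: l => a - 1 / hjValue (b :: l)

theorem hjExpansion_eq_nil_iff (p q : ℕ) : hjExpansion p q = [] ↔ q = 0 := by
  cases q <;> simp [hjExpansion]

/-- The entries of the expansion of `p / q` are at least `2` when `p > q`. -/
theorem two_le_of_mem_hjExpansion {q : ℕ} : ∀ {p : ℕ}, q < p →
    ∀ a ∈ hjExpansion p q, 2 ≤ a := by
  induction q using Nat.strong_induction_on with
  | _ q ih =>
    intro p hpq a ha
    cases q with
    | zero => simp [hjExpansion] at ha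
    | succ q =>
      rw [hjExpansion, List.mem_cons] at ha
      rcases ha with rfl | ha
      · rw [Nat.le_div_iff_mul_le (Nat.succ_pos q)]
        omega
      · exact ih _ (by omega) (by omega) a ha

/-- The expansion of `p / q` has value `p / q`. -/
theorem hjValue_hjExpansion {q : ℕ} : ∀ {p : ℕ}, q < p → 0 < q →
    hjValue (hjExpansion p q) = (p : ℚ) / q := by
  induction q using Nat.strong_induction_on with
  | _ q ih =>
    intro p hpq hq
    cases q with
    | zero => omega
    | succ q =>
      rw [hjExpansion]
      have hdiv := Nat.div_add_mod (p + q) (q + 1)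
      have hlt : (p + q) % (q + 1) < q + 1 := Nat.mod_lt _ (Nat.succ_pos q)
      set a := (p + q) / (q + 1) with ha
      set r := q - (p + q) % (q + 1) with hr
      have key : (q + 1) * a = p + r := by omega
      have keyQ : ((q : ℚ) + 1) * a = p + r := by exact_mod_cast key
      have hq0 : (q : ℚ) + 1 ≠ 0 := by positivity
      rcases Nat.eq_zero_or_pos r with h0 | h0
      · rw [h0] at keyQ ⊢
        rw [hjExpansion, hjValue]
        push_cast at keyQ ⊢
        field_simp
        linarith
      · have h := ih r (by omega) (p := q + 1) (by omega) h0
        cases hl : hjExpansion (q + 1) r with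
        | nil => rw [hjExpansion_eq_nil_iff] at hl; omega
        | cons b l =>
          rw [hjValue, ← hl, h]
          have hr0 : (r : ℚ) ≠ 0 := by exact_mod_cast h0.ne'
          push_cast
          field_simp
          linarith

/-- The coefficients `a₁, …, aₙ ≥ 2` with `p / q = a₁ - 1 / (a₂ - 1 / (⋯ - 1 / aₙ))`. -/
def LensSpace.coeffs (L : LensSpace) : List ℕ := hjExpansion L.p L.q

/-- A simple graph with integer weights on its vertices. -/
structure WeightedGraph (V : Type*) where
  graph : SimpleGraph V
  weight : V → ℤ

namespace WeightedGraph

variable {V W : Type*}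

/-- `G` is (isomorphic to) an induced subgraph of `H`, with the same weights. -/
def IsInducedSubgraph (G : WeightedGraph V) (H : WeightedGraph W) : Prop :=
  ∃ f : G.graph ↪g H.graph, ∀ v, H.weight (f v) = G.weight v

/-- `G` and `H` are isomorphic weighted graphs. -/
def IsIsomorphic (G : WeightedGraph V) (H : WeightedGraph W) : Prop :=
  ∃ f : G.graph ≃g H.graph, ∀ v, H.weight (f v) = G.weight v

open Classical in
/-- The intersection form `Q` of the plumbing of disk bundles over spheres along a forest `G`, on
its second homology, the free abelian group on the vertices: the matrix has the weights on the
diagonal, and off the diagonal `1` for adjacent and `0` for non-adjacent vertices. -/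
noncomputable def intersectionForm [Fintype V] (G : WeightedGraph V) :
    LinearMap.BilinForm ℤ (V → ℤ) :=
  Matrix.toBilin' (Matrix.of fun u v : V =>
    if u = v then G.weight u else if G.graph.Adj u v then 1 else 0)

/-- The second Betti number of the plumbing along `G`. -/
noncomputable def bettiTwo [Fintype V] (_G : WeightedGraph V) : ℕ :=
  Module.finrank ℤ (V → ℤ)

end WeightedGraph

/-- The standard negative-definite lattice `(ℤⁿ, -Id)`. -/
def standardNegativeForm (n : ℕ) : LinearMap.BilinForm ℤ (Fin n → ℤ) :=
  Matrix.toBilin' (-1)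

/-- There is an embedding of integral lattices `(M, B) ↪ (N, C)`. -/
def LatticeEmbeds {M N : Type*} [AddCommGroup M] [AddCommGroup N]
    (B : LinearMap.BilinForm ℤ M) (C : LinearMap.BilinForm ℤ N) : Prop :=
  ∃ f : M →ₗ[ℤ] N, Function.Injective f ∧ ∀ x y, C (f x) (f y) = B x y

/-- The canonical plumbing graph of the connected sum `#ᵢ L(pᵢ,qᵢ)`: the disjoint union over `i` of
the paths with weights `-a₁, …, -aₙ`, where `[a₁, …, aₙ]` is the expansion of `pᵢ / qᵢ`. -/
def canonicalPlumbingGraph {m : ℕ} (L : Fin m → LensSpace) :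
    WeightedGraph (Σ i : Fin m, Fin (L i).coeffs.length) where
  graph :=
    { Adj := fun u v => u.1 = v.1 ∧ (u.2.val + 1 = v.2.val ∨ v.2.val + 1 = u.2.val)
      symm := ⟨fun _ _ h => ⟨h.1.symm, h.2.symm⟩⟩
      loopless := ⟨fun _ h => by omega⟩ }
  weight := fun v => -((L v.1).coeffs.get v.2 : ℤ)

/-- The canonical plumbing graph of `#ᵢ L(pᵢ,pᵢ-qᵢ)`. -/
def dualPlumbingGraph {m : ℕ} (L : Fin m → LensSpace) :
    WeightedGraph (Σ i : Fin m, Fin (L i).reverse.coeffs.length) :=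
  canonicalPlumbingGraph fun i => (L i).reverse

/-- Property `X_k` of `#ᵢ L(pᵢ,qᵢ)`: the lattice `Q` of `♮ᵢ X(pᵢ,pᵢ-qᵢ)` has no embedding into
`(ℤⁿ, -Id)` for `n = b₂(♮ᵢ X(pᵢ,qᵢ)) + b₂(♮ᵢ X(pᵢ,pᵢ-qᵢ)) - k`. The difference is taken in `ℤ`;
if it is negative, there is no such lattice and the property holds. -/
def PropertyX (k : ℕ) {m : ℕ} (L : Fin m → LensSpace) : Prop :=
  ¬ ∃ n : ℕ,
    (n : ℤ) = (canonicalPlumbingGraph L).bettiTwo + (dualPlumbingGraph L).bettiTwo - k ∧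
    LatticeEmbeds (dualPlumbingGraph L).intersectionForm (standardNegativeForm n)

/-- `G` is a minimal configuration for `k`: it is the canonical plumbing graph of a connected sum
of lens spaces without Property `X_k`, and it contains no other such graph as an induced subgraph. -/
def IsMinimalConfiguration (k : ℕ) {V : Type*} (G : WeightedGraph V) : Prop :=
  (∃ (m : ℕ) (L : Fin m → LensSpace),
    G.IsIsomorphic (canonicalPlumbingGraph L) ∧ ¬ PropertyX k L) ∧
  ∀ (m : ℕ) (L : Fin m → LensSpace), ¬ PropertyX k L →
    (canonicalPlumbingGraph L).IsInducedSubgraph G →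
    (canonicalPlumbingGraph L).IsIsomorphic G

/-!
Up to signs, the vertices of a chain of weights `-a₁, …, -aₙ` are the indicator vectors of blocks of
`a₁, …, aₙ` coordinates of a diagonal lattice, where consecutive blocks share one coordinate. By
Riemenschneider duality the lattice of the dual plumbing `♮ X(p,p-q)` is the orthogonal complement
of these vectors (the *flows*), and the number of coordinates is the sum of the two Betti numbers.
So Property `X_k` fails exactly when the lattice of flows embeds in a standard lattice whose rank is
smaller by `k`. This condition is inherited by larger plumbing graphs, and the numbers `k` add up
over nonadjacent pieces. Each vertex of weight `-2` or `-4` and each pair of adjacent vertices of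
weight `-3` contributes `1`, hence a minimal configuration has at most `k` pairwise nonadjacent
pieces of these kinds.

Suppose that a vertex `X` meets many coordinates that no other vertex meets. Differences of two such
coordinates have square `2`, so their images under an embedding determine orthonormal vectors. These
read off the coordinates of a flow up to a common error. If the error vanishes on all flows, the
orthonormal vectors split off and `X` can be removed, contradicting minimality. Otherwise the error
occurs on the flow along a run of vertices of weight `-2`, whose length is then at least `|w| - 5`
for the weight `w` of `X`. As every other vertex of the run is a piece, `|w| ≤ 2k + 7`. The same
analysis shows that each vertex lies near one of the at most `k` pieces, hence there are at most
`13k` vertices.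
-/

open scoped Matrix

namespace LinearPlumbing

section Orthonormal

variable {ι J R : Type*} [DecidableEq ι] [Fintype J] [CommRing R]

/-- The family `U` is orthonormal on `s` for the standard form. -/
def IsOrthonormalOn (s : Finset ι) (U : ι → J → R) : Prop :=
  ∀ i ∈ s, ∀ j ∈ s, U i ⬝ᵥ U j = if i = j then 1 else 0

theorem IsOrthonormalOn.dotProduct_self_sub_sum {s : Finset ι} {U : ι → J → R}
    (hU : IsOrthonormalOn s U) (x : J → R) :
    (x - ∑ i ∈ s, (x ⬝ᵥ U i) • U i) ⬝ᵥ (x - ∑ i ∈ s, (x ⬝ᵥ U i) • U i) =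
      x ⬝ᵥ x - ∑ i ∈ s, (x ⬝ᵥ U i) ^ 2 := by
  set y := ∑ i ∈ s, (x ⬝ᵥ U i) • U i with hy
  have hyU : ∀ i ∈ s, y ⬝ᵥ U i = x ⬝ᵥ U i := fun i hi => by
    rw [hy, sum_dotProduct, Finset.sum_eq_single_of_mem i hi fun j hj hji => by
      rw [smul_dotProduct, hU j hj i hi, if_neg hji, smul_zero], smul_dotProduct, hU i hi i hi,
      if_pos rfl, smul_eq_mul, mul_one]
  have hdot : ∀ z : J → R, z ⬝ᵥ y = ∑ i ∈ s, (x ⬝ᵥ U i) * (z ⬝ᵥ U i) := fun z => by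
    simp only [hy, dotProduct_sum, dotProduct_smul, smul_eq_mul]
  have hxy : x ⬝ᵥ y = ∑ i ∈ s, (x ⬝ᵥ U i) ^ 2 := by simp only [hdot, sq]
  have hyy : y ⬝ᵥ y = ∑ i ∈ s, (x ⬝ᵥ U i) ^ 2 := by
    rw [hdot]
    exact Finset.sum_congr rfl fun i hi => by rw [hyU i hi, sq]
  rw [sub_dotProduct, dotProduct_sub, dotProduct_sub, dotProduct_comm y x, hxy, hyy]
  ring

theorem IsOrthonormalOn.insertNone {s : Finset ι} {U : ι → J → R} (hU : IsOrthonormalOn s U)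
    {g : J → R} (hg : g ⬝ᵥ g = 1) (hUg : ∀ i ∈ s, U i ⬝ᵥ g = 0) :
    IsOrthonormalOn (Finset.insertNone s) fun o => o.elim g U := by
  rw [IsOrthonormalOn, Finset.forall_mem_insertNone]
  simp only [Finset.forall_mem_insertNone, Option.elim_none, Option.elim_some, Option.some.injEq,
    reduceCtorEq, if_true, if_false]
  exact ⟨⟨hg, fun i hi => by rw [dotProduct_comm, hUg i hi]⟩, fun i hi => ⟨hUg i hi, hU i hi⟩⟩

variable [LinearOrder R] [IsStrictOrderedRing R]

theorem dotProduct_self_nonneg (x : J → R) : 0 ≤ x ⬝ᵥ x :=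
  Finset.sum_nonneg fun i _ => mul_self_nonneg (x i)

theorem IsOrthonormalOn.sum_sq_dotProduct_le {s : Finset ι} {U : ι → J → R}
    (hU : IsOrthonormalOn s U) (x : J → R) : ∑ i ∈ s, (x ⬝ᵥ U i) ^ 2 ≤ x ⬝ᵥ x := by
  rw [← sub_nonneg, ← hU.dotProduct_self_sub_sum]
  exact dotProduct_self_nonneg _

theorem IsOrthonormalOn.eq_sum_of_dotProduct_self_le {s : Finset ι} {U : ι → J → R}
    (hU : IsOrthonormalOn s U) {x : J → R} (hx : x ⬝ᵥ x ≤ ∑ i ∈ s, (x ⬝ᵥ U i) ^ 2) :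
    x = ∑ i ∈ s, (x ⬝ᵥ U i) • U i := by
  rw [← sub_eq_zero, ← dotProduct_self_eq_zero, hU.dotProduct_self_sub_sum]
  exact sub_eq_zero.2 (le_antisymm hx (hU.sum_sq_dotProduct_le x))

theorem IsOrthonormalOn.dotProduct_eq_sum_of_dotProduct_self_le {s : Finset ι} {U : ι → J → R}
    (hU : IsOrthonormalOn s U) {x : J → R} (hx : x ⬝ᵥ x ≤ ∑ i ∈ s, (x ⬝ᵥ U i) ^ 2)
    (y : J → R) : y ⬝ᵥ x = ∑ i ∈ s, (x ⬝ᵥ U i) * (y ⬝ᵥ U i) := by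
  conv_lhs => rw [hU.eq_sum_of_dotProduct_self_le hx]
  simp only [dotProduct_sum, dotProduct_smul, smul_eq_mul]

end Orthonormal

section IntegerVectors

variable {J : Type*} [Fintype J]

theorem exists_eq_single_of_dotProduct_self_eq_one [DecidableEq J] {u : J → ℤ}
    (hu : u ⬝ᵥ u = 1) : ∃ j ε, ε * ε = 1 ∧ u = Pi.single j ε := by
  obtain ⟨j, hj⟩ : ∃ j, u j ≠ 0 := by
    by_contra! h
    simp [dotProduct, h] at hu
  have hsplit := Finset.add_sum_erase Finset.univ (fun i => u i * u i) (Finset.mem_univ j)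
  have hsum : ∑ i, u i * u i = 1 := hu
  have hrest : 0 ≤ ∑ i ∈ Finset.univ.erase j, u i * u i :=
    Finset.sum_nonneg fun i _ => mul_self_nonneg (u i)
  have hpos : 0 < u j * u j := mul_self_pos.2 hj
  have hzero : ∑ i ∈ Finset.univ.erase j, u i * u i = 0 := by linarith
  rw [Finset.sum_eq_zero_iff_of_nonneg fun i _ => mul_self_nonneg (u i)] at hzero
  refine ⟨j, u j, by linarith, ?_⟩
  ext i
  rcases eq_or_ne i j with rfl | hij
  · rw [Pi.single_eq_same]
  · rw [Pi.single_eq_of_ne hij]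
    exact mul_self_eq_zero.1 (hzero i (Finset.mem_erase.2 ⟨hij, Finset.mem_univ i⟩))

theorem exists_common_unit {r s : J → ℤ} (hr : r ⬝ᵥ r = 2) (hs : s ⬝ᵥ s = 2) (hrs : r ⬝ᵥ s = 1) :
    ∃ u : J → ℤ, u ⬝ᵥ u = 1 ∧ u ⬝ᵥ r = 1 ∧ u ⬝ᵥ s = 1 := by
  classical
  have hbound : ∀ t : J → ℤ, t ⬝ᵥ t = 2 → ∀ i, -1 ≤ t i ∧ t i ≤ 1 := fun t ht i => by
    have hti : t i * t i ≤ 2 := ht ▸ Finset.single_le_sum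
      (f := fun i => t i * t i) (fun i _ => mul_self_nonneg (t i)) (Finset.mem_univ i)
    constructor <;> nlinarith
  obtain ⟨i, hi⟩ : ∃ i, 0 < r i * s i := by
    by_contra! h
    have : r ⬝ᵥ s ≤ 0 := Finset.sum_nonpos fun i _ => h i
    omega
  have hri := hbound r hr i
  have hsi := hbound s hs i
  rcases pos_and_pos_or_neg_and_neg_of_mul_pos hi with ⟨hr0, hs0⟩ | ⟨hr0, hs0⟩
  · exact ⟨Pi.single i 1, by simp, by rw [single_dotProduct]; omega,
      by rw [single_dotProduct]; omega⟩
  · exact ⟨Pi.single i (-1), by simp, by rw [single_dotProduct]; omega,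
      by rw [single_dotProduct]; omega⟩

theorem isOrthonormalOn_of_common_unit {u r s : J → ℤ} (hu : u ⬝ᵥ u = 1) (hr : r ⬝ᵥ r = 2)
    (hs : s ⬝ᵥ s = 2) (hrs : r ⬝ᵥ s = 1) (hur : u ⬝ᵥ r = 1) (hus : u ⬝ᵥ s = 1) :
    IsOrthonormalOn Finset.univ ![u, r - u, s - u] := by
  have hru := (dotProduct_comm r u).trans hur
  have hsu := (dotProduct_comm s u).trans hus
  have hsr := (dotProduct_comm s r).trans hrs
  intro i _ j _
  fin_cases i <;> fin_cases j <;>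
    simp [sub_dotProduct, dotProduct_sub, hu, hr, hs, hrs, hur, hus, hru, hsu, hsr]

/-- If `u` misses `r l`, then `r l = (r i - u) + (r j - u)`, as for the vectors `e₁ + e₂`,
`e₁ + e₃`, `e₂ + e₃`; then `y ⬝ᵥ (r i + r j + r l)` is even for every `y`. -/
theorem exists_common_unit_of_finset {ι : Type*} (s : Finset ι) (r : ι → J → ℤ)
    (hr : ∀ i ∈ s, r i ⬝ᵥ r i = 2) (hrr : ∀ i ∈ s, ∀ j ∈ s, i ≠ j → r i ⬝ᵥ r j = 1)
    (hs : 2 ≤ s.card)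
    (hex : ∀ i ∈ s, ∀ j ∈ s, ∀ l ∈ s, i ≠ j → i ≠ l → j ≠ l →
      ∃ y, y ⬝ᵥ r i = 1 ∧ y ⬝ᵥ r j = 1 ∧ y ⬝ᵥ r l = 1) :
    ∃ u : J → ℤ, u ⬝ᵥ u = 1 ∧ ∀ i ∈ s, u ⬝ᵥ r i = 1 := by
  obtain ⟨i, hi, j, hj, hij⟩ := Finset.one_lt_card.1 hs
  obtain ⟨u, hu, hui, huj⟩ := exists_common_unit (hr i hi) (hr j hj) (hrr i hi j hj hij)
  refine ⟨u, hu, fun l hl => ?_⟩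
  rcases eq_or_ne i l with rfl | hil
  · exact hui
  rcases eq_or_ne j l with rfl | hjl
  · exact huj
  have hU := isOrthonormalOn_of_common_unit hu (hr i hi) (hr j hj) (hrr i hi j hj hij) hui huj
  have hbessel := hU.sum_sq_dotProduct_le (r l)
  have hequality := hU.eq_sum_of_dotProduct_self_le (x := r l)
  have hli := hrr l hl i hi hil.symm
  have hlj := hrr l hl j hj hjl.symm
  simp only [Fin.sum_univ_three, Matrix.cons_val, dotProduct_sub, hr l hl, hli, hlj,
    dotProduct_comm (r l) u] at hbessel hequality
  by_contra hne
  have hul : u ⬝ᵥ r l = 0 := by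
    have : 0 ≤ u ⬝ᵥ r l := by nlinarith
    have : u ⬝ᵥ r l ≤ 1 := by nlinarith
    omega
  obtain ⟨y, hyi, hyj, hyl⟩ := hex i hi j hj l hl hij hil hjl
  simp only [hul] at hequality
  have hparity := congrArg (y ⬝ᵥ ·) (hequality (by norm_num))
  simp only [zero_smul, zero_add, sub_zero, one_smul, dotProduct_add, dotProduct_sub, hyi, hyj,
    hyl] at hparity
  omega

theorem IsOrthonormalOn.exists_complement {ι : Type*} [DecidableEq ι] {s : Finset ι}
    {U : ι → J → ℤ} (hU : IsOrthonormalOn s U) : ∃ t : Finset J,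
      t.card + s.card = Fintype.card J ∧
        ∀ x y, x ⬝ᵥ y = ∑ j ∈ t, x j * y j + ∑ i ∈ s, (x ⬝ᵥ U i) * (y ⬝ᵥ U i) := by
  classical
  have hsingle : ∀ i : s, ∃ j ε, ε * ε = 1 ∧ U i = Pi.single j ε := fun i =>
    exists_eq_single_of_dotProduct_self_eq_one ((hU i i.2 i i.2).trans (if_pos rfl))
  choose f ε hε hf using hsingle
  have hinj : Function.Injective f := fun i j hij => by
    by_contra hne
    have horth := (hU i i.2 j j.2).trans (if_neg (Subtype.coe_ne_coe.2 hne))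
    rw [hf, hf, hij, single_dotProduct, Pi.single_eq_same] at horth
    exact mul_ne_zero (left_ne_zero_of_mul_eq_one (hε i)) (left_ne_zero_of_mul_eq_one (hε j)) horth
  refine ⟨Finset.univ \ Finset.univ.image f, ?_, fun x y => ?_⟩
  · rw [← Fintype.card_coe s, ← Finset.card_univ (α := s),
      ← Finset.card_image_of_injective _ hinj,
      Finset.card_sdiff_add_card_eq_card (Finset.subset_univ _), Finset.card_univ]
  · rw [dotProduct, ← Finset.sum_sdiff (Finset.subset_univ (Finset.univ.image f)),
      Finset.sum_image hinj.injOn,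
      ← Finset.sum_coe_sort s fun i => (x ⬝ᵥ U i) * (y ⬝ᵥ U i)]
    congr 1
    refine Finset.sum_congr rfl fun i _ => ?_
    rw [hf, dotProduct_single, dotProduct_single, mul_mul_mul_comm, hε, mul_one]

end IntegerVectors

section SetSystems

variable {ι α : Type*} [DecidableEq α] {B : ι → Finset α} {P Q R : Finset ι} {k l : ℕ}
  {x y : α → ℤ}

/-- `x` is orthogonal to the indicator vectors of the blocks `B i`, `i ∈ P`; these indicators play
the role of the vertices of a plumbing embedded in a diagonal lattice. -/
def IsFlow (B : ι → Finset α) (P : Finset ι) (x : α → ℤ) : Prop :=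
  ∀ i ∈ P, ∑ c ∈ B i, x c = 0

/-- The standard form on the coordinates covered by the blocks `B i`, `i ∈ P`. -/
def pairing (B : ι → Finset α) (P : Finset ι) (x y : α → ℤ) : ℤ :=
  ∑ c ∈ P.biUnion B, x c * y c

/-- `φ` is an isometry from the lattice of flows to the standard lattice on `J`. -/
def IsFlowIsometry {J : Type*} [Fintype J] (B : ι → Finset α) (P : Finset ι)
    (φ : (α → ℤ) → J → ℤ) : Prop :=
  ∀ x y, IsFlow B P x → IsFlow B P y → φ x ⬝ᵥ φ y = pairing B P x y

/-- The lattice of flows embeds in a standard lattice whose rank is smaller by `k` than the number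
of coordinates that the blocks cover. -/
def Compressible (B : ι → Finset α) (P : Finset ι) (k : ℕ) : Prop :=
  ∃ (J : Type) (_ : Fintype J) (φ : (α → ℤ) → J → ℤ),
    IsFlowIsometry B P φ ∧ Fintype.card J + k = (P.biUnion B).card

omit [DecidableEq α] in
theorem IsFlow.mono (hx : IsFlow B P x) (h : Q ⊆ P) : IsFlow B Q x :=
  fun i hi => hx i (h hi)

omit [DecidableEq α] in
theorem IsFlow.add (hx : IsFlow B P x) (hy : IsFlow B P y) : IsFlow B P (x + y) := fun i hi => by
  simp only [Pi.add_apply, Finset.sum_add_distrib, hx i hi, hy i hi, add_zero]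

omit [DecidableEq α] in
theorem IsFlow.smul (hx : IsFlow B P x) (n : ℤ) : IsFlow B P (n • x) := fun i hi => by
  simp only [Pi.smul_apply, smul_eq_mul, ← Finset.mul_sum, hx i hi, mul_zero]

omit [DecidableEq α] in
theorem IsFlow.sub (hx : IsFlow B P x) (hy : IsFlow B P y) : IsFlow B P (x - y) := fun i hi => by
  simp only [Pi.sub_apply, Finset.sum_sub_distrib, hx i hi, hy i hi, sub_zero]

theorem IsFlow.congr (hx : IsFlow B P x) (h : ∀ c ∈ P.biUnion B, x c = y c) : IsFlow B P y :=
  fun i hi => by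
    rw [← hx i hi]
    exact Finset.sum_congr rfl fun c hc => (h c (Finset.mem_biUnion.2 ⟨i, hi, hc⟩)).symm

theorem pairing_comm (x y : α → ℤ) : pairing B P x y = pairing B P y x :=
  Finset.sum_congr rfl fun _ _ => mul_comm _ _

theorem pairing_add_left (x x' y : α → ℤ) :
    pairing B P (x + x') y = pairing B P x y + pairing B P x' y := by
  simp only [pairing, Pi.add_apply, add_mul, Finset.sum_add_distrib]

theorem pairing_sub_left (x x' y : α → ℤ) :
    pairing B P (x - x') y = pairing B P x y - pairing B P x' y := by
  simp only [pairing, Pi.sub_apply, sub_mul, Finset.sum_sub_distrib]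

theorem pairing_smul_left (n : ℤ) (x y : α → ℤ) :
    pairing B P (n • x) y = n * pairing B P x y := by
  simp only [pairing, Pi.smul_apply, smul_eq_mul, Finset.mul_sum, mul_assoc]

theorem pairing_single_left {c : α} (hc : c ∈ P.biUnion B) (y : α → ℤ) :
    pairing B P (Pi.single c 1) y = y c := by
  rw [pairing, Finset.sum_eq_single_of_mem c hc fun d _ hd => by
    rw [Pi.single_eq_of_ne hd, zero_mul], Pi.single_eq_same, one_mul]

theorem pairing_eq_zero (h : ∀ X ∈ P, ∀ c ∈ B X, x c = 0 ∨ y c = 0) : pairing B P x y = 0 := by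
  refine Finset.sum_eq_zero fun c hc => mul_eq_zero.2 ?_
  obtain ⟨X, hX, hc⟩ := Finset.mem_biUnion.1 hc
  exact h X hX c hc

section Isometry

variable {J : Type*} [Fintype J] {φ : (α → ℤ) → J → ℤ}

theorem IsFlowIsometry.add (hφ : IsFlowIsometry B P φ) (hx : IsFlow B P x) (hy : IsFlow B P y) :
    φ (x + y) = φ x + φ y := by
  have hxy := hx.add hy
  rw [← sub_eq_zero, ← dotProduct_self_eq_zero]
  simp only [sub_dotProduct, dotProduct_sub, add_dotProduct, dotProduct_add, hφ _ _ hxy hxy,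
    hφ _ _ hx hxy, hφ _ _ hy hxy, hφ _ _ hxy hx, hφ _ _ hxy hy, hφ _ _ hx hx, hφ _ _ hx hy,
    hφ _ _ hy hx, hφ _ _ hy hy, pairing_add_left, pairing_comm _ (x + y)]
  ring

theorem IsFlowIsometry.smul (hφ : IsFlowIsometry B P φ) (hx : IsFlow B P x) (n : ℤ) :
    φ (n • x) = n • φ x := by
  have hnx := hx.smul n
  rw [← sub_eq_zero, ← dotProduct_self_eq_zero]
  simp only [sub_dotProduct, dotProduct_sub, smul_dotProduct, dotProduct_smul, smul_eq_mul,
    hφ _ _ hnx hnx, hφ _ _ hx hnx, hφ _ _ hnx hx, hφ _ _ hx hx, pairing_smul_left,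
    pairing_comm _ (n • x)]
  ring

theorem IsFlowIsometry.eq_zero (hφ : IsFlowIsometry B P φ) (hx : IsFlow B P x)
    (h : ∀ c ∈ P.biUnion B, x c = 0) : φ x = 0 := by
  rw [← dotProduct_self_eq_zero, hφ x x hx hx]
  exact Finset.sum_eq_zero fun c hc => by rw [h c hc, zero_mul]

end Isometry

theorem compressible_zero : Compressible B P 0 := by
  classical
  let e := (P.biUnion B).equivFin
  refine ⟨Fin (P.biUnion B).card, inferInstance, fun x j => x (e.symm j), fun x y _ _ => ?_,
    by rw [Fintype.card_fin, add_zero]⟩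
  exact (e.symm.sum_comp fun c => x c * y c).trans
    (Finset.sum_coe_sort (P.biUnion B) fun c => x c * y c)

theorem Compressible.mono (h : Compressible B P k) (hl : l ≤ k) : Compressible B P l := by
  obtain ⟨J, _, φ, hφ, hJ⟩ := h
  refine ⟨J ⊕ Fin (k - l), inferInstance, fun x => Sum.elim (φ x) 0, fun x y hx hy => ?_, ?_⟩
  · rw [← hφ x y hx hy, sumElim_dotProduct_sumElim, zero_dotProduct, add_zero]
  · rw [Fintype.card_sum, Fintype.card_fin]
    omega

variable [DecidableEq ι]

theorem Compressible.union (hQ : Compressible B Q k) (hR : Compressible B R l)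
    (h : Disjoint (Q.biUnion B) (R.biUnion B)) : Compressible B (Q ∪ R) (k + l) := by
  obtain ⟨J, _, φ, hφ, hJ⟩ := hQ
  obtain ⟨K, _, ψ, hψ, hK⟩ := hR
  refine ⟨J ⊕ K, inferInstance, fun x => Sum.elim (φ x) (ψ x), fun x y hx hy => ?_, ?_⟩
  · rw [sumElim_dotProduct_sumElim,
      hφ x y (hx.mono Finset.subset_union_left) (hy.mono Finset.subset_union_left),
      hψ x y (hx.mono Finset.subset_union_right) (hy.mono Finset.subset_union_right), pairing,
      pairing, pairing, Finset.union_biUnion, Finset.sum_union h]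
  · rw [Finset.union_biUnion, Finset.card_union_of_disjoint h, Fintype.card_sum]
    omega

omit [DecidableEq ι] in
theorem Compressible.superset (h : Compressible B Q k) (hQ : Q ⊆ P) : Compressible B P k := by
  obtain ⟨J, _, φ, hφ, hJ⟩ := h
  have hcover : Q.biUnion B ⊆ P.biUnion B := Finset.biUnion_subset_biUnion_of_subset_left B hQ
  let e := (P.biUnion B \ Q.biUnion B).equivFin
  refine ⟨J ⊕ Fin (P.biUnion B \ Q.biUnion B).card, inferInstance,
    fun x => Sum.elim (φ x) fun j => x (e.symm j), fun x y hx hy => ?_, ?_⟩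
  · rw [sumElim_dotProduct_sumElim, hφ x y (hx.mono hQ) (hy.mono hQ), pairing, pairing,
      ← Finset.sum_sdiff hcover, add_comm]
    congr 1
    exact (e.symm.sum_comp fun c => x c * y c).trans
      (Finset.sum_coe_sort (P.biUnion B \ Q.biUnion B) fun c => x c * y c)
  · rw [Fintype.card_sum, Fintype.card_fin, ← Finset.card_sdiff_add_card_eq_card hcover]
    omega

end SetSystems

section Counting

variable {ι α β : Type*} [DecidableEq ι] {P : Finset ι}

theorem card_filter_subset {s : Finset α} {F : α → Finset ι}
    (hF : ∀ c ∈ s, F c ⊆ P) (T : Finset ι) :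
    {c ∈ s | T ⊆ F c}.card =
      {c ∈ s | F c = T}.card + ∑ S ∈ P.powerset with T ⊂ S, {c ∈ s | F c = S}.card := by
  have hlt : {c ∈ s | T ⊂ F c}.card = ∑ S ∈ P.powerset with T ⊂ S, {c ∈ s | F c = S}.card := by
    rw [Finset.card_eq_sum_card_fiberwise (f := F) (t := {S ∈ P.powerset | T ⊂ S}) fun c hc => by
      simpa [hF c (Finset.mem_filter.1 hc).1] using (Finset.mem_filter.1 hc).2]
    refine Finset.sum_congr rfl fun S hS => ?_
    rw [Finset.filter_filter]
    congr 1
    exact Finset.filter_congr fun c _ =>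
      ⟨And.right, fun h => ⟨h ▸ (Finset.mem_filter.1 hS).2, h⟩⟩
  classical
  rw [← hlt, ← Finset.card_union_of_disjoint, ← Finset.filter_or]
  · congr 1
    exact Finset.filter_congr fun c _ => by rw [subset_iff_ssubset_or_eq, or_comm, eq_comm]
  · exact Finset.disjoint_filter.2 fun c _ h => by rw [h]; exact ssubset_irrefl T

theorem card_filter_eq_of_card_filter_subset {s : Finset α} {t : Finset β}
    {F : α → Finset ι} {G : β → Finset ι} (hF : ∀ c ∈ s, F c ⊆ P ∧ (F c).Nonempty)
    (hG : ∀ d ∈ t, G d ⊆ P ∧ (G d).Nonempty)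
    (h : ∀ T ⊆ P, T.Nonempty → {c ∈ s | T ⊆ F c}.card = {d ∈ t | T ⊆ G d}.card)
    (T : Finset ι) : {c ∈ s | F c = T}.card = {d ∈ t | G d = T}.card := by
  by_cases! hT : T ⊆ P → ¬ T.Nonempty
  · rw [Finset.filter_false_of_mem fun c hc (hcT : F c = T) => hT (hcT ▸ (hF c hc).1)
      (hcT ▸ (hF c hc).2), Finset.filter_false_of_mem fun d hd (hdT : G d = T) =>
      hT (hdT ▸ (hG d hd).1) (hdT ▸ (hG d hd).2), Finset.card_empty, Finset.card_empty]
  refine Finset.strongDownwardInduction (n := P.card)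
    (p := fun T => T ⊆ P ∧ T.Nonempty → {c ∈ s | F c = T}.card = {d ∈ t | G d = T}.card)
    (fun T ih _ hT => ?_) T (Finset.card_le_card hT.1) hT
  have hcard := h T hT.1 hT.2
  rw [card_filter_subset fun c hc => (hF c hc).1, card_filter_subset fun d hd => (hG d hd).1]
    at hcard
  have hsum : ∑ S ∈ P.powerset with T ⊂ S, {c ∈ s | F c = S}.card =
      ∑ S ∈ P.powerset with T ⊂ S, {d ∈ t | G d = S}.card :=
    Finset.sum_congr rfl fun S hS => by
      obtain ⟨hSP, hTS⟩ := Finset.mem_filter.1 hS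
      rw [Finset.mem_powerset] at hSP
      exact ih (Finset.card_le_card hSP) hTS ⟨hSP, hT.2.mono hTS.subset⟩
  omega

omit [DecidableEq ι] in
theorem exists_equiv_of_card_filter_eq {γ : Type*} [DecidableEq γ] {s : Finset α} {t : Finset β}
    {F : α → γ} {G : β → γ} (h : ∀ T, {c ∈ s | F c = T}.card = {d ∈ t | G d = T}.card) :
    ∃ e : s ≃ t, ∀ c, G (e c) = F c := by
  let hs (T : γ) : {c : s // F c = T} ≃ ({c ∈ s | F c = T} : Finset α) :=
    (Equiv.subtypeSubtypeEquivSubtypeInter (· ∈ s) (F · = T)).trans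
      (Equiv.subtypeEquivRight fun _ => by rw [Finset.mem_filter])
  let ht (T : γ) : {d : t // G d = T} ≃ ({d ∈ t | G d = T} : Finset β) :=
    (Equiv.subtypeSubtypeEquivSubtypeInter (· ∈ t) (G · = T)).trans
      (Equiv.subtypeEquivRight fun _ => by rw [Finset.mem_filter])
  exact ⟨Equiv.ofFiberEquiv (f := fun c : s => F c) (g := fun d : t => G d) fun T =>
    (hs T).trans ((Finset.equivOfCardEq (h T)).trans (ht T).symm),
    Equiv.ofFiberEquiv_map (f := fun c : s => F c) (g := fun d : t => G d) _⟩

omit [DecidableEq ι] in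
theorem subset_filter_iff {p : ι → Prop} [DecidablePred p] {T : Finset ι} (hT : T ⊆ P) :
    T ⊆ {i ∈ P | p i} ↔ ∀ i ∈ T, p i :=
  ⟨fun h _ hi => (Finset.mem_filter.1 (h hi)).2,
    fun h i hi => Finset.mem_filter.2 ⟨hT hi, h i hi⟩⟩

omit [DecidableEq ι] in
theorem filter_mem_nonempty [DecidableEq α] {B : ι → Finset α} {c : α} :
    {i ∈ P | c ∈ B i}.Nonempty ↔ c ∈ P.biUnion B := by
  simp only [Finset.Nonempty, Finset.mem_filter, Finset.mem_biUnion]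

end Counting

section Transport

variable {ι α β : Type*} [DecidableEq α] [DecidableEq β] {B : ι → Finset α} {C : ι → Finset β}
  {P : Finset ι} {k : ℕ}

theorem Compressible.of_equiv (h : Compressible B P k) (e : P.biUnion B ≃ P.biUnion C)
    (he : ∀ i ∈ P, ∀ c : P.biUnion B, (c : α) ∈ B i ↔ (e c : β) ∈ C i) : Compressible C P k := by
  obtain ⟨J, _, φ, hφ, hJ⟩ := h
  let pull (x : β → ℤ) (c : α) : ℤ := if hc : c ∈ P.biUnion B then x (e ⟨c, hc⟩) else 0
  have hpull : ∀ x (c : P.biUnion B), pull x c = x (e c) := fun x c => dif_pos c.2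
  have hsum : ∀ i ∈ P, ∀ x : β → ℤ, ∑ c ∈ B i, pull x c = ∑ d ∈ C i, x d := fun i hi x => by
    have hB : ∀ c ∈ B i, c ∈ P.biUnion B := fun c hc => Finset.mem_biUnion.2 ⟨i, hi, hc⟩
    have hC : ∀ d ∈ C i, d ∈ P.biUnion C := fun d hd => Finset.mem_biUnion.2 ⟨i, hi, hd⟩
    refine Finset.sum_bij' (fun c hc => e ⟨c, hB c hc⟩) (fun d hd => e.symm ⟨d, hC d hd⟩)
      (fun c hc => (he i hi _).1 hc) (fun d hd => (he i hi _).2 ?_) (fun c hc => ?_)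
      (fun d hd => ?_) fun c hc => hpull x ⟨c, hB c hc⟩
    · rwa [Equiv.apply_symm_apply]
    · simp only [Subtype.coe_eta, Equiv.symm_apply_apply]
    · simp only [Subtype.coe_eta, Equiv.apply_symm_apply]
  have hflow : ∀ x, IsFlow C P x → IsFlow B P (pull x) := fun x hx i hi =>
    (hsum i hi x).trans (hx i hi)
  refine ⟨J, inferInstance, fun x => φ (pull x), fun x y hx hy => ?_, ?_⟩
  · rw [hφ _ _ (hflow x hx) (hflow y hy), pairing, pairing, ← Finset.sum_coe_sort,
      ← Finset.sum_coe_sort (P.biUnion C)]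
    simp only [hpull]
    exact e.sum_comp fun d => x d * y d
  · rw [hJ, ← Fintype.card_coe, ← Fintype.card_coe (P.biUnion C)]
    exact Fintype.card_congr e

/-- By Möbius inversion over the subsets of `P`, the cardinalities of the intersections of blocks
determine how many coordinates lie in exactly the blocks `B i`, `i ∈ T`. -/
theorem Compressible.congr_card (h : Compressible B P k)
    (hcard : ∀ T ⊆ P, T.Nonempty →
      {c ∈ P.biUnion B | ∀ i ∈ T, c ∈ B i}.card = {d ∈ P.biUnion C | ∀ i ∈ T, d ∈ C i}.card) :
    Compressible C P k := by
  classical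
  obtain ⟨e, he⟩ := exists_equiv_of_card_filter_eq <| card_filter_eq_of_card_filter_subset
    (P := P) (s := P.biUnion B) (t := P.biUnion C) (F := fun c => {i ∈ P | c ∈ B i})
    (G := fun d => {i ∈ P | d ∈ C i})
    (fun c hc => ⟨Finset.filter_subset _ _, filter_mem_nonempty.2 hc⟩)
    (fun d hd => ⟨Finset.filter_subset _ _, filter_mem_nonempty.2 hd⟩)
    fun T hTP hT => by simpa only [subset_filter_iff hTP] using hcard T hTP hT
  refine h.of_equiv e fun i hi c => ?_
  simpa only [Finset.mem_filter, hi, true_and, eq_iff_iff] using congrArg (i ∈ ·) (he c).symm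

theorem filter_biUnion_forall_mem {T : Finset ι} [DecidableEq ι] {i : ι} (hT : T ⊆ P)
    (hi : i ∈ T) :
    {c ∈ P.biUnion B | ∀ j ∈ T, c ∈ B j} = {c ∈ B i | ∀ j ∈ T.erase i, c ∈ B j} := by
  ext c
  simp only [Finset.mem_filter, Finset.mem_biUnion, Finset.mem_erase]
  exact ⟨fun hc => ⟨hc.2 i hi, fun j hj => hc.2 j hj.2⟩, fun hc => ⟨⟨i, hT hi, hc.1⟩,
    fun j hj => if hji : j = i then hji ▸ hc.1 else hc.2 j ⟨hji, hj⟩⟩⟩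

theorem Compressible.image {κ : Type*} [DecidableEq κ] {B : κ → Finset α} {f : ι → κ}
    (h : Compressible (fun i => B (f i)) P k) : Compressible B (P.image f) k := by
  obtain ⟨J, hJ', φ, hφ, hJ⟩ := h
  refine ⟨J, hJ', φ, fun x y hx hy => ?_, ?_⟩
  · rw [hφ x y (fun i hi => hx _ (Finset.mem_image_of_mem f hi))
      fun i hi => hy _ (Finset.mem_image_of_mem f hi), pairing, pairing, Finset.image_biUnion]
  · rw [hJ, Finset.image_biUnion]

end Transport

section Own

variable {ι α : Type*} [DecidableEq ι] [DecidableEq α] {B : ι → Finset α} {P : Finset ι} {k : ℕ}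
  {X Y : ι} {x y : α → ℤ} {c d : α}

/-- The coordinates of the block `B X` that lie in no other block `B i`, `i ∈ P`. -/
def own (B : ι → Finset α) (P : Finset ι) (X : ι) : Finset α :=
  B X \ (P.erase X).biUnion B

theorem biUnion_eq_union_own (hX : X ∈ P) :
    P.biUnion B = (P.erase X).biUnion B ∪ own B P X := by
  conv_lhs => rw [← Finset.insert_erase hX]
  rw [own, Finset.union_sdiff_self_eq_union, Finset.biUnion_insert, Finset.union_comm]

theorem disjoint_biUnion_own : Disjoint ((P.erase X).biUnion B) (own B P X) :=
  Finset.disjoint_sdiff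

theorem own_subset_biUnion (hX : X ∈ P) : own B P X ⊆ P.biUnion B := by
  rw [biUnion_eq_union_own hX]
  exact Finset.subset_union_right

theorem mem_block_iff_of_mem_own (hY : Y ∈ P) (hc : c ∈ own B P X) : c ∈ B Y ↔ Y = X := by
  obtain ⟨hcX, hcP⟩ := Finset.mem_sdiff.1 hc
  refine ⟨fun hcY => ?_, fun h => h ▸ hcX⟩
  by_contra hne
  exact hcP (Finset.mem_biUnion.2 ⟨Y, Finset.mem_erase.2 ⟨hne, hY⟩, hcY⟩)

theorem eq_of_mem_own_of_mem_own (hX : X ∈ P) (hcX : c ∈ own B P X) (hcY : c ∈ own B P Y) :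
    X = Y :=
  (mem_block_iff_of_mem_own hX hcY).1 (Finset.mem_sdiff.1 hcX).1

theorem exists_isFlow_extension (hx : IsFlow B (P.erase X) x) (hc : c ∈ own B P X) :
    ∃ y, IsFlow B P y ∧ ∀ d ∈ (P.erase X).biUnion B, y d = x d := by
  refine ⟨x - (∑ d ∈ B X, x d) • Pi.single c 1, fun i hi => ?_, fun d hd => ?_⟩
  · simp only [Pi.sub_apply, Pi.smul_apply, Finset.sum_sub_distrib, ← Finset.smul_sum,
      Finset.sum_pi_single', mem_block_iff_of_mem_own hi hc]
    split_ifs with hiX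
    · rw [hiX, smul_eq_mul, mul_one, sub_self]
    · rw [smul_zero, sub_zero, hx i (Finset.mem_erase.2 ⟨hiX, hi⟩)]
  · have hdc : d ≠ c := Finset.disjoint_left.1 disjoint_biUnion_own hd |>.imp_symm fun h => by
      rwa [not_not.1 h]
    simp only [Pi.sub_apply, Pi.smul_apply, Pi.single_eq_of_ne hdc, smul_zero, sub_zero]

/-- The difference of two basis vectors. -/
def diff (c d : α) : α → ℤ := Pi.single c 1 - Pi.single d 1

omit [DecidableEq ι] in
theorem diff_apply (c d e : α) :
    diff c d e = (if e = c then 1 else 0) - if e = d then 1 else 0 := by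
  rw [diff, Pi.sub_apply, Pi.single_apply, Pi.single_apply]

theorem isFlow_diff (hc : c ∈ own B P X) (hd : d ∈ own B P X) : IsFlow B P (diff c d) :=
  fun i hi => by
    simp only [diff, Pi.sub_apply, Finset.sum_sub_distrib, Finset.sum_pi_single',
      mem_block_iff_of_mem_own hi hc, mem_block_iff_of_mem_own hi hd, sub_self]

theorem pairing_diff (hX : X ∈ P) (hc : c ∈ own B P X) (hd : d ∈ own B P X) (y : α → ℤ) :
    pairing B P (diff c d) y = y c - y d := by
  rw [diff, pairing_sub_left, pairing_single_left (own_subset_biUnion hX hc),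
    pairing_single_left (own_subset_biUnion hX hd)]

theorem sum_diff_own (hX : X ∈ P) (hc : c ∈ own B P X) (hd : d ∈ own B P X) :
    ∑ e ∈ own B P Y, diff c d e = 0 := by
  have hmem : ∀ {e}, e ∈ own B P X → (e ∈ own B P Y ↔ X = Y) := fun he =>
    ⟨eq_of_mem_own_of_mem_own hX he, fun h => h ▸ he⟩
  simp only [diff, Pi.sub_apply, Finset.sum_sub_distrib, Finset.sum_pi_single', hmem hc, hmem hd,
    sub_self]

variable {J : Type*} [Fintype J] {φ : (α → ℤ) → J → ℤ} {U : α → J → ℤ} {τ : (α → ℤ) → ℤ}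

theorem IsFlowIsometry.dotProduct_diff (hφ : IsFlowIsometry B P φ) (hx : IsFlow B P x)
    (hX : X ∈ P) (hc : c ∈ own B P X) (hd : d ∈ own B P X) :
    φ x ⬝ᵥ φ (diff c d) = x c - x d := by
  rw [dotProduct_comm, hφ _ _ (isFlow_diff hc hd) hx, pairing_diff hX hc hd]

/-- The vectors `U c` stand for the coordinates `c` that only the vertex `X` meets: the isometry
`φ` reads off these coordinates along them, up to a common error `τ`. -/
structure IsUnits (B : ι → Finset α) (P : Finset ι) (φ : (α → ℤ) → J → ℤ) (X : ι)
    (U : α → J → ℤ) (τ : (α → ℤ) → ℤ) : Prop where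
  orthonormal : IsOrthonormalOn (own B P X) U
  dotProduct_eq : ∀ x, IsFlow B P x → ∀ c ∈ own B P X, φ x ⬝ᵥ U c = x c + τ x

/-- The vectors `φ (diff c₀ c)` have square `2` and pairwise products `1`; the third hypothesis
excludes the exceptional configuration `e₁ + e₂`, `e₁ + e₃`, `e₂ + e₃`. -/
theorem IsFlowIsometry.exists_unit (hφ : IsFlowIsometry B P φ) (hX : X ∈ P) {c₀ : α}
    (hc₀ : c₀ ∈ own B P X) (hcard : 3 ≤ (own B P X).card)
    (hfour : (own B P X).card = 4 →
      ∃ y, IsFlow B P y ∧ y c₀ = 1 ∧ ∀ c ∈ own B P X, c ≠ c₀ → y c = 0) :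
    ∃ u : J → ℤ, u ⬝ᵥ u = 1 ∧ ∀ c ∈ own B P X, c ≠ c₀ → u ⬝ᵥ φ (diff c₀ c) = 1 := by
  have hdot : ∀ x, IsFlow B P x → ∀ c ∈ own B P X, φ x ⬝ᵥ φ (diff c₀ c) = x c₀ - x c :=
    fun x hx c hc => hφ.dotProduct_diff hx hX hc₀ hc
  have herase := Finset.card_erase_add_one hc₀
  have hone : ∀ c ∈ (own B P X).erase c₀, ∀ d ∈ (own B P X).erase c₀, c ≠ d →
      φ (diff c₀ c) ⬝ᵥ φ (diff c₀ d) = 1 := by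
    simp only [Finset.mem_erase, and_imp]
    intro c hcc₀ hc d hdc₀ hd hcd
    rw [hdot _ (isFlow_diff hc₀ hc) d hd, diff_apply, diff_apply, if_pos rfl, if_neg hcc₀.symm,
      if_neg hdc₀, if_neg hcd.symm, sub_zero, sub_zero, sub_zero]
  have htwo : ∀ c ∈ (own B P X).erase c₀, φ (diff c₀ c) ⬝ᵥ φ (diff c₀ c) = 2 := fun c hc => by
    obtain ⟨hcc₀, hc⟩ := Finset.mem_erase.1 hc
    rw [hdot _ (isFlow_diff hc₀ hc) c hc, diff_apply, diff_apply, if_pos rfl, if_neg hcc₀.symm,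
      if_neg hcc₀, if_pos rfl]
    norm_num
  suffices hex : ∀ i ∈ (own B P X).erase c₀, ∀ j ∈ (own B P X).erase c₀,
      ∀ l ∈ (own B P X).erase c₀, i ≠ j → i ≠ l → j ≠ l → ∃ y, y ⬝ᵥ φ (diff c₀ i) = 1 ∧
        y ⬝ᵥ φ (diff c₀ j) = 1 ∧ y ⬝ᵥ φ (diff c₀ l) = 1 by
    obtain ⟨u, huu, hu⟩ := exists_common_unit_of_finset _ _ htwo hone (by omega) hex
    exact ⟨u, huu, fun c hc hcc₀ => hu c (Finset.mem_erase.2 ⟨hcc₀, hc⟩)⟩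
  intro i hi j hj l hl hij hil hjl
  by_cases h4 : (own B P X).card = 4
  · obtain ⟨y, hy, hy₀, hyc⟩ := hfour h4
    have hone' : ∀ c ∈ (own B P X).erase c₀, φ y ⬝ᵥ φ (diff c₀ c) = 1 := fun c hc => by
      obtain ⟨hcc₀, hc⟩ := Finset.mem_erase.1 hc
      rw [hdot y hy c hc, hy₀, hyc c hc hcc₀, sub_zero]
    exact ⟨φ y, hone' i hi, hone' j hj, hone' l hl⟩
  · have hthree : ({i, j, l} : Finset α).card = 3 := Finset.card_eq_three.2
      ⟨i, j, l, hij, hil, hjl, rfl⟩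
    have hle := Finset.card_le_card (Finset.insert_subset hi
      (Finset.insert_subset hj (Finset.singleton_subset_iff.2 hl)))
    obtain ⟨m, hm, hmne⟩ := Finset.exists_mem_notMem_of_card_lt_card
      (s := {i, j, l}) (t := (own B P X).erase c₀) (by omega)
    simp only [Finset.mem_insert, Finset.mem_singleton, not_or] at hmne
    exact ⟨φ (diff c₀ m), hone m hm i hi hmne.1, hone m hm j hj hmne.2.1,
      hone m hm l hl hmne.2.2⟩

theorem IsFlowIsometry.exists_isUnits (hφ : IsFlowIsometry B P φ) (hX : X ∈ P) {c₀ : α}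
    (hc₀ : c₀ ∈ own B P X) (hcard : 3 ≤ (own B P X).card)
    (hfour : (own B P X).card = 4 →
      ∃ y, IsFlow B P y ∧ y c₀ = 1 ∧ ∀ c ∈ own B P X, c ≠ c₀ → y c = 0) :
    ∃ U τ, IsUnits B P φ X U τ := by
  obtain ⟨u, huu, hu⟩ := hφ.exists_unit hX hc₀ hcard hfour
  have hdiff : ∀ c ∈ own B P X, u ⬝ᵥ φ (diff c₀ c) = 1 - if c₀ = c then 1 else 0 :=
    fun c hc => by
      split_ifs with h
      · rw [← h, hφ.eq_zero (isFlow_diff hc₀ hc₀) fun e _ => by rw [diff_apply, sub_self],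
          dotProduct_zero, sub_self]
      · rw [hu c hc (Ne.symm h), sub_zero]
  refine ⟨fun c => u - φ (diff c₀ c), fun x => φ x ⬝ᵥ u - x c₀, fun c hc d hd => ?_,
    fun x hx c hc => ?_⟩
  · rw [sub_dotProduct, dotProduct_sub, dotProduct_sub,
      dotProduct_comm (φ (diff c₀ c)) u, huu, hdiff c hc,
      hdiff d hd, hφ.dotProduct_diff (isFlow_diff hc₀ hc) hX hc₀ hd, diff_apply, diff_apply]
    simp only [eq_comm (a := d), if_true]
    ring
  · rw [dotProduct_sub, hφ.dotProduct_diff hx hX hc₀ hc]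
    ring

theorem IsUnits.sum_sq_dotProduct (hU : IsUnits B P φ X U τ) (hx : IsFlow B P x) :
    ∑ c ∈ own B P X, (φ x ⬝ᵥ U c) ^ 2 =
      ∑ c ∈ own B P X, x c ^ 2 + 2 * τ x * ∑ c ∈ own B P X, x c +
        (own B P X).card * τ x ^ 2 := by
  rw [Finset.sum_congr rfl fun c hc => congrArg (· ^ 2) (hU.dotProduct_eq x hx c hc)]
  simp only [add_sq, Finset.sum_add_distrib, ← Finset.sum_mul, ← Finset.mul_sum,
    Finset.sum_const, nsmul_eq_mul]
  ring

section Bessel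

variable (hU : IsUnits B P φ X U τ) (hφ : IsFlowIsometry B P φ)
include hU hφ

theorem IsUnits.sum_sq_le_pairing (hx : IsFlow B P x) :
    ∑ c ∈ own B P X, (x c + τ x) ^ 2 ≤ pairing B P x x := by
  rw [← hφ x x hx hx,
    Finset.sum_congr rfl fun c hc => congrArg (· ^ 2) (hU.dotProduct_eq x hx c hc).symm]
  exact hU.orthonormal.sum_sq_dotProduct_le (φ x)

theorem IsUnits.sum_sq_add_card_mul_sq_le_pairing (hx : IsFlow B P x)
    (hsum : ∑ c ∈ own B P X, x c = 0) :
    ∑ c ∈ own B P X, x c ^ 2 + (own B P X).card * τ x ^ 2 ≤ pairing B P x x := by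
  have h := hU.orthonormal.sum_sq_dotProduct_le (φ x)
  rwa [hφ x x hx hx, hU.sum_sq_dotProduct hx, hsum, mul_zero, add_zero] at h

theorem IsUnits.card_mul_sq_le_pairing (hx : IsFlow B P x) (hzero : ∀ c ∈ own B P X, x c = 0) :
    (own B P X).card * τ x ^ 2 ≤ pairing B P x x := by
  refine le_trans ?_
    (hU.sum_sq_add_card_mul_sq_le_pairing hφ hx (Finset.sum_eq_zero hzero))
  exact le_add_of_nonneg_left (Finset.sum_nonneg fun _ _ => sq_nonneg _)

theorem IsUnits.sq_add_card_sub_one_mul_sq_le_pairing (hx : IsFlow B P x)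
    (hc : c ∈ own B P X) (hzero : ∀ d ∈ own B P X, d ≠ c → x d = 0) :
    (x c + τ x) ^ 2 + ((own B P X).card - 1) * τ x ^ 2 ≤ pairing B P x x := by
  refine le_trans (le_of_eq ?_) (hU.sum_sq_le_pairing hφ hx)
  rw [← Finset.add_sum_erase _ _ hc, Finset.sum_congr rfl fun d hd => by
    rw [hzero d (Finset.mem_of_mem_erase hd) (Finset.ne_of_mem_erase hd), zero_add],
    Finset.sum_const, nsmul_eq_mul, Finset.cast_card_erase_of_mem hc]

theorem IsUnits.tau_add (hc : c ∈ own B P X) (hx : IsFlow B P x) (hy : IsFlow B P y) :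
    τ (x + y) = τ x + τ y := by
  have h := hU.dotProduct_eq _ (hx.add hy) c hc
  rw [hφ.add hx hy, add_dotProduct, hU.dotProduct_eq x hx c hc, hU.dotProduct_eq y hy c hc,
    Pi.add_apply] at h
  linarith

theorem IsUnits.tau_smul (hc : c ∈ own B P X) (hx : IsFlow B P x) (n : ℤ) :
    τ (n • x) = n * τ x := by
  have h := hU.dotProduct_eq _ (hx.smul n) c hc
  rw [hφ.smul hx, smul_dotProduct, hU.dotProduct_eq x hx c hc, Pi.smul_apply, smul_eq_mul,
    smul_eq_mul] at h
  linarith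

theorem IsUnits.tau_eq_zero (hX : X ∈ P) (hc : c ∈ own B P X) (hx : IsFlow B P x)
    (h : ∀ d ∈ P.biUnion B, x d = 0) : τ x = 0 := by
  have hτ := hU.dotProduct_eq x hx c hc
  rwa [hφ.eq_zero hx h, zero_dotProduct, h c (own_subset_biUnion hX hc), zero_add, eq_comm] at hτ

theorem IsUnits.tau_diff (hcard : 3 ≤ (own B P X).card) (hY : Y ∈ P)
    (hc : c ∈ own B P Y) (hd : d ∈ own B P Y) : τ (diff c d) = 0 := by
  have hbessel := hU.sum_sq_add_card_mul_sq_le_pairing hφ (isFlow_diff hc hd)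
    (sum_diff_own hY hc hd)
  rw [pairing_diff hY hc hd, diff_apply, diff_apply, if_pos rfl, if_pos rfl] at hbessel
  have hsq : 0 ≤ ∑ e ∈ own B P X, diff c d e ^ 2 := Finset.sum_nonneg fun _ _ => sq_nonneg _
  have : (3 : ℤ) ≤ (own B P X).card := by exact_mod_cast hcard
  by_contra hne
  have : 0 < τ (diff c d) ^ 2 := by positivity
  split_ifs at hbessel <;> nlinarith

end Bessel

/-- If all errors vanish, then the vectors `U c` split off as an orthogonal summand, and `X` can be
removed. -/
theorem IsUnits.compressible_erase {J : Type} [Fintype J] {φ : (α → ℤ) → J → ℤ} {U : α → J → ℤ}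
    (hU : IsUnits B P φ X U τ) (hφ : IsFlowIsometry B P φ)
    (hJ : Fintype.card J + k = (P.biUnion B).card) (hX : X ∈ P) (hc : c ∈ own B P X)
    (hτ : ∀ x, IsFlow B P x → τ x = 0) : Compressible B (P.erase X) k := by
  obtain ⟨t, ht, hdot⟩ := hU.orthonormal.exists_complement
  have hext : ∀ x, ∃ y, IsFlow B (P.erase X) x →
      IsFlow B P y ∧ ∀ d ∈ (P.erase X).biUnion B, y d = x d := fun x => by
    by_cases hx : IsFlow B (P.erase X) x
    · obtain ⟨y, hy⟩ := exists_isFlow_extension hx hc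
      exact ⟨y, fun _ => hy⟩
    · exact ⟨x, fun h => absurd h hx⟩
  choose ext hext using hext
  refine ⟨t, inferInstance, fun x j => φ (ext x) j, fun x y hx hy => ?_, ?_⟩
  · obtain ⟨hx', hxeq⟩ := hext x hx
    obtain ⟨hy', hyeq⟩ := hext y hy
    have hown : ∑ c ∈ own B P X, (φ (ext x) ⬝ᵥ U c) * (φ (ext y) ⬝ᵥ U c) =
        ∑ c ∈ own B P X, ext x c * ext y c := Finset.sum_congr rfl fun c hc => by
      rw [hU.dotProduct_eq _ hx' c hc, hU.dotProduct_eq _ hy' c hc, hτ _ hx', hτ _ hy', add_zero,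
        add_zero]
    have hsplit := hφ _ _ hx' hy'
    rw [hdot, hown, pairing, biUnion_eq_union_own hX, Finset.sum_union disjoint_biUnion_own,
      add_left_inj] at hsplit
    rw [pairing, dotProduct, Finset.sum_coe_sort t fun j => φ (ext x) j * φ (ext y) j, hsplit]
    exact Finset.sum_congr rfl fun d hd => by rw [hxeq d hd, hyeq d hd]
  · rw [biUnion_eq_union_own hX, Finset.card_union_of_disjoint disjoint_biUnion_own] at hJ
    rw [Fintype.card_coe]
    omega

end Own

section Block

variable {a : ℤ → ℕ} {P Q R : Finset ℤ} {k : ℕ} {i j l p q : ℤ} {c : ℤ × ℕ}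

/-- The coordinates met by the vertex of weight `-a i` at position `i` of a chain: consecutive
vertices share the coordinate `(i + 1, 0)`. -/
def block (a : ℤ → ℕ) (i : ℤ) : Finset (ℤ × ℕ) :=
  insert (i + 1, 0) ((Finset.range (a i - 1)).image (i, ·))

theorem mem_block : c ∈ block a i ↔ c = (i + 1, 0) ∨ (c.1 = i ∧ c.2 < a i - 1) := by
  rcases c with ⟨p, t⟩
  simp only [block, Finset.mem_insert, Finset.mem_image, Finset.mem_range, Prod.mk.injEq]
  constructor
  · rintro (h | ⟨s, hs, rfl, rfl⟩)
    · exact Or.inl h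
    · exact Or.inr ⟨rfl, hs⟩
  · rintro (h | ⟨rfl, hs⟩)
    · exact Or.inl h
    · exact Or.inr ⟨t, hs, rfl, rfl⟩

theorem right_mem_block : (i + 1, 0) ∈ block a i :=
  mem_block.2 (Or.inl rfl)

theorem left_mem_block (h : 2 ≤ a i) : (i, 0) ∈ block a i :=
  mem_block.2 (Or.inr ⟨rfl, by omega⟩)

theorem eq_of_mem_block_of_mem_block (hi : c ∈ block a i) (hj : c ∈ block a j) (hij : i < j) :
    j = i + 1 ∧ c = (j, 0) := by
  simp only [mem_block, Prod.ext_iff] at hi hj ⊢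
  omega

theorem sum_block {M : Type*} [AddCommMonoid M] (a : ℤ → ℕ) (i : ℤ) (f : ℤ × ℕ → M) :
    ∑ c ∈ block a i, f c = f (i + 1, 0) + ∑ t ∈ Finset.range (a i - 1), f (i, t) := by
  rw [block, Finset.sum_insert (by simp), Finset.sum_image (by simp)]

theorem card_block (h : 1 ≤ a i) : (block a i).card = a i := by
  rw [Finset.card_eq_sum_ones, sum_block, Finset.sum_const, Finset.card_range, smul_eq_mul]
  omega

theorem card_block_inter_block (hi : 2 ≤ a i) (hj : 2 ≤ a j) (hij : i ≠ j) :
    (block a i ∩ block a j).card = if j = i + 1 ∨ i = j + 1 then 1 else 0 := by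
  wlog hlt : i < j generalizing i j
  · rw [Finset.inter_comm, this hj hi hij.symm (by omega), if_congr or_comm rfl rfl]
  · split_ifs with h
    · obtain rfl : j = i + 1 := by omega
      refine Finset.card_eq_one.2 ⟨(i + 1, 0), Finset.eq_singleton_iff_unique_mem.2
        ⟨Finset.mem_inter.2 ⟨right_mem_block, left_mem_block hj⟩, fun c hc => ?_⟩⟩
      obtain ⟨hci, hcj⟩ := Finset.mem_inter.1 hc
      exact (eq_of_mem_block_of_mem_block hci hcj hlt).2
    · refine Finset.card_eq_zero.2 (Finset.eq_empty_of_forall_notMem fun c hc => h ?_)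
      obtain ⟨hci, hcj⟩ := Finset.mem_inter.1 hc
      exact Or.inl (eq_of_mem_block_of_mem_block hci hcj hlt).1

theorem not_mem_three_blocks (hij : i ≠ j) (hil : i ≠ l) (hjl : j ≠ l) :
    ¬ (c ∈ block a i ∧ c ∈ block a j ∧ c ∈ block a l) := by
  simp only [mem_block, Prod.ext_iff]
  omega

theorem Compressible.image_block {a' : ℤ → ℕ} {f : ℤ → ℤ} (h : Compressible (block a') P k)
    (h2 : ∀ i ∈ P, 2 ≤ a' i) (hinj : ∀ i ∈ P, ∀ j ∈ P, f i = f j → i = j)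
    (hadj : ∀ i ∈ P, ∀ j ∈ P, (f j = f i + 1 ∨ f i = f j + 1) ↔ (j = i + 1 ∨ i = j + 1))
    (hw : ∀ i ∈ P, a (f i) = a' i) : Compressible (block a) (P.image f) k := by
  have hcomp : Compressible (fun i => block a (f i)) P k := h.congr_card fun T hT hne => by
    obtain ⟨i, hi⟩ := hne
    rw [filter_biUnion_forall_mem hT hi, filter_biUnion_forall_mem hT hi]
    have hiP := hT hi
    have ha' := h2 i hiP
    rcases (T.erase i).eq_empty_or_nonempty with h0 | ⟨j, hj⟩
    · simp only [h0, Finset.notMem_empty, false_imp_iff, implies_true, Finset.filter_true]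
      rw [card_block (by omega), card_block (by rw [hw i hiP]; omega), hw i hiP]
    obtain ⟨hji, hjT⟩ := Finset.mem_erase.1 hj
    have hjP := hT hjT
    rcases ((T.erase i).erase j).eq_empty_or_nonempty with h0 | ⟨l, hl⟩
    · have h0 : T.erase i = {j} := by rw [← Finset.insert_erase hj, h0, insert_empty_eq]
      simp only [h0, Finset.mem_singleton, forall_eq, Finset.filter_mem_eq_inter]
      rw [card_block_inter_block ha' (h2 j hjP) hji.symm, card_block_inter_block
        (by rw [hw i hiP]; exact ha') (by rw [hw j hjP]; exact h2 j hjP)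
        fun h => hji (hinj i hiP j hjP h).symm, if_congr (hadj i hiP j hjP) rfl rfl]
    · obtain ⟨hlj, hli, hlT⟩ : l ≠ j ∧ l ≠ i ∧ l ∈ T := by simpa using hl
      have hlP := hT hlT
      rw [Finset.filter_false_of_mem fun c hc hcT => not_mem_three_blocks hji.symm hli.symm hlj.symm
          ⟨hc, hcT j hj, hcT l (Finset.mem_of_mem_erase hl)⟩,
        Finset.filter_false_of_mem fun c hc hcT => not_mem_three_blocks
          (fun h => hji (hinj i hiP j hjP h).symm) (fun h => hli (hinj i hiP l hlP h).symm)
          (fun h => hlj (hinj j hjP l hlP h).symm)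
          ⟨hc, hcT j hj, hcT l (Finset.mem_of_mem_erase hl)⟩]
  exact hcomp.image

/-- No vertex at a position in `Q` equals or is adjacent to a vertex at a position in `R`. -/
def Separated (Q R : Finset ℤ) : Prop := ∀ i ∈ Q, ∀ j ∈ R, i + 2 ≤ j ∨ j + 2 ≤ i

theorem Separated.disjoint_biUnion_block (h : Separated Q R) :
    Disjoint (Q.biUnion (block a)) (R.biUnion (block a)) := by
  rw [Finset.disjoint_biUnion_left]
  intro i hi
  rw [Finset.disjoint_biUnion_right]
  intro j hj
  rw [Finset.disjoint_left]
  intro c hci hcj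
  rcases h i hi j hj with h | h
  · have := (eq_of_mem_block_of_mem_block hci hcj (by omega)).1
    omega
  · have := (eq_of_mem_block_of_mem_block hcj hci (by omega)).1
    omega

theorem compressible_four (h : a p = 4) : Compressible (block a) {p} 1 := by
  refine ⟨Fin 3, inferInstance, fun x => ![x (p, 0) + x (p, 1), x (p, 0) + x (p, 2),
    x (p, 1) + x (p, 2)], fun x y hx hy => ?_, ?_⟩
  · have hlast : ∀ x, IsFlow (block a) {p} x →
        x (p + 1, 0) = -(x (p, 0) + x (p, 1) + x (p, 2)) := fun x hx => by
      have := hx p (Finset.mem_singleton_self p)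
      rw [sum_block, h] at this
      simp only [Nat.add_one_sub_one, Finset.sum_range_succ, Finset.sum_range_zero] at this
      linarith
    rw [pairing, Finset.singleton_biUnion, sum_block, h, hlast x hx, hlast y hy]
    simp only [Nat.add_one_sub_one, Finset.sum_range_succ, Finset.sum_range_zero, dotProduct,
      Fin.sum_univ_three, Matrix.cons_val]
    ring
  · rw [Finset.singleton_biUnion, card_block (by omega), h, Fintype.card_fin]

theorem compressible_three_three (h : a p = 3) (h' : a (p + 1) = 3) :
    Compressible (block a) {p, p + 1} 1 := by
  have hcells : ({p, p + 1} : Finset ℤ).biUnion (block a) =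
      {(p, 0), (p, 1), (p + 1, 0), (p + 1, 1), (p + 2, 0)} := by
    ext ⟨i, t⟩
    simp only [Finset.biUnion_insert, Finset.singleton_biUnion, Finset.mem_union, mem_block,
      Finset.mem_insert, Finset.mem_singleton, Prod.mk.injEq, h, h']
    omega
  refine ⟨Fin 4, inferInstance, fun x => ![x (p, 0) + x (p + 1, 1) + x (p + 1, 0),
    x (p, 0) - x (p + 1, 1), x (p + 1, 0), x (p + 1, 0)], fun x y hx hy => ?_, ?_⟩
  · have hlast : ∀ x, IsFlow (block a) {p, p + 1} x → x (p, 1) = -(x (p + 1, 0) + x (p, 0)) ∧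
        x (p + 2, 0) = -(x (p + 1, 0) + x (p + 1, 1)) := fun x hx => by
      have h₁ := hx p (Finset.mem_insert_self _ _)
      have h₂ := hx (p + 1) (Finset.mem_insert_of_mem (Finset.mem_singleton_self _))
      rw [sum_block, h] at h₁
      rw [sum_block, h', show p + 1 + 1 = p + 2 by ring] at h₂
      simp only [Nat.add_one_sub_one, Finset.sum_range_succ, Finset.sum_range_zero] at h₁ h₂
      exact ⟨by linarith, by linarith⟩
    rw [pairing, hcells]
    simp [dotProduct, Fin.sum_univ_four, hlast x hx, hlast y hy]
    ring
  · rw [hcells]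
    simp

theorem compressible_two_two (hp : a p = 2) (hq : a q = 2) (hpq : p + 2 ≤ q) :
    Compressible (block a) {p, q} 2 := by
  have hsep : Separated {p} {q} := by
    simp only [Separated, Finset.mem_singleton, forall_eq]
    exact Or.inl hpq
  have hcells : ({p, q} : Finset ℤ).biUnion (block a) = block a p ∪ block a q := by
    rw [Finset.biUnion_insert, Finset.singleton_biUnion]
  have hdisj : Disjoint (block a p) (block a q) := by
    simpa only [Finset.singleton_biUnion] using hsep.disjoint_biUnion_block (a := a)
  refine ⟨Fin 2, inferInstance, fun x => ![x (p, 0) + x (q, 0), x (p, 0) - x (q, 0)],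
    fun x y hx hy => ?_, ?_⟩
  · have hneg : ∀ x, IsFlow (block a) {p, q} x → ∀ i ∈ ({p, q} : Finset ℤ), a i = 2 →
        x (i + 1, 0) = -x (i, 0) := fun x hx i hi h => by
      have := hx i hi
      rwa [sum_block, h, Nat.add_one_sub_one, Finset.sum_range_one, add_eq_zero_iff_eq_neg] at this
    have hpP : p ∈ ({p, q} : Finset ℤ) := Finset.mem_insert_self _ _
    have hqP : q ∈ ({p, q} : Finset ℤ) := Finset.mem_insert_of_mem (Finset.mem_singleton_self _)
    rw [pairing, hcells, Finset.sum_union hdisj, sum_block, sum_block, hp, hq, hneg x hx p hpP hp,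
      hneg y hy p hpP hp, hneg x hx q hqP hq, hneg y hy q hqP hq]
    simp only [Nat.add_one_sub_one, Finset.sum_range_one, dotProduct, Fin.sum_univ_two,
      Matrix.cons_val]
    ring
  · rw [hcells, Finset.card_union_of_disjoint hdisj, card_block (by omega), card_block (by omega),
      hp, hq, Fintype.card_fin]

end Block

section Own

variable {a : ℤ → ℕ} {P : Finset ℤ} {X : ℤ} {c : ℤ × ℕ}

theorem mem_biUnion_erase_block (h2 : ∀ i ∈ P, 2 ≤ a i) (hc : c ∈ block a X) :
    c ∈ (P.erase X).biUnion (block a) ↔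
      (c = (X, 0) ∧ X - 1 ∈ P) ∨ (c = (X + 1, 0) ∧ X + 1 ∈ P) := by
  rw [Finset.mem_biUnion]
  constructor
  · rintro ⟨i, hi, hci⟩
    obtain ⟨hne, hi⟩ := Finset.mem_erase.1 hi
    rcases lt_or_gt_of_ne hne with hlt | hlt
    · obtain ⟨rfl, rfl⟩ := eq_of_mem_block_of_mem_block hci hc hlt
      exact Or.inl ⟨rfl, by rwa [add_sub_cancel_right]⟩
    · obtain ⟨rfl, rfl⟩ := eq_of_mem_block_of_mem_block hc hci hlt
      exact Or.inr ⟨rfl, hi⟩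
  · rintro (⟨rfl, h⟩ | ⟨rfl, h⟩)
    · have hmem : ((X - 1) + 1, 0) ∈ block a (X - 1) := right_mem_block
      rw [sub_add_cancel] at hmem
      exact ⟨X - 1, Finset.mem_erase.2 ⟨by omega, h⟩, hmem⟩
    · exact ⟨X + 1, Finset.mem_erase.2 ⟨by omega, h⟩, left_mem_block (h2 _ h)⟩

theorem mem_own (h2 : ∀ i ∈ P, 2 ≤ a i) (hX : X ∈ P) :
    c ∈ own (block a) P X ↔ (c.1 = X ∧ c.2 ≠ 0 ∧ c.2 < a X - 1) ∨ (c = (X, 0) ∧ X - 1 ∉ P) ∨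
      (c = (X + 1, 0) ∧ X + 1 ∉ P) := by
  have hX2 := h2 X hX
  rw [own, Finset.mem_sdiff, and_congr_right fun hc => not_congr (mem_biUnion_erase_block h2 hc),
    mem_block]
  rcases c with ⟨p, t⟩
  simp only [Prod.mk.injEq]
  by_cases hp : p = X
  · by_cases ht : t = 0 <;> simp [hp, ht]
    omega
  · by_cases hp' : p = X + 1 <;> by_cases ht : t = 0 <;> simp [hp, hp', ht]

theorem card_own_add (h2 : ∀ i ∈ P, 2 ≤ a i) (hX : X ∈ P) :
    (own (block a) P X).card + (if X - 1 ∈ P then 1 else 0) + (if X + 1 ∈ P then 1 else 0) =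
      a X := by
  set L : Finset (ℤ × ℕ) := if X - 1 ∈ P then {(X, 0)} else ∅ with hL
  set R : Finset (ℤ × ℕ) := if X + 1 ∈ P then {(X + 1, 0)} else ∅ with hR
  have hown : own (block a) P X = block a X \ (L ∪ R) := by
    ext c
    rw [own, Finset.mem_sdiff, Finset.mem_sdiff,
      and_congr_right fun hc => not_congr (mem_biUnion_erase_block h2 hc), hL, hR]
    split_ifs <;> simp [*]
  have hsub : L ∪ R ⊆ block a X := by
    refine Finset.union_subset ?_ ?_
    · rw [hL]
      split_ifs
      exacts [Finset.singleton_subset_iff.2 (left_mem_block (h2 X hX)), Finset.empty_subset _]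
    · rw [hR]
      split_ifs
      exacts [Finset.singleton_subset_iff.2 right_mem_block, Finset.empty_subset _]
  have hdisj : Disjoint L R := by
    rw [hL, hR]
    split_ifs <;> simp
  have hcard := Finset.card_sdiff_add_card_eq_card hsub
  rw [← hown, Finset.card_union_of_disjoint hdisj,
    card_block (one_le_two.trans (h2 X hX))] at hcard
  rw [← hcard, add_assoc, hL, hR]
  split_ifs <;> rfl

end Own

section Run

variable {a : ℤ → ℕ} {P : Finset ℤ} {X i j i' j' : ℤ} {c : ℤ × ℕ}

/-- The positions strictly between `i` and `j` form a maximal run of weights `-2`, preceded and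
followed by gaps or by vertices of weight at most `-3`. The run may be empty if `i` and `j` are
vertices. -/
structure IsRun (a : ℤ → ℕ) (P : Finset ℤ) (i j : ℤ) : Prop where
  lt : i < j
  two : ∀ p, i < p → p < j → p ∈ P ∧ a p = 2
  left : i ∈ P → 3 ≤ a i
  right : j ∈ P → 3 ≤ a j
  nonempty : i + 1 = j → i ∈ P ∧ j ∈ P

theorem IsRun.le_of_lt (h : IsRun a P i j) (h' : IsRun a P i' j') (hlt : i < i') : j ≤ i' := by
  by_contra! hj
  obtain ⟨hmem, htwo⟩ := h.two i' hlt hj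
  have := h'.left hmem
  omega

theorem IsRun.sub_one_mem (h : IsRun a P i j) (hX : 3 ≤ a X) (hi : i < X) (hj : X ≤ j) :
    X - 1 ∈ P := by
  obtain rfl : X = j := hj.antisymm <| not_lt.1 fun hlt => by
    have := (h.two X hi hlt).2
    omega
  by_cases hX' : i + 1 = X
  · rw [← hX', add_sub_cancel_right]
    exact (h.nonempty hX').1
  · exact (h.two (X - 1) (by omega) (by omega)).1

theorem IsRun.add_one_mem (h : IsRun a P i j) (hX : 3 ≤ a X) (hi : i ≤ X) (hj : X < j) :
    X + 1 ∈ P := by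
  obtain rfl : i = X := hi.antisymm <| not_lt.1 fun hlt => by
    have := (h.two X hlt hj).2
    omega
  by_cases hX' : i + 1 = j
  · rw [hX']
    exact (h.nonempty hX').2
  · exact (h.two (i + 1) (by omega) (by omega)).1

theorem exists_isRun_right (h2 : ∀ i ∈ P, 2 ≤ a i) (hi : i ∈ P → 3 ≤ a i) (hi' : i + 1 ∈ P)
    (h : i ∉ P → a (i + 1) = 2) : ∃ j, IsRun a P i j := by
  obtain ⟨b, hb⟩ := P.bddAbove
  obtain ⟨j, ⟨hij, hj⟩, hmin⟩ :=
    Int.exists_least_of_bdd (P := fun z => i < z ∧ ¬ (z ∈ P ∧ a z = 2))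
      ⟨i, fun z hz => hz.1.le⟩ ⟨max i b + 1, by omega, fun hz => by
        have := hb hz.1
        omega⟩
  refine ⟨j, hij, fun p hp hpj => ?_, hi, fun hjP => ?_, ?_⟩
  · by_contra hp'
    exact absurd (hmin p ⟨hp, hp'⟩) (not_le.2 hpj)
  · have := h2 j hjP
    have : a j ≠ 2 := fun h => hj ⟨hjP, h⟩
    omega
  · rintro rfl
    exact ⟨by_contra fun hiP => hj ⟨hi', h hiP⟩, hi'⟩

theorem exists_isRun_left (h2 : ∀ i ∈ P, 2 ≤ a i) (hj : j ∈ P) (h3 : 3 ≤ a j)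
    (hj' : j - 1 ∈ P) : ∃ i, IsRun a P i j := by
  obtain ⟨b, hb⟩ := P.bddBelow
  obtain ⟨i, ⟨hij, hi⟩, hmax⟩ :=
    Int.exists_greatest_of_bdd (P := fun z => z < j ∧ ¬ (z ∈ P ∧ a z = 2))
      ⟨j, fun z hz => hz.1.le⟩ ⟨min j b - 1, by omega, fun hz => by
        have := hb hz.1
        omega⟩
  refine ⟨i, hij, fun p hp hpj => ?_, fun hiP => ?_, fun _ => h3, ?_⟩
  · by_contra hp'
    exact absurd (hmax p ⟨hpj, hp'⟩) (not_le.2 hp)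
  · have := h2 i hiP
    have : a i ≠ 2 := fun h => hi ⟨hiP, h⟩
    omega
  · rintro rfl
    exact ⟨by rwa [add_sub_cancel_right] at hj', hj⟩

/-- The flow along a run: alternating signs on the coordinates shared by consecutive vertices of
the run, closed up on a coordinate met only by `i` and on one met only by `j`, when these are
vertices. -/
noncomputable def runFlow (a : ℤ → ℕ) (P : Finset ℤ) (i j : ℤ) : ℤ × ℕ → ℤ := fun c =>
  if c.2 = 0 then (if i < c.1 ∧ c.1 ≤ j then ((c.1 - i).negOnePow : ℤ) else 0)
  else if c = (i, a i - 2) ∧ i ∈ P then 1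
  else if c = (j, 1) ∧ j ∈ P then -((j - i).negOnePow : ℤ) else 0

theorem isFlow_runFlow (h : IsRun a P i j) : IsFlow (block a) P (runFlow a P i j) := by
  intro p hp
  rw [sum_block]
  have hij := h.lt
  rcases lt_trichotomy p i with hpi | rfl | hpi
  · rw [Finset.sum_eq_zero fun t _ => by simp [runFlow, hpi.ne, hpi.not_gt, (hpi.trans hij).ne]]
    simp [runFlow, show ¬ i < p + 1 by omega]
  · have h3 := h.left hp
    rw [Finset.sum_eq_single (a p - 2)
      (fun t _ ht => by simp [runFlow, ht, hij.ne])
      (fun ht => absurd (Finset.mem_range.2 (by omega)) ht)]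
    simp [runFlow, show a p - 2 ≠ 0 by omega, hp, show p + 1 ≤ j by omega]
  · rcases lt_trichotomy p j with hpj | rfl | hpj
    · simp [(h.two p hpi hpj).2, runFlow, hpi, hpj.le, show i < p + 1 by omega,
        show p + 1 ≤ j by omega, add_sub_right_comm, Int.negOnePow_succ]
    · have h3 := h.right hp
      rw [show a p - 1 = (a p - 3) + 1 + 1 by omega, Finset.sum_range_succ',
        Finset.sum_range_succ', Finset.sum_eq_zero fun t _ => by simp [runFlow, hij.ne']]
      simp [runFlow, hp, hij, hij.ne']
    · rw [Finset.sum_eq_zero fun t _ => by simp [runFlow, hpj.ne', hpj.not_ge, (hij.trans hpj).ne']]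
      simp [runFlow, show ¬ p + 1 ≤ j by omega]

theorem runFlow_mul_self_le (i j : ℤ) (c : ℤ × ℕ) :
    runFlow a P i j c * runFlow a P i j c ≤ 1 := by
  unfold runFlow
  split_ifs <;> simp

theorem runFlow_eq_zero (hc : c ∉ (Finset.Ioc i j).image (·, 0) ∪ {(i, a i - 2), (j, 1)}) :
    runFlow a P i j c = 0 := by
  rcases c with ⟨p, t⟩
  simp only [Finset.mem_union, Finset.mem_image, Finset.mem_Ioc, Finset.mem_insert,
    Finset.mem_singleton, not_or, not_exists, not_and, Prod.mk.injEq] at hc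
  obtain ⟨h0, hi, hj⟩ := hc
  simp only [runFlow, Prod.mk.injEq]
  split_ifs with ht hp hi' hj'
  · exact absurd ht.symm (h0 p hp rfl)
  · rfl
  · exact absurd hi'.1.2 (hi hi'.1.1)
  · exact absurd hj'.1.2 (hj hj'.1.1)
  · rfl

theorem pairing_runFlow_le (h : IsRun a P i j) :
    pairing (block a) P (runFlow a P i j) (runFlow a P i j) ≤ j - i + 2 := by
  set S : Finset (ℤ × ℕ) := (Finset.Ioc i j).image (·, 0) ∪ {(i, a i - 2), (j, 1)}
  have hcard : S.card ≤ (Finset.Ioc i j).card + 2 :=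
    (Finset.card_union_le _ _).trans (add_le_add Finset.card_image_le Finset.card_le_two)
  rw [Int.card_Ioc] at hcard
  have hij := h.lt
  calc pairing (block a) P (runFlow a P i j) (runFlow a P i j)
      ≤ ∑ c ∈ P.biUnion (block a) ∪ S, runFlow a P i j c * runFlow a P i j c :=
        Finset.sum_le_sum_of_subset_of_nonneg Finset.subset_union_left
          fun c _ _ => mul_self_nonneg _
    _ = ∑ c ∈ S, runFlow a P i j c * runFlow a P i j c :=
        (Finset.sum_subset Finset.subset_union_right fun c _ hc => by
          rw [runFlow_eq_zero hc, mul_zero]).symm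
    _ ≤ S.card := by
        simpa using Finset.sum_le_sum fun c (_ : c ∈ S) => runFlow_mul_self_le i j c
    _ ≤ j - i + 2 := by omega

theorem eq_of_runFlow_ne_zero_of_mem_own (h2 : ∀ i ∈ P, 2 ≤ a i) (h : IsRun a P i j) (hX : X ∈ P)
    (h3 : 3 ≤ a X) (hc : c ∈ own (block a) P X) (h0 : runFlow a P i j c ≠ 0) :
    (X = i ∧ c = (i, a i - 2)) ∨ (X = j ∧ c = (j, 1)) := by
  rcases (mem_own h2 hX).1 hc with ⟨rfl, ht, -⟩ | ⟨rfl, hX'⟩ | ⟨rfl, hX'⟩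
  · simp only [runFlow, ht, if_false] at h0
    split_ifs at h0 with hci hcj
    · exact Or.inl ⟨congr_arg Prod.fst hci.1, hci.1⟩
    · exact Or.inr ⟨congr_arg Prod.fst hcj.1, hcj.1⟩
    · exact absurd rfl h0
  · simp only [runFlow, if_true] at h0
    split_ifs at h0 with hmem
    · exact absurd (h.sub_one_mem h3 hmem.1 hmem.2) hX'
    · exact absurd rfl h0
  · simp only [runFlow, if_true] at h0
    split_ifs at h0 with hmem
    · exact absurd (h.add_one_mem h3 (by omega) (by omega)) hX'
    · exact absurd rfl h0

theorem runFlow_eq_zero_or_exists_unique_own (h2 : ∀ i ∈ P, 2 ≤ a i) (hX : X ∈ P) (h3 : 3 ≤ a X)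
    (h : IsRun a P i j) : (∀ c ∈ own (block a) P X, runFlow a P i j c = 0) ∨
      ∃ e ∈ own (block a) P X, ∀ c ∈ own (block a) P X, c ≠ e → runFlow a P i j c = 0 := by
  by_cases h0 : ∀ c ∈ own (block a) P X, runFlow a P i j c = 0
  · exact Or.inl h0
  push Not at h0
  obtain ⟨e, he, h0⟩ := h0
  refine Or.inr ⟨e, he, fun c hc => Not.imp_symm fun hc0 => ?_⟩
  have hij := h.lt
  rcases eq_of_runFlow_ne_zero_of_mem_own h2 h hX h3 he h0 with ⟨hXi, rfl⟩ | ⟨hXj, rfl⟩ <;>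
    rcases eq_of_runFlow_ne_zero_of_mem_own h2 h hX h3 hc hc0 with ⟨hXi', rfl⟩ | ⟨hXj', rfl⟩
  · rfl
  · omega
  · omega
  · rfl

end Run

section Generation

variable {a : ℤ → ℕ} {P : Finset ℤ} {x : ℤ × ℕ → ℤ} {i : ℤ} {t : ℕ} {c d : ℤ × ℕ}

/-- `c` is the lexicographically first coordinate at which `x` does not vanish. -/
structure IsLeading (a : ℤ → ℕ) (P : Finset ℤ) (x : ℤ × ℕ → ℤ) (c : ℤ × ℕ) : Prop where
  mem : c ∈ P.biUnion (block a)
  ne_zero : x c ≠ 0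
  eq_zero : ∀ d ∈ P.biUnion (block a), toLex d < toLex c → x d = 0

/-- The flow `g` can be used to clear the coordinate `c` without changing earlier ones. -/
def IsPivot (g : ℤ × ℕ → ℤ) (c : ℤ × ℕ) : Prop :=
  g c * g c = 1 ∧ ∀ d, toLex d < toLex c → g d = 0

theorem exists_isLeading (h : ∃ c ∈ P.biUnion (block a), x c ≠ 0) : ∃ c, IsLeading a P x c := by
  obtain ⟨c, hc, hmin⟩ := Finset.exists_min_image ((P.biUnion (block a)).filter (x · ≠ 0)) toLex
    (by simpa only [Finset.Nonempty, Finset.mem_filter] using h)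
  obtain ⟨hcP, hxc⟩ := Finset.mem_filter.1 hc
  exact ⟨c, hcP, hxc, fun d hd hdc => by_contra fun hxd =>
    absurd (hmin d (Finset.mem_filter.2 ⟨hd, hxd⟩)) (not_le.2 hdc)⟩

/-- Flow conservation at a vertex prevents its last coordinate from being leading. -/
theorem IsLeading.not_sub_one_mem_and (hx : IsFlow (block a) P x) (h : IsLeading a P x (i, t)) :
    ¬ (i - 1 ∈ P ∧ t = 0) := by
  rintro ⟨hi, rfl⟩
  have hsum := hx (i - 1) hi
  rw [sum_block, sub_add_cancel, Finset.sum_eq_zero fun s hs => ?_, add_zero] at hsum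
  · exact h.ne_zero hsum
  · refine h.eq_zero _ (Finset.mem_biUnion.2 ⟨i - 1, hi, mem_block.2 (Or.inr ⟨rfl, ?_⟩)⟩) ?_
    · exact Finset.mem_range.1 hs
    · exact Prod.Lex.toLex_lt_toLex.2 (Or.inl (sub_one_lt i))

theorem IsLeading.mem_and_lt (hx : IsFlow (block a) P x) (h : IsLeading a P x (i, t)) :
    i ∈ P ∧ t < a i - 1 := by
  obtain ⟨p, hp, hcp⟩ := Finset.mem_biUnion.1 h.mem
  rcases mem_block.1 hcp with hcp | ⟨hi, ht⟩
  · obtain ⟨rfl, rfl⟩ := Prod.mk.inj hcp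
    exact absurd ⟨by rwa [add_sub_cancel_right], rfl⟩ (h.not_sub_one_mem_and hx)
  · obtain rfl : i = p := hi
    exact ⟨hp, ht⟩

theorem IsLeading.mem_own (h2 : ∀ i ∈ P, 2 ≤ a i) (hx : IsFlow (block a) P x)
    (h : IsLeading a P x (i, t)) : (i, t) ∈ own (block a) P i := by
  obtain ⟨hi, ht⟩ := h.mem_and_lt hx
  refine (LinearPlumbing.mem_own h2 hi).2 ?_
  by_cases ht0 : t = 0
  · subst ht0
    exact Or.inr (Or.inl ⟨rfl, fun hi' => h.not_sub_one_mem_and hx ⟨hi', rfl⟩⟩)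
  · exact Or.inl ⟨rfl, ht0, ht⟩

theorem isPivot_diff (h : toLex c < toLex d) : IsPivot (diff c d) c := by
  have hne : ∀ {e f : ℤ × ℕ}, toLex e < toLex f → e ≠ f := fun he hef => he.ne (congr_arg toLex hef)
  refine ⟨by simp [diff_apply, hne h], fun e he => ?_⟩
  simp [diff_apply, hne he, hne (he.trans h)]

theorem IsRun.isPivot_of_mem {j : ℤ} (h : IsRun a P i j) (hi : i ∈ P) :
    IsPivot (runFlow a P i j) (i, a i - 2) := by
  have h3 := h.left hi
  have hij := h.lt
  refine ⟨by simp [runFlow, show a i - 2 ≠ 0 by omega, hi], ?_⟩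
  rintro ⟨p, t⟩ hd
  simp only [Prod.Lex.toLex_lt_toLex] at hd
  simp only [runFlow, Prod.mk.injEq]
  split_ifs <;> first | rfl | omega

theorem IsRun.isPivot_of_notMem {j : ℤ} (h : IsRun a P (i - 1) j) (hi : i - 1 ∉ P) :
    IsPivot (runFlow a P (i - 1) j) (i, 0) := by
  have hij := h.lt
  refine ⟨by simp [runFlow, show i ≤ j by omega], ?_⟩
  rintro ⟨p, t⟩ hd
  simp only [Prod.Lex.toLex_lt_toLex] at hd
  simp only [runFlow, Prod.mk.injEq, hi, and_false, if_false]
  split_ifs <;> first | rfl | omega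

theorem IsLeading.exists_isPivot (h2 : ∀ i ∈ P, 2 ≤ a i) (hx : IsFlow (block a) P x)
    (h : IsLeading a P x c) :
    (∃ X ∈ P, c ∈ own (block a) P X ∧ ∃ d ∈ own (block a) P X, IsPivot (diff c d) c) ∨
      ∃ i j, IsRun a P i j ∧ IsPivot (runFlow a P i j) c := by
  obtain ⟨i, t⟩ := c
  obtain ⟨hi, ht⟩ := h.mem_and_lt hx
  have hown := h.mem_own h2 hx
  by_cases ht' : t + 1 < a i - 1
  · refine Or.inl ⟨i, hi, hown, (i, t + 1), ?_, isPivot_diff ?_⟩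
    · exact (LinearPlumbing.mem_own h2 hi).2 (Or.inl ⟨rfl, t.succ_ne_zero, ht'⟩)
    · exact Prod.Lex.toLex_lt_toLex.2 (Or.inr ⟨rfl, t.lt_succ_self⟩)
  by_cases hi' : i + 1 ∈ P
  swap
  · refine Or.inl ⟨i, hi, hown, (i + 1, 0), ?_, isPivot_diff ?_⟩
    · exact (LinearPlumbing.mem_own h2 hi).2 (Or.inr (Or.inr ⟨rfl, hi'⟩))
    · exact Prod.Lex.toLex_lt_toLex.2 (Or.inl (lt_add_one i))
  right
  by_cases h3 : 3 ≤ a i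
  · obtain ⟨j, hr⟩ := exists_isRun_right h2 (fun _ => h3) hi' (absurd hi)
    have hpivot := hr.isPivot_of_mem hi
    rw [show a i - 2 = t by omega] at hpivot
    exact ⟨i, j, hr, hpivot⟩
  · have := h2 i hi
    obtain rfl : t = 0 := by omega
    have hpred : i - 1 ∉ P := fun hmem => h.not_sub_one_mem_and hx ⟨hmem, rfl⟩
    obtain ⟨j, hr⟩ := exists_isRun_right h2 (absurd · hpred)
      (by rwa [sub_add_cancel]) (fun _ => by rw [sub_add_cancel]; omega)
    exact ⟨i - 1, j, hr, hr.isPivot_of_notMem hpred⟩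

theorem IsLeading.lt_of_clear {g : ℤ × ℕ → ℤ} (h : IsLeading a P x c) (hg : IsPivot g c)
    (hd : IsLeading a P (x - (x c * g c) • g) d) : toLex c < toLex d := by
  refine lt_of_not_ge fun hdc => hd.ne_zero ?_
  simp only [Pi.sub_apply, Pi.smul_apply, smul_eq_mul]
  rcases hdc.lt_or_eq with hlt | heq
  · rw [h.eq_zero d hd.mem hlt, hg.2 d hlt, mul_zero, sub_zero]
  · rw [toLex_inj.1 heq, mul_assoc, hg.1, mul_one, sub_self]

/-- Gaussian elimination along the lexicographic order: a property of flows is inherited from the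
differences of coordinates met by the same vertex only and from the flows along runs. -/
theorem flow_induction (h2 : ∀ i ∈ P, 2 ≤ a i) {p : (ℤ × ℕ → ℤ) → Prop}
    (hadd : ∀ x y, IsFlow (block a) P x → IsFlow (block a) P y → p x → p y → p (x + y))
    (hsmul : ∀ (n : ℤ) x, IsFlow (block a) P x → p x → p (n • x))
    (hzero : ∀ x, IsFlow (block a) P x → (∀ c ∈ P.biUnion (block a), x c = 0) → p x)
    (hdiff : ∀ X ∈ P, ∀ c ∈ own (block a) P X, ∀ d ∈ own (block a) P X, p (diff c d))
    (hrun : ∀ i j, IsRun a P i j → p (runFlow a P i j)) (hx : IsFlow (block a) P x) : p x := by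
  by_contra hpx
  have hlead : ∀ y, IsFlow (block a) P y → ¬ p y → ∃ c, IsLeading a P y c := fun y hy hpy =>
    exists_isLeading <| by
      by_contra! h0
      exact hpy (hzero y hy h0)
  classical
  set S := (P.biUnion (block a)).filter fun c =>
    ∃ y, IsFlow (block a) P y ∧ ¬ p y ∧ IsLeading a P y c
  have hmem : ∀ {y c}, IsFlow (block a) P y → ¬ p y → IsLeading a P y c → c ∈ S :=
    fun hy hpy hc => Finset.mem_filter.2 ⟨hc.mem, _, hy, hpy, hc⟩
  obtain ⟨c₀, hc₀⟩ := hlead x hx hpx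
  obtain ⟨c, hc, hmax⟩ := Finset.exists_max_image S toLex ⟨c₀, hmem hx hpx hc₀⟩
  obtain ⟨-, y, hy, hpy, hyc⟩ := Finset.mem_filter.1 hc
  obtain ⟨g, hg, hpg, hgc⟩ : ∃ g, IsFlow (block a) P g ∧ p g ∧ IsPivot g c := by
    rcases hyc.exists_isPivot h2 hy with ⟨X, hX, hcX, d, hd, hg⟩ | ⟨i, j, hr, hg⟩
    · exact ⟨_, isFlow_diff hcX hd, hdiff X hX c hcX d hd, hg⟩
    · exact ⟨_, isFlow_runFlow hr, hrun i j hr, hg⟩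
  have hz : IsFlow (block a) P (y - (y c * g c) • g) := hy.sub (hg.smul _)
  have hpz : ¬ p (y - (y c * g c) • g) := fun hpz => hpy <| by
    have hsum := hadd _ _ hz (hg.smul (y c * g c)) hpz (hsmul _ g hg hpg)
    rwa [sub_add_cancel] at hsum
  obtain ⟨d, hd⟩ := hlead _ hz hpz
  exact absurd (hmax d (hmem hz hpz hd)) (not_le.2 (hyc.lt_of_clear hgc hd))

end Generation

section Pack

variable {a : ℤ → ℕ} {P T T' : Finset ℤ} {k l : ℕ} {p q : ℤ}

/-- The positions in `T` are the vertices of weight `-2` and `-4` and the first vertices of the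
pairs of weights `-3` in a disjoint union of pairwise nonadjacent pieces of these types. -/
structure IsPack (a : ℤ → ℕ) (P T : Finset ℤ) : Prop where
  piece : ∀ p ∈ T, p ∈ P ∧ (a p = 2 ∨ a p = 4 ∨ a p = 3 ∧ p + 1 ∈ P ∧ a (p + 1) = 3)
  sep : ∀ p ∈ T, ∀ q ∈ T, p < q → p + 2 ≤ q ∧ (a p = 3 → p + 3 ≤ q)

/-- The vertices of a pack. -/
def packSupport (a : ℤ → ℕ) (T : Finset ℤ) : Finset ℤ :=
  T ∪ (T.filter fun p => a p = 3).image (· + 1)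

theorem mem_packSupport : p ∈ packSupport a T ↔ p ∈ T ∨ p - 1 ∈ T ∧ a (p - 1) = 3 := by
  simp only [packSupport, Finset.mem_union, Finset.mem_image, Finset.mem_filter]
  refine or_congr_right ⟨?_, fun h => ⟨p - 1, h, sub_add_cancel p 1⟩⟩
  rintro ⟨q, h, rfl⟩
  rwa [add_sub_cancel_right]

theorem packSupport_union (T T' : Finset ℤ) :
    packSupport a (T ∪ T') = packSupport a T ∪ packSupport a T' := by
  ext p
  simp only [mem_packSupport, Finset.mem_union]
  tauto

theorem packSupport_eq_self (h : ∀ p ∈ T, a p ≠ 3) : packSupport a T = T := by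
  rw [packSupport, Finset.filter_eq_empty_iff.2 fun p hp => h p hp, Finset.image_empty,
    Finset.union_empty]

theorem card_packSupport_le : (packSupport a T).card ≤ 2 * T.card := by
  have := (Finset.card_image_le (s := T.filter fun p => a p = 3) (f := (· + 1))).trans
    (Finset.card_filter_le _ _)
  exact (Finset.card_union_le _ _).trans (by omega)

theorem IsPack.mono (h : IsPack a P T) (hT : T' ⊆ T) : IsPack a P T' :=
  ⟨fun p hp => h.piece p (hT hp), fun p hp q hq => h.sep p (hT hp) q (hT hq)⟩

theorem IsPack.packSupport_subset (h : IsPack a P T) : packSupport a T ⊆ P := by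
  intro p hp
  rcases mem_packSupport.1 hp with hp | ⟨hp, h3⟩
  · exact (h.piece p hp).1
  · rcases (h.piece _ hp).2 with h2 | h4 | ⟨-, hmem, -⟩
    · omega
    · omega
    · rwa [sub_add_cancel] at hmem

theorem IsPack.le_four (h : IsPack a P T) (hp : p ∈ packSupport a T) : a p ≤ 4 := by
  rcases mem_packSupport.1 hp with hp | ⟨hp, h3⟩
  · rcases (h.piece p hp).2 with h | h | h <;> omega
  · rcases (h.piece _ hp).2 with h2 | h4 | ⟨-, -, h3'⟩
    · omega
    · omega
    · rw [sub_add_cancel] at h3'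
      omega

theorem IsPack.separated (h : IsPack a P (T ∪ T')) (hd : Disjoint T T') :
    Separated (packSupport a T) (packSupport a T') := by
  have hsep : ∀ p ∈ T, ∀ q ∈ T', p + 2 ≤ q ∧ (a p = 3 → p + 3 ≤ q) ∨
      q + 2 ≤ p ∧ (a q = 3 → q + 3 ≤ p) := by
    intro p hp q hq
    have hp' := Finset.mem_union_left T' hp
    have hq' := Finset.mem_union_right T hq
    rcases lt_trichotomy p q with hpq | rfl | hpq
    · exact Or.inl (h.sep p hp' q hq' hpq)
    · exact absurd hq (Finset.disjoint_left.1 hd hp)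
    · exact Or.inr (h.sep q hq' p hp' hpq)
  intro i hi j hj
  rw [mem_packSupport] at hi hj
  rcases hi with hi | ⟨hi, hi3⟩ <;> rcases hj with hj | ⟨hj, hj3⟩ <;>
  · rcases hsep _ hi _ hj with ⟨h1, h2⟩ | ⟨h1, h2⟩ <;> omega

theorem IsPack.compressible_union (h : IsPack a P (T ∪ T')) (hd : Disjoint T T')
    (hT : Compressible (block a) (packSupport a T) k)
    (hT' : Compressible (block a) (packSupport a T') l) :
    Compressible (block a) (packSupport a (T ∪ T')) (k + l) := by
  rw [packSupport_union]
  exact hT.union hT' (h.separated hd).disjoint_biUnion_block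

theorem IsPack.compressible_singleton (h : IsPack a P {p}) (hp : a p ≠ 2) :
    Compressible (block a) (packSupport a {p}) 1 := by
  rcases (h.piece p (Finset.mem_singleton_self p)).2 with h2 | h4 | ⟨h3, -, h3'⟩
  · exact absurd h2 hp
  · rw [packSupport_eq_self (by simp [h4])]
    exact compressible_four h4
  · rw [packSupport, Finset.filter_singleton, if_pos h3, Finset.image_singleton,
      ← Finset.insert_eq]
    exact compressible_three_three h3 h3'

theorem IsPack.compressible_pair (h : IsPack a P {p, q}) (hlt : p < q) (hp : a p = 2)
    (hq : a q = 2) : Compressible (block a) (packSupport a {p, q}) 2 := by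
  rw [packSupport_eq_self (by simp [hp, hq])]
  exact compressible_two_two hp hq (h.sep p (by simp) q (by simp) hlt).1

theorem IsPack.compressible (h : IsPack a P T) :
    Compressible (block a) (packSupport a T) (T.card - 1) := by
  induction T using Finset.strongInduction with
  | H T ih =>
  by_cases h2 : ∃ p ∈ T, a p ≠ 2
  · obtain ⟨p, hp, hp2⟩ := h2
    have hT : T.erase p ∪ {p} = T := Finset.sdiff_singleton_eq_erase p T ▸
      Finset.sdiff_union_of_subset (Finset.singleton_subset_iff.2 hp)
    have hrest := ih _ (Finset.erase_ssubset hp) (h.mono (Finset.erase_subset p T))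
    have hone := (h.mono (Finset.singleton_subset_iff.2 hp)).compressible_singleton hp2
    have hunion := IsPack.compressible_union (hT.symm ▸ h) (by simp) hrest hone
    have hcard := Finset.card_erase_add_one hp
    rw [hT] at hunion
    exact hunion.mono (by omega)
  · push Not at h2
    rcases le_or_gt T.card 1 with hcard | hcard
    · exact compressible_zero.mono (by omega)
    obtain ⟨p, hp, q, hq, hpq⟩ := Finset.one_lt_card.1 hcard
    wlog hlt : p < q generalizing p q
    · exact this q hq p hp hpq.symm (by omega)
    have hsub : {p, q} ⊆ T := Finset.insert_subset hp (Finset.singleton_subset_iff.2 hq)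
    have hT : T \ {p, q} ∪ {p, q} = T := Finset.sdiff_union_of_subset hsub
    have hrest := ih _ (Finset.sdiff_ssubset hsub (Finset.insert_nonempty _ _))
      (h.mono Finset.sdiff_subset)
    have htwo := (h.mono hsub).compressible_pair hlt (h2 p hp) (h2 q hq)
    have hunion := IsPack.compressible_union (hT.symm ▸ h) Finset.sdiff_disjoint hrest htwo
    have hcard' := Finset.card_sdiff_add_card_eq_card hsub
    rw [Finset.card_pair hpq] at hcard'
    rw [hT] at hunion
    exact hunion.mono (by omega)

theorem pack_card_le_or (h : Minimal (Compressible (block a) · k) P) :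
    (∀ T, IsPack a P T → T.card ≤ k) ∨ P.card ≤ 2 * (k + 1) ∧ ∀ i ∈ P, a i ≤ 4 := by
  by_cases hpack : ∀ T, IsPack a P T → T.card ≤ k
  · exact Or.inl hpack
  push Not at hpack
  obtain ⟨T, hT, hk⟩ := hpack
  obtain ⟨T', hT', hk'⟩ := Finset.exists_subset_card_eq (show k + 1 ≤ T.card from hk)
  have hpack := hT.mono hT'
  have hcomp := hpack.compressible
  rw [hk', Nat.add_sub_cancel] at hcomp
  have hP : P = packSupport a T' := (h.eq_of_le hcomp hpack.packSupport_subset).symm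
  exact Or.inr ⟨hP ▸ hk' ▸ card_packSupport_le, fun i hi => hpack.le_four (hP ▸ hi)⟩

end Pack

section RunPack

variable {a : ℤ → ℕ} {P : Finset ℤ} {i j p : ℤ} {I : Finset ℤ} {J : ℤ → ℤ}

/-- Every other vertex of a run. -/
noncomputable def runPack (i j : ℤ) : Finset ℤ :=
  (Finset.range ((j - i) / 2).toNat).image fun t : ℕ => i + 1 + 2 * t

theorem mem_runPack : p ∈ runPack i j ↔ ∃ t : ℕ, 2 * (t : ℤ) + 2 ≤ j - i ∧ p = i + 1 + 2 * t := by
  simp only [runPack, Finset.mem_image, Finset.mem_range]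
  refine exists_congr fun t => and_congr ?_ eq_comm
  omega

theorem card_runPack (h : i < j) : ((runPack i j).card : ℤ) = (j - i) / 2 := by
  rw [runPack, Finset.card_image_of_injective _ fun s t hst => by simpa using hst,
    Finset.card_range]
  omega

theorem IsRun.two_of_mem_runPack (h : IsRun a P i j) (hp : p ∈ runPack i j) : p ∈ P ∧ a p = 2 := by
  obtain ⟨t, ht, rfl⟩ := mem_runPack.1 hp
  exact h.two _ (by omega) (by omega)

theorem IsRun.add_two_le_of_mem_runPack {i' j' q : ℤ} (h : IsRun a P i j) (h' : IsRun a P i' j')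
    (hi : i < i') (hp : p ∈ runPack i j) (hq : q ∈ runPack i' j') : p + 2 ≤ q := by
  obtain ⟨t, ht, rfl⟩ := mem_runPack.1 hp
  obtain ⟨s, -, rfl⟩ := mem_runPack.1 hq
  have := h.le_of_lt h' hi
  omega

theorem isPack_biUnion_runPack (h : ∀ i ∈ I, IsRun a P i (J i)) :
    IsPack a P (I.biUnion fun i => runPack i (J i)) := by
  refine ⟨fun p hp => ?_, fun p hp q hq hpq => ?_⟩
  · obtain ⟨i, hi, hp⟩ := Finset.mem_biUnion.1 hp
    obtain ⟨hmem, htwo⟩ := (h i hi).two_of_mem_runPack hp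
    exact ⟨hmem, Or.inl htwo⟩
  · obtain ⟨i, hi, hp⟩ := Finset.mem_biUnion.1 hp
    obtain ⟨i', hi', hq⟩ := Finset.mem_biUnion.1 hq
    have htwo := ((h i hi).two_of_mem_runPack hp).2
    refine ⟨?_, fun h3 => by omega⟩
    rcases lt_trichotomy i i' with hii | rfl | hii
    · exact (h i hi).add_two_le_of_mem_runPack (h i' hi') hii hp hq
    · obtain ⟨t, -, rfl⟩ := mem_runPack.1 hp
      obtain ⟨s, -, rfl⟩ := mem_runPack.1 hq
      omega
    · have := (h i' hi').add_two_le_of_mem_runPack (h i hi) hii hq hp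
      omega

theorem card_biUnion_runPack (h : ∀ i ∈ I, IsRun a P i (J i)) :
    ((I.biUnion fun i => runPack i (J i)).card : ℤ) = ∑ i ∈ I, (J i - i) / 2 := by
  rw [Finset.card_biUnion fun i hi i' hi' hne => Finset.disjoint_left.2 fun p hp hq => ?_]
  · push_cast
    exact Finset.sum_congr rfl fun i hi => card_runPack (h i hi).lt
  · rcases lt_or_gt_of_ne hne with hii | hii
    · have := (h i hi).add_two_le_of_mem_runPack (h i' hi') hii hp hq
      omega
    · have := (h i' hi').add_two_le_of_mem_runPack (h i hi) hii hq hp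
      omega

end RunPack

section WeightBound

variable {a : ℤ → ℕ} {P : Finset ℤ} {k : ℕ} {X i j : ℤ} {J : Type} [Fintype J]
  {φ : (ℤ × ℕ → ℤ) → J → ℤ} {U : ℤ × ℕ → J → ℤ} {τ : (ℤ × ℕ → ℤ) → ℤ}

theorem IsUnits.exists_run (hU : IsUnits (block a) P φ X U τ) (h2 : ∀ i ∈ P, 2 ≤ a i)
    (h : Minimal (Compressible (block a) · k) P) (hφ : IsFlowIsometry (block a) P φ)
    (hJ : Fintype.card J + k = (P.biUnion (block a)).card) (hX : X ∈ P)
    (hcard : 3 ≤ (own (block a) P X).card) : ∃ i j, IsRun a P i j ∧ τ (runFlow a P i j) ≠ 0 := by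
  by_contra! hrun
  obtain ⟨c, hc⟩ : (own (block a) P X).Nonempty := Finset.card_pos.1 (by omega)
  refine h.not_prop_of_lt (Finset.erase_ssubset hX)
    (hU.compressible_erase hφ hJ hX hc fun x hx => ?_)
  refine flow_induction (p := fun x => τ x = 0) h2 ?_ ?_ ?_ ?_ hrun hx
  · intro x y hx hy hτx hτy
    rw [hU.tau_add hφ hc hx hy, hτx, hτy, add_zero]
  · intro n x hx hτx
    rw [hU.tau_smul hφ hc hx, hτx, mul_zero]
  · exact fun x hx => hU.tau_eq_zero hφ hX hc hx
  · exact fun Y hY c hc d hd => hU.tau_diff hφ hcard hY hc hd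

theorem IsUnits.card_own_sub_one_mul_sq_le (hU : IsUnits (block a) P φ X U τ)
    (h2 : ∀ i ∈ P, 2 ≤ a i) (hφ : IsFlowIsometry (block a) P φ) (hX : X ∈ P) (h3 : 3 ≤ a X)
    (h : IsRun a P i j) :
    ((own (block a) P X).card - 1) * τ (runFlow a P i j) ^ 2 ≤
      pairing (block a) P (runFlow a P i j) (runFlow a P i j) := by
  have hf := isFlow_runFlow h
  rcases runFlow_eq_zero_or_exists_unique_own h2 hX h3 h with h0 | ⟨e, he, h0⟩
  · refine le_trans ?_ (hU.card_mul_sq_le_pairing hφ hf h0)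
    gcongr
    omega
  · exact (le_add_of_nonneg_left (sq_nonneg _)).trans
      (hU.sq_add_card_sub_one_mul_sq_le_pairing hφ hf he h0)

/-- A run along which the common error of the units at `X` does not vanish has length at
least `a X - 5`, and a run of length `2k + 2` carries a pack of more than `k` pieces. -/
theorem weight_le (h2 : ∀ i ∈ P, 2 ≤ a i) (h : Minimal (Compressible (block a) · k) P)
    (hpack : ∀ T, IsPack a P T → T.card ≤ k) (hX : X ∈ P) : a X ≤ 2 * k + 7 := by
  by_contra! hlt
  obtain ⟨J, _, φ, hφ, hJ⟩ := h.prop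
  have hown := card_own_add h2 hX
  replace hown : 2 * k + 6 ≤ (own (block a) P X).card := by
    split_ifs at hown <;> omega
  obtain ⟨c, hc⟩ : (own (block a) P X).Nonempty := Finset.card_pos.1 (by omega)
  obtain ⟨U, τ, hU⟩ := hφ.exists_isUnits hX hc (by omega) (by omega)
  obtain ⟨i, j, hrun, hτ⟩ := hU.exists_run h2 h hφ hJ hX (by omega)
  have hlen : (j - i) / 2 ≤ k := by
    have hruns : ∀ p ∈ ({i} : Finset ℤ), IsRun a P p j := by simpa using hrun
    rw [← Finset.sum_singleton (fun p => (j - p) / 2) i, ← card_biUnion_runPack hruns]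
    exact_mod_cast hpack _ (isPack_biUnion_runPack hruns)
  have hpos : 0 < τ (runFlow a P i j) ^ 2 := by positivity
  have hbound : 2 * (k : ℤ) + 5 ≤ j - i + 2 := calc
    2 * (k : ℤ) + 5 ≤ ((own (block a) P X).card - 1) * 1 := by omega
    _ ≤ ((own (block a) P X).card - 1) * τ (runFlow a P i j) ^ 2 := by gcongr <;> omega
    _ ≤ _ := hU.card_own_sub_one_mul_sq_le h2 hφ hX (by omega) hrun
    _ ≤ j - i + 2 := pairing_runFlow_le hrun
  omega

end WeightBound

section ShortRun

variable {a : ℤ → ℕ} {P : Finset ℤ} {i : ℤ}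

theorem isRun_succ (hi : i ∈ P) (hi' : i + 1 ∈ P) (h3 : 3 ≤ a i) (h3' : 3 ≤ a (i + 1)) :
    IsRun a P i (i + 1) :=
  ⟨by omega, fun p h1 h2 => by omega, fun _ => h3, fun _ => h3', fun _ => ⟨hi, hi'⟩⟩

theorem IsRun.runFlow_succ (h : IsRun a P i (i + 1)) :
    runFlow a P i (i + 1) =
      Pi.single (i, a i - 2) 1 + Pi.single (i + 1, 1) 1 - Pi.single (i + 1, 0) 1 := by
  obtain ⟨hi, hi'⟩ := h.nonempty rfl
  have h3 := h.left hi
  funext ⟨p, t⟩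
  simp only [runFlow, Pi.sub_apply, Pi.add_apply, Pi.single_apply, Prod.mk.injEq, hi, hi', and_true]
  by_cases hp : p = i + 1
  · subst hp
    simp only [add_sub_cancel_left, Int.negOnePow_one, Units.val_neg, Units.val_one,
      true_and]
    split_ifs <;> omega
  · split_ifs <;> omega

theorem IsRun.pairing_runFlow_succ (h : IsRun a P i (i + 1)) (y : ℤ × ℕ → ℤ) :
    pairing (block a) P (runFlow a P i (i + 1)) y =
      y (i, a i - 2) + y (i + 1, 1) - y (i + 1, 0) := by
  obtain ⟨hi, hi'⟩ := h.nonempty rfl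
  have h3 := h.left hi
  have h3' := h.right hi'
  rw [h.runFlow_succ, pairing_sub_left, pairing_add_left,
    pairing_single_left (Finset.mem_biUnion.2 ⟨i, hi, mem_block.2 (Or.inr ⟨rfl, by omega⟩)⟩),
    pairing_single_left (Finset.mem_biUnion.2 ⟨_, hi', mem_block.2 (Or.inr ⟨rfl, by omega⟩)⟩),
    pairing_single_left (Finset.mem_biUnion.2 ⟨i, hi, right_mem_block⟩)]

theorem IsRun.pairing_runFlow_succ_self (h : IsRun a P i (i + 1)) :
    pairing (block a) P (runFlow a P i (i + 1)) (runFlow a P i (i + 1)) = 3 := by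
  have h3 := h.left (h.nonempty rfl).1
  have hne : a i - 2 ≠ 0 := by omega
  rw [h.pairing_runFlow_succ, h.runFlow_succ]
  simp [hne]

end ShortRun

section NonstandardFive

variable {ι α J : Type*} [DecidableEq ι] [DecidableEq α] [Fintype J] {B : ι → Finset α}
  {P : Finset ι} {X : ι} {m m' : α} {v w z v' w' z' x : α → ℤ} {φ : (α → ℤ) → J → ℤ}
  {U : α → J → ℤ} {τ : (α → ℤ) → ℤ} {g : J → ℤ}

/-- A flow `w` of square at most `3` together with a flow `z` of square at most `2`, which is
linked to `w` unless the square of `w` is at most `2`. -/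
structure IsShortPair (B : ι → Finset α) (P : Finset ι) (w z : α → ℤ) : Prop where
  isFlow : IsFlow B P w
  isFlow' : IsFlow B P z
  le_three : pairing B P w w ≤ 3
  le_two : pairing B P z z ≤ 2
  le_two_or : pairing B P w w ≤ 2 ∨ pairing B P z w = 1

/-- A chain of flows `v`, `w`, `z` attached to the block `B X` at its coordinate `m`. -/
structure IsArm (B : ι → Finset α) (P : Finset ι) (X : ι) (m : α) (v w z : α → ℤ) : Prop
    extends IsShortPair B P w z where
  isFlow_base : IsFlow B P v
  base_apply : ∀ c ∈ own B P X, v c = if c = m then 1 else 0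
  pairing_base : pairing B P v v = 3
  apply_eq_zero : ∀ c ∈ own B P X, w c = 0 ∧ z c = 0
  pairing_left : pairing B P w v = 1
  pairing_right : pairing B P z v = 0

/-- `g` is a unit vector orthogonal to the units at `X`, with the stated product with every flow. -/
structure IsResidual (B : ι → Finset α) (P : Finset ι) (φ : (α → ℤ) → J → ℤ) (X : ι)
    (U : α → J → ℤ) (τ : (α → ℤ) → ℤ) (v : α → ℤ) (m : α) (g : J → ℤ) : Prop where
  self : g ⬝ᵥ g = 1
  orthogonal : ∀ c ∈ own B P X, U c ⬝ᵥ g = 0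
  dotProduct_eq : ∀ x, IsFlow B P x →
    φ x ⬝ᵥ g = pairing B P x v + ∑ c ∈ own B P X, x c - x m + 2 * τ x

theorem IsArm.sum_base (h : IsArm B P X m v w z) (hm : m ∈ own B P X) :
    ∑ c ∈ own B P X, v c = 1 := by
  rw [Finset.sum_congr rfl h.base_apply, Finset.sum_ite_eq', if_pos hm]

theorem IsArm.sum_sq_base (h : IsArm B P X m v w z) (hm : m ∈ own B P X) :
    ∑ c ∈ own B P X, v c ^ 2 = 1 := by
  rw [← h.sum_base hm]
  refine Finset.sum_congr rfl fun c hc => ?_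
  rw [h.base_apply c hc]
  split_ifs <;> rfl

theorem IsUnits.exists_isResidual (hU : IsUnits B P φ X U τ) (hφ : IsFlowIsometry B P φ)
    (hcard : (own B P X).card = 3) (h : IsArm B P X m v w z) (hm : m ∈ own B P X)
    (hτ : τ v = -1) : ∃ g, IsResidual B P φ X U τ v m g := by
  set g : J → ℤ := φ v + ∑ c ∈ own B P X, U c - U m with hg
  have hdot : ∀ y : J → ℤ, y ⬝ᵥ g = y ⬝ᵥ φ v + ∑ c ∈ own B P X, y ⬝ᵥ U c - y ⬝ᵥ U m := fun y => by
    rw [hg, dotProduct_sub, dotProduct_add, dotProduct_sum]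
  have horth : ∀ c ∈ own B P X, U c ⬝ᵥ g = 0 := fun c hc => by
    rw [hdot, dotProduct_comm, hU.dotProduct_eq v h.isFlow_base c hc, h.base_apply c hc, hτ,
      Finset.sum_congr rfl (hU.orthonormal c hc), hU.orthonormal c hc m hm, Finset.sum_ite_eq,
      if_pos hc]
    ring
  have hflow : ∀ x, IsFlow B P x →
      φ x ⬝ᵥ g = pairing B P x v + ∑ c ∈ own B P X, x c - x m + 2 * τ x := fun x hx => by
    rw [hdot, hφ x v hx h.isFlow_base, Finset.sum_congr rfl (hU.dotProduct_eq x hx),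
      hU.dotProduct_eq x hx m hm, Finset.sum_add_distrib, Finset.sum_const, hcard]
    ring
  refine ⟨g, ?_, horth, hflow⟩
  calc g ⬝ᵥ g = φ v ⬝ᵥ g + ∑ c ∈ own B P X, U c ⬝ᵥ g - U m ⬝ᵥ g := by
        rw [dotProduct_comm, hdot, dotProduct_comm g (φ v), dotProduct_comm g (U m),
          Finset.sum_congr rfl fun c _ => dotProduct_comm g (U c)]
    _ = 1 := by
        rw [Finset.sum_congr rfl horth, horth m hm, hflow v h.isFlow_base, h.pairing_base,
          h.sum_base hm, h.base_apply m hm, hτ, if_pos rfl]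
        simp

section Residual

variable (hU : IsUnits B P φ X U τ) (hφ : IsFlowIsometry B P φ) (hcard : (own B P X).card = 3)
  (hg : IsResidual B P φ X U τ v m g)
include hU hφ hcard hg

theorem IsResidual.sq_add_le_pairing (hx : IsFlow B P x) :
    (pairing B P x v + ∑ c ∈ own B P X, x c - x m + 2 * τ x) ^ 2 +
      (∑ c ∈ own B P X, x c ^ 2 + 2 * τ x * ∑ c ∈ own B P X, x c + 3 * τ x ^ 2) ≤
      pairing B P x x := by
  have hsum := (hU.orthonormal.insertNone hg.self hg.orthogonal).sum_sq_dotProduct_le (φ x)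
  rw [Finset.sum_insertNone, hφ x x hx hx] at hsum
  simp only [Option.elim_none, Option.elim_some] at hsum
  rwa [hg.dotProduct_eq x hx, hU.sum_sq_dotProduct hx, hcard, Nat.cast_ofNat] at hsum

theorem IsResidual.tau_eq_zero (hm : m ∈ own B P X) (hx : IsFlow B P x)
    (hzero : ∀ c ∈ own B P X, x c = 0) (hle : pairing B P x x ≤ 3)
    (hxv : pairing B P x v = 0 ∨ pairing B P x v = 1) : τ x = 0 := by
  have hsq := hg.sq_add_le_pairing hU hφ hcard hx
  rw [Finset.sum_eq_zero hzero, hzero m hm,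
    Finset.sum_eq_zero fun c hc => by rw [hzero c hc, zero_pow two_ne_zero]] at hsq
  have hlo : -1 < τ x := by rcases hxv with h | h <;> rw [h] at hsq <;> nlinarith
  have hhi : τ x < 1 := by rcases hxv with h | h <;> rw [h] at hsq <;> nlinarith
  omega

theorem IsResidual.dotProduct_eq_pairing (hm : m ∈ own B P X) (hm' : m' ∈ own B P X)
    (hx : IsFlow B P x) (hzero : ∀ c ∈ own B P X, x c = 0) (hle : pairing B P x x ≤ 3)
    (hxv : pairing B P x v = 0 ∨ pairing B P x v = 1) :
    φ x ⬝ᵥ g = pairing B P x v ∧ φ x ⬝ᵥ U m' = 0 := by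
  rw [hg.dotProduct_eq x hx, hU.dotProduct_eq x hx m' hm', Finset.sum_eq_zero hzero, hzero m hm,
    hzero m' hm', hg.tau_eq_zero hU hφ hcard hm hx hzero hle hxv]
  simp only [add_zero, mul_zero, sub_zero, and_self]

theorem IsResidual.dotProduct_eq_pairing_of_isArm {n : α} {y : α → ℤ} (R : IsArm B P X n y w z)
    (hm : m ∈ own B P X) (hm' : m' ∈ own B P X)
    (hwv : pairing B P w v = 0 ∨ pairing B P w v = 1) (hzv : pairing B P z v = 0) :
    (φ w ⬝ᵥ g = pairing B P w v ∧ φ w ⬝ᵥ U m' = 0) ∧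
      φ z ⬝ᵥ g = pairing B P z v ∧ φ z ⬝ᵥ U m' = 0 :=
  ⟨hg.dotProduct_eq_pairing hU hφ hcard hm hm' R.isFlow (fun c hc => (R.apply_eq_zero c hc).1)
      R.le_three hwv,
    hg.dotProduct_eq_pairing hU hφ hcard hm hm' R.isFlow' (fun c hc => (R.apply_eq_zero c hc).2)
      (by linarith [R.le_two]) (Or.inl hzv)⟩

theorem IsResidual.tau_base_eq_zero (R : IsArm B P X m v w z) (L : IsArm B P X m' v' w' z')
    (hm : m ∈ own B P X) (hm' : m' ∈ own B P X) (hne : m ≠ m')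
    (hvv : pairing B P v v' = 0) (hwv : pairing B P w v' = 0) : τ v' = 0 := by
  have hw : τ w = 0 := hg.tau_eq_zero hU hφ hcard hm R.isFlow (fun c hc => (R.apply_eq_zero c hc).1)
    R.le_three (Or.inr R.pairing_left)
  have hgv : φ v' ⬝ᵥ g = 1 + 2 * τ v' := by
    rw [hg.dotProduct_eq v' L.isFlow_base, pairing_comm, hvv, L.sum_base hm', L.base_apply m hm,
      if_neg hne]
    ring
  have hgw : φ w ⬝ᵥ g = 1 := by
    rw [hg.dotProduct_eq w R.isFlow, R.pairing_left, hw, (R.apply_eq_zero m hm).1,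
      Finset.sum_eq_zero fun c hc => (R.apply_eq_zero c hc).1]
    norm_num
  have hUw : ∀ c ∈ own B P X, φ w ⬝ᵥ U c = 0 := fun c hc => by
    rw [hU.dotProduct_eq w R.isFlow c hc, (R.apply_eq_zero c hc).1, hw, add_zero]
  have hsq := hg.sq_add_le_pairing hU hφ hcard L.isFlow_base
  rw [← hg.dotProduct_eq v' L.isFlow_base, hgv, L.sum_base hm', L.sum_sq_base hm',
    L.pairing_base] at hsq
  have hτ : τ v' = 0 ∨ τ v' = -1 := by
    have hlo : -2 < τ v' := by nlinarith
    have hhi : τ v' < 1 := by nlinarith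
    omega
  refine hτ.resolve_right fun hτ => ?_
  have heq := (hU.orthonormal.insertNone hg.self hg.orthogonal
    ).dotProduct_eq_sum_of_dotProduct_self_le (x := φ v') ?_ (φ w)
  · rw [Finset.sum_insertNone, hφ w v' R.isFlow L.isFlow_base, hwv,
      Finset.sum_eq_zero fun c hc => by rw [Option.elim_some, hUw c hc, mul_zero],
      Option.elim_none, hgv, hgw, hτ] at heq
    norm_num at heq
  · rw [hφ v' v' L.isFlow_base L.isFlow_base, L.pairing_base, Finset.sum_insertNone]
    simp only [Option.elim_none, Option.elim_some]
    rw [hgv, hU.sum_sq_dotProduct L.isFlow_base, L.sum_base hm', L.sum_sq_base hm', hcard, hτ]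
    norm_num

end Residual

theorem dotProduct_self_pos_of_dotProduct_ne_zero {x y : J → ℤ} (h : y ⬝ᵥ x ≠ 0) : 0 < x ⬝ᵥ x :=
  (dotProduct_self_nonneg x).lt_of_ne fun h0 => h (by
    rw [dotProduct_self_eq_zero.1 h0.symm, dotProduct_zero])

theorem dotProduct_eq_zero_and_dotProduct_self_eq_one {x u g : J → ℤ} (hx : x ⬝ᵥ x = 3)
    (hu : u ⬝ᵥ u = 1) (hg : g ⬝ᵥ g = 1) (hxu : x ⬝ᵥ u = 1) (hxg : x ⬝ᵥ g = 1)
    (hug : u ⬝ᵥ g = 0) : g ⬝ᵥ (x - u - g) = 0 ∧ (x - u - g) ⬝ᵥ (x - u - g) = 1 := by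
  simp only [sub_dotProduct, dotProduct_sub, dotProduct_comm u x, dotProduct_comm g x,
    dotProduct_comm g u]
  omega

/-- `h = w - g + g'` and `k = w' - g' - h` would be orthogonal unit vectors with `z = h - k`. -/
theorem false_of_linked_pairs {g g' w z w' z' : J → ℤ} (hg : g ⬝ᵥ g = 1) (hg' : g' ⬝ᵥ g' = 1)
    (hgg' : g ⬝ᵥ g' = 0) (hwg : w ⬝ᵥ g = 1) (hwg' : w ⬝ᵥ g' = -1) (hw'g : w' ⬝ᵥ g = 0)
    (hw'g' : w' ⬝ᵥ g' = 1) (hzg : z ⬝ᵥ g = 0) (hzg' : z ⬝ᵥ g' = 0) (hz'g : z' ⬝ᵥ g = 0)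
    (hz'g' : z' ⬝ᵥ g' = 0) (hw'w : w' ⬝ᵥ w = 0) (hzw' : z ⬝ᵥ w' = 0) (hz'w : z' ⬝ᵥ w = 0)
    (hz'z : z' ⬝ᵥ z = 0) (hw : w ⬝ᵥ w ≤ 3) (hz : z ⬝ᵥ z ≤ 2) (hw' : w' ⬝ᵥ w' ≤ 3)
    (hwz : w ⬝ᵥ w ≤ 2 ∨ z ⬝ᵥ w = 1) (hwz' : w' ⬝ᵥ w' ≤ 2 ∨ z' ⬝ᵥ w' = 1) : False := by
  set h := w - g + g' with hh
  have hdot : ∀ x, x ⬝ᵥ h = x ⬝ᵥ w - x ⬝ᵥ g + x ⬝ᵥ g' := fun x => by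
    rw [hh, dotProduct_add, dotProduct_sub]
  have hgh : h ⬝ᵥ g = 0 := by
    rw [dotProduct_comm, hdot, dotProduct_comm g w, hwg, hg, hgg']; norm_num
  have hg'h : h ⬝ᵥ g' = 0 := by
    rw [dotProduct_comm, hdot, dotProduct_comm g' w, dotProduct_comm g', hwg', hg', hgg']; norm_num
  have hself : h ⬝ᵥ h = w ⬝ᵥ w - 2 := by
    rw [hdot, hgh, hg'h, dotProduct_comm h w, hdot, hwg, hwg']; ring
  have hw'h : w' ⬝ᵥ h = 1 := by rw [hdot, hw'w, hw'g, hw'g']; norm_num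
  have hpos := dotProduct_self_pos_of_dotProduct_ne_zero (hw'h.trans_ne one_ne_zero)
  have hzh : z ⬝ᵥ h = 1 := by rw [hdot, hzg, hzg', hwz.resolve_left (by omega)]; norm_num
  have hz'h : z' ⬝ᵥ h = 0 := by rw [hdot, hz'w, hz'g, hz'g']; norm_num
  set k := w' - g' - h with hk
  have kdot : ∀ x, x ⬝ᵥ k = x ⬝ᵥ w' - x ⬝ᵥ g' - x ⬝ᵥ h := fun x => by
    rw [hk, dotProduct_sub, dotProduct_sub]
  have hg'k : k ⬝ᵥ g' = 0 := by
    rw [dotProduct_comm, kdot, dotProduct_comm g' w', dotProduct_comm g' h, hw'g', hg', hg'h]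
    norm_num
  have hhk : k ⬝ᵥ h = 0 := by
    rw [dotProduct_comm, kdot, dotProduct_comm h w', hw'h, hg'h, hself]; omega
  have kself : k ⬝ᵥ k = w' ⬝ᵥ w' - 2 := by
    rw [kdot, hg'k, hhk, dotProduct_comm k w', kdot, hw'g', hw'h]; ring
  have hzk : z ⬝ᵥ k = -1 := by rw [kdot, hzw', hzg', hzh]; norm_num
  have kpos := dotProduct_self_pos_of_dotProduct_ne_zero (hzk.trans_ne (by norm_num))
  have hz'k : z' ⬝ᵥ k = 1 := by rw [kdot, hwz'.resolve_left (by omega), hz'g', hz'h]; norm_num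
  have hne : z' ⬝ᵥ (z - h + k) ≠ 0 := by
    rw [dotProduct_add, dotProduct_sub, hz'z, hz'h, hz'k]; norm_num
  refine (dotProduct_self_pos_of_dotProduct_ne_zero hne).not_ge ?_
  simp only [add_dotProduct, sub_dotProduct, dotProduct_add, dotProduct_sub, dotProduct_comm h z,
    dotProduct_comm k z, dotProduct_comm h k]
  omega

theorem IsUnits.tau_ne_neg_one (hU : IsUnits B P φ X U τ) (hφ : IsFlowIsometry B P φ)
    (hcard : (own B P X).card = 3) (R : IsArm B P X m v w z) (L : IsArm B P X m' v' w' z')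
    (hm : m ∈ own B P X) (hm' : m' ∈ own B P X) (hne : m ≠ m')
    (horth : ∀ x ∈ ({v, w, z} : Set (α → ℤ)), ∀ y ∈ ({v', w', z'} : Set (α → ℤ)),
      pairing B P x y = 0) : τ v ≠ -1 := fun hτ => by
  obtain ⟨g, hg⟩ := hU.exists_isResidual hφ hcard R hm hτ
  simp only [Set.mem_insert_iff, Set.mem_singleton_iff, forall_eq_or_imp, forall_eq] at horth
  obtain ⟨⟨hvv', hvw', hvz'⟩, ⟨hwv', hww', hwz'⟩, hzv', hzw', hzz'⟩ := horth
  have hτv' := hg.tau_base_eq_zero hU hφ hcard R L hm hm' hne hvv' hwv'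
  obtain ⟨hw, hz⟩ := hg.dotProduct_eq_pairing_of_isArm hU hφ hcard R hm hm'
    (Or.inr R.pairing_left) R.pairing_right
  obtain ⟨hw', hz'⟩ := hg.dotProduct_eq_pairing_of_isArm hU hφ hcard L hm hm'
    (Or.inl (by rw [pairing_comm, hvw'])) (by rw [pairing_comm, hvz'])
  have hgv' : φ v' ⬝ᵥ g = 1 := by
    rw [hg.dotProduct_eq v' L.isFlow_base, pairing_comm, hvv', hτv', L.sum_base hm',
      L.base_apply m hm, if_neg hne]
    norm_num
  have hUv' : φ v' ⬝ᵥ U m' = 1 := by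
    rw [hU.dotProduct_eq v' L.isFlow_base m' hm', hτv', L.base_apply m' hm', if_pos rfl, add_zero]
  set g' := φ v' - U m' - g with hg'
  obtain ⟨hgg', hg'g'⟩ : g ⬝ᵥ g' = 0 ∧ g' ⬝ᵥ g' = 1 :=
    dotProduct_eq_zero_and_dotProduct_self_eq_one
      (by rw [hφ _ _ L.isFlow_base L.isFlow_base, L.pairing_base])
      (by rw [hU.orthonormal m' hm' m' hm', if_pos rfl]) hg.self hUv' hgv' (hg.orthogonal m' hm')
  have hflow : ∀ {x}, IsFlow B P x → φ x ⬝ᵥ g' = pairing B P x v' - φ x ⬝ᵥ U m' - φ x ⬝ᵥ g :=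
    fun {x} hx => by rw [hg', dotProduct_sub, dotProduct_sub, hφ x v' hx L.isFlow_base]
  refine false_of_linked_pairs hg.self hg'g' hgg' (w := φ w) (z := φ z) (w' := φ w') (z' := φ z')
    (by rw [hw.1, R.pairing_left]) (by rw [hflow R.isFlow, hwv', hw.1, hw.2, R.pairing_left]; rfl)
    (by rw [hw'.1, pairing_comm, hvw'])
    (by rw [hflow L.isFlow, L.pairing_left, hw'.1, hw'.2, pairing_comm, hvw']; rfl)
    (by rw [hz.1, R.pairing_right])
    (by rw [hflow R.isFlow', hzv', hz.1, hz.2, R.pairing_right]; rfl)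
    (by rw [hz'.1, pairing_comm, hvz'])
    (by rw [hflow L.isFlow', L.pairing_right, hz'.1, hz'.2, pairing_comm, hvz']; rfl)
    (by rw [hφ _ _ L.isFlow R.isFlow, pairing_comm, hww'])
    (by rw [hφ _ _ R.isFlow' L.isFlow, hzw'])
    (by rw [hφ _ _ L.isFlow' R.isFlow, pairing_comm, hwz'])
    (by rw [hφ _ _ L.isFlow' R.isFlow', pairing_comm, hzz'])
    ((hφ _ _ R.isFlow R.isFlow).trans_le R.le_three)
    ((hφ _ _ R.isFlow' R.isFlow').trans_le R.le_two)
    ((hφ _ _ L.isFlow L.isFlow).trans_le L.le_three)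
    (by rw [hφ _ _ R.isFlow R.isFlow, hφ _ _ R.isFlow' R.isFlow]; exact R.le_two_or)
    (by rw [hφ _ _ L.isFlow L.isFlow, hφ _ _ L.isFlow' L.isFlow]; exact L.le_two_or)

end NonstandardFive

section OuterFlows

variable {a : ℤ → ℕ} {P : Finset ℤ} {X Y i j p : ℤ} {c d : ℤ × ℕ}

theorem isShortPair_diff (hY : Y ∈ P) (hc : c ∈ own (block a) P Y) (hd : d ∈ own (block a) P Y)
    (hdc : d ≠ c) : IsShortPair (block a) P (diff c d) 0 := by
  have hpair : pairing (block a) P (diff c d) (diff c d) = 2 := by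
    rw [pairing_diff hY hc hd, diff_apply, diff_apply]
    simp [hdc, hdc.symm]
  exact ⟨isFlow_diff hc hd, fun _ _ => Finset.sum_const_zero, hpair.trans_le (by norm_num),
    (pairing_eq_zero fun _ _ _ _ => Or.inl rfl).trans_le (by norm_num), Or.inl hpair.le⟩

theorem diff_eq_zero_of_mem_block (hc : c ∈ own (block a) P Y) (hd : d ∈ own (block a) P Y)
    (hp : p ∈ P) (hpY : p ≠ Y) {e : ℤ × ℕ} (he : e ∈ block a p) : diff c d e = 0 := by
  have hne : ∀ {c}, c ∈ own (block a) P Y → e ≠ c := by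
    rintro c hc rfl
    exact hpY ((mem_block_iff_of_mem_own hp hc).1 he)
  rw [diff_apply, if_neg (hne hc), if_neg (hne hd), sub_zero]

theorem runFlow_eq_zero_of_lt (hp : p < i) (hij : i < j) (hc : c ∈ block a p) :
    runFlow a P i j c = 0 := by
  rcases c with ⟨q, t⟩
  simp only [mem_block, Prod.mk.injEq] at hc
  simp only [runFlow, Prod.mk.injEq]
  split_ifs <;> omega

theorem runFlow_eq_zero_of_gt (hp : j < p) (hij : i < j) (hc : c ∈ block a p) :
    runFlow a P i j c = 0 := by
  rcases c with ⟨q, t⟩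
  simp only [mem_block, Prod.mk.injEq] at hc
  simp only [runFlow, Prod.mk.injEq]
  split_ifs <;> omega

theorem runFlow_apply_left (hi : i ∈ P) (h3 : 3 ≤ a i) : runFlow a P i j (i, a i - 2) = 1 := by
  simp [runFlow, hi, show a i - 2 ≠ 0 by omega]

theorem runFlow_apply_right (hij : i < j) (hj : j ∈ P) :
    runFlow a P i j (j, 1) = -((j - i).negOnePow : ℤ) := by
  simp [runFlow, hj, hij.ne']

theorem mem_own_left (h2 : ∀ i ∈ P, 2 ≤ a i) (hX : X ∈ P) (h3 : 3 ≤ a X) :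
    (X, 1) ∈ own (block a) P X :=
  (mem_own h2 hX).2 (Or.inl ⟨rfl, one_ne_zero, by simp only; omega⟩)

theorem mem_own_right (h2 : ∀ i ∈ P, 2 ≤ a i) (hX : X ∈ P) (h3 : 3 ≤ a X) :
    (X, a X - 2) ∈ own (block a) P X :=
  (mem_own h2 hX).2 (Or.inl ⟨rfl, by simp only; omega, by simp only; omega⟩)

theorem exists_ne_mem_own_or (h2 : ∀ i ∈ P, 2 ≤ a i) (hX : X ∈ P) (h3 : 3 ≤ a X) (c : ℤ × ℕ) :
    (∃ d ∈ own (block a) P X, d ≠ c) ∨ a X = 3 ∧ X - 1 ∈ P ∧ X + 1 ∈ P := by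
  refine or_iff_not_imp_left.2 fun h => ?_
  push Not at h
  have hle : (own (block a) P X).card ≤ 1 :=
    Finset.card_le_one.2 fun d hd e he => (h d hd).trans (h e he).symm
  have hadd := card_own_add h2 hX
  split_ifs at hadd with hl hr hr <;> first | exact ⟨by omega, hl, hr⟩ | omega

theorem exists_isFlow_right (h2 : ∀ i ∈ P, 2 ≤ a i) (hY : Y ∈ P) (h3 : 3 ≤ a Y) :
    ∃ y, IsFlow (block a) P y ∧ y (Y, 1) = 1 ∧ ∀ p ∈ P, p < Y → ∀ c ∈ block a p, y c = 0 := by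
  have hown := mem_own_left h2 hY h3
  rcases exists_ne_mem_own_or h2 hY h3 (Y, 1) with ⟨d, hd, hne⟩ | ⟨hY3, -, hY'⟩
  · exact ⟨diff (Y, 1) d, isFlow_diff hown hd, by simp [diff_apply, hne.symm],
      fun p hp hlt c hc => diff_eq_zero_of_mem_block hown hd hp hlt.ne hc⟩
  · obtain ⟨j, h⟩ := exists_isRun_right h2 (fun _ => h3) hY' fun h => absurd hY h
    refine ⟨runFlow a P Y j, isFlow_runFlow h, ?_, fun p _ hlt c hc =>
      runFlow_eq_zero_of_lt hlt h.lt hc⟩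
    simpa only [hY3] using runFlow_apply_left (j := j) hY h3

theorem exists_isFlow_left (h2 : ∀ i ∈ P, 2 ≤ a i) (hY : Y ∈ P) (h3 : 3 ≤ a Y) :
    ∃ y, IsFlow (block a) P y ∧ y (Y, a Y - 2) = 1 ∧
      ∀ p ∈ P, Y < p → ∀ c ∈ block a p, y c = 0 := by
  have hown := mem_own_right h2 hY h3
  rcases exists_ne_mem_own_or h2 hY h3 (Y, a Y - 2) with ⟨d, hd, hne⟩ | ⟨hY3, hY', -⟩
  · exact ⟨diff (Y, a Y - 2) d, isFlow_diff hown hd, by simp [diff_apply, hne.symm],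
      fun p hp hlt c hc => diff_eq_zero_of_mem_block hown hd hp hlt.ne' hc⟩
  · obtain ⟨i, h⟩ := exists_isRun_left h2 hY h3 hY'
    refine ⟨(-((Y - i).negOnePow : ℤ)) • runFlow a P i Y, (isFlow_runFlow h).smul _, ?_,
      fun p _ hlt c hc => ?_⟩
    · rw [Pi.smul_apply, hY3, runFlow_apply_right h.lt hY, smul_eq_mul, neg_mul_neg,
        ← abs_mul_abs_self, Int.abs_negOnePow, one_mul]
    · rw [Pi.smul_apply, runFlow_eq_zero_of_gt hlt h.lt hc, smul_zero]

theorem exists_isShortPair_right (h2 : ∀ i ∈ P, 2 ≤ a i) (hY : Y ∈ P) (h3 : 3 ≤ a Y)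
    (h5 : a Y = 3 → Y + 1 ∈ P → 5 ≤ a (Y + 1)) :
    ∃ w z, IsShortPair (block a) P w z ∧ w (Y, 1) = 1 ∧ z (Y, 1) = 0 ∧
      ∀ p ∈ P, p < Y → ∀ c ∈ block a p, w c = 0 ∧ z c = 0 := by
  have hown := mem_own_left h2 hY h3
  rcases exists_ne_mem_own_or h2 hY h3 (Y, 1) with ⟨d, hd, hne⟩ | ⟨hY3, -, hY'⟩
  · exact ⟨diff (Y, 1) d, 0, isShortPair_diff hY hown hd hne, by simp [diff_apply, hne.symm], rfl,
      fun p hp hlt c hc => ⟨diff_eq_zero_of_mem_block hown hd hp hlt.ne hc, rfl⟩⟩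
  have h5 := h5 hY3 hY'
  have h := isRun_succ hY hY' h3 (by omega)
  have hown1 := mem_own_left h2 hY' (by omega)
  have hown2 : (Y + 1, 2) ∈ own (block a) P (Y + 1) :=
    (mem_own h2 hY').2 (Or.inl ⟨rfl, two_ne_zero, by simp only; omega⟩)
  have hz := isShortPair_diff hY' hown1 hown2 (by simp)
  refine ⟨runFlow a P Y (Y + 1), diff (Y + 1, 1) (Y + 1, 2), ⟨isFlow_runFlow h, hz.isFlow,
    h.pairing_runFlow_succ_self.le, ?_, Or.inr ?_⟩, ?_, by simp [diff_apply], fun p hp hlt c hc =>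
    ⟨runFlow_eq_zero_of_lt hlt h.lt hc, diff_eq_zero_of_mem_block hown1 hown2 hp (by omega) hc⟩⟩
  · rw [pairing_diff hY' hown1 hown2]
    simp [diff_apply]
  · rw [pairing_comm, h.pairing_runFlow_succ]
    simp [diff_apply]
  · simpa only [hY3] using runFlow_apply_left (j := Y + 1) hY h3

theorem exists_isShortPair_left (h2 : ∀ i ∈ P, 2 ≤ a i) (hY : Y + 1 ∈ P) (h3 : 3 ≤ a (Y + 1))
    (h5 : a (Y + 1) = 3 → Y ∈ P → 5 ≤ a Y) :
    ∃ w z, IsShortPair (block a) P w z ∧ w (Y + 1, a (Y + 1) - 2) = 1 ∧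
      z (Y + 1, a (Y + 1) - 2) = 0 ∧
      ∀ p ∈ P, Y + 1 < p → ∀ c ∈ block a p, w c = 0 ∧ z c = 0 := by
  have hown := mem_own_right h2 hY h3
  rcases exists_ne_mem_own_or h2 hY h3 (Y + 1, a (Y + 1) - 2) with ⟨d, hd, hne⟩ | ⟨hY3, hY', -⟩
  · exact ⟨diff (Y + 1, a (Y + 1) - 2) d, 0, isShortPair_diff hY hown hd hne,
      by simp [diff_apply, hne.symm], rfl,
      fun p hp hlt c hc => ⟨diff_eq_zero_of_mem_block hown hd hp hlt.ne' hc, rfl⟩⟩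
  rw [add_sub_cancel_right] at hY'
  have h5 := h5 hY3 hY'
  have h := isRun_succ hY' hY (by omega) h3
  have hown1 := mem_own_right h2 hY' (by omega)
  have hown2 := mem_own_left h2 hY' (by omega)
  have hne : a Y - 2 ≠ 1 := by omega
  have hz := isShortPair_diff hY' hown1 hown2 (by simpa using hne.symm)
  refine ⟨runFlow a P Y (Y + 1), diff (Y, a Y - 2) (Y, 1), ⟨isFlow_runFlow h, hz.isFlow,
    h.pairing_runFlow_succ_self.le, ?_, Or.inr ?_⟩, ?_, by simp [diff_apply], fun p hp hlt c hc =>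
    ⟨runFlow_eq_zero_of_gt hlt h.lt hc, diff_eq_zero_of_mem_block hown1 hown2 hp (by omega) hc⟩⟩
  · rw [pairing_diff hY' hown1 hown2]
    simp [diff_apply, hne, hne.symm]
  · rw [pairing_comm, h.pairing_runFlow_succ]
    simp [diff_apply, hne]
  · simp [h.runFlow_succ, hY3]

theorem IsRun.exists_isFlow_pairing_eq_one (h2 : ∀ i ∈ P, 2 ≤ a i) (h : IsRun a P i (i + 1))
    (hX : X ∈ P) : ∃ y, IsFlow (block a) P y ∧
      pairing (block a) P y (runFlow a P i (i + 1)) = 1 ∧ ∀ c ∈ block a X, y c = 0 := by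
  obtain ⟨hi, hi'⟩ := h.nonempty rfl
  have h3 := h.left hi
  have h3' := h.right hi'
  rcases lt_or_ge i X with hlt | hle
  · obtain ⟨y, hy, hy1, hzero⟩ := exists_isFlow_left h2 hi h3
    refine ⟨y, hy, ?_, hzero X hX hlt⟩
    rw [pairing_comm, h.pairing_runFlow_succ, hy1,
      hzero _ hi' (by omega) _ (mem_block.2 (Or.inr ⟨rfl, by simp only; omega⟩)),
      hzero _ hi' (by omega) _ (left_mem_block (by omega))]
    norm_num
  · obtain ⟨y, hy, hy1, hzero⟩ := exists_isFlow_right h2 hi' h3'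
    refine ⟨y, hy, ?_, hzero X hX (by omega)⟩
    rw [pairing_comm, h.pairing_runFlow_succ, hy1,
      hzero _ hi (by omega) _ (mem_block.2 (Or.inr ⟨rfl, by simp only; omega⟩)),
      hzero _ hi (by omega) _ right_mem_block]
    norm_num

end OuterFlows

section Arms

variable {a : ℤ → ℕ} {P : Finset ℤ} {X : ℤ}

theorem exists_isArm_right (h2 : ∀ i ∈ P, 2 ≤ a i) (hX : X ∈ P) (hX' : X + 1 ∈ P) (h3 : 3 ≤ a X)
    (h3' : 3 ≤ a (X + 1)) (h5 : a (X + 1) = 3 → X + 2 ∈ P → 5 ≤ a (X + 2)) :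
    ∃ w z, IsArm (block a) P X (X, a X - 2) (runFlow a P X (X + 1)) w z ∧
      ∀ p ∈ P, p ≤ X → ∀ c ∈ block a p, w c = 0 ∧ z c = 0 := by
  have h := isRun_succ hX hX' h3 h3'
  obtain ⟨w, z, hwz, hw1, hz1, hzero⟩ :=
    exists_isShortPair_right h2 hX' h3' (by rwa [add_assoc, one_add_one_eq_two])
  replace hzero : ∀ p ∈ P, p ≤ X → ∀ c ∈ block a p, w c = 0 ∧ z c = 0 :=
    fun p hp hle => hzero p hp (by omega)
  have hinner := hzero X hX le_rfl (X, a X - 2) (mem_block.2 (Or.inr ⟨rfl, by simp only; omega⟩))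
  have hcorner := hzero X hX le_rfl (X + 1, 0) right_mem_block
  refine ⟨w, z, ⟨hwz, isFlow_runFlow h, fun c hc => ?_, h.pairing_runFlow_succ_self, fun c hc =>
    hzero X hX le_rfl c (Finset.sdiff_subset hc), ?_, ?_⟩, hzero⟩
  · split_ifs with hcm
    · rw [hcm, runFlow_apply_left hX h3]
    · by_contra h0
      rcases eq_of_runFlow_ne_zero_of_mem_own h2 h hX h3 hc h0 with h | h
      · exact hcm h.2
      · omega
  · rw [pairing_comm, h.pairing_runFlow_succ, hinner.1, hcorner.1, hw1]
    norm_num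
  · rw [pairing_comm, h.pairing_runFlow_succ, hinner.2, hcorner.2, hz1]
    norm_num

theorem exists_isArm_left (h2 : ∀ i ∈ P, 2 ≤ a i) (hX : X + 1 ∈ P) (hX' : X ∈ P)
    (h3 : 3 ≤ a (X + 1)) (h3' : 3 ≤ a X) (h5 : a X = 3 → X - 1 ∈ P → 5 ≤ a (X - 1)) :
    ∃ w z, IsArm (block a) P (X + 1) (X + 1, 1) (runFlow a P X (X + 1)) w z ∧
      ∀ p ∈ P, X < p → ∀ c ∈ block a p, w c = 0 ∧ z c = 0 := by
  have h := isRun_succ hX' hX h3' h3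
  obtain ⟨Y, rfl⟩ : ∃ Y, X = Y + 1 := ⟨X - 1, by ring⟩
  obtain ⟨w, z, hwz, hw1, hz1, hzero⟩ := exists_isShortPair_left h2 hX' h3' (by simpa using h5)
  have hinner := hzero _ hX (lt_add_one _) (Y + 1 + 1, 1)
    (mem_block.2 (Or.inr ⟨rfl, by simp only; omega⟩))
  have hcorner := hzero _ hX (lt_add_one _) (Y + 1 + 1, 0) (left_mem_block (by omega))
  refine ⟨w, z, ⟨hwz, isFlow_runFlow h, fun c hc => ?_, h.pairing_runFlow_succ_self, fun c hc =>
    hzero _ hX (lt_add_one _) c (Finset.sdiff_subset hc), ?_, ?_⟩, hzero⟩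
  · split_ifs with hcm
    · simp [hcm, h.runFlow_succ]
    · by_contra h0
      rcases eq_of_runFlow_ne_zero_of_mem_own h2 h hX h3 hc h0 with h | h
      · omega
      · exact hcm h.2
  · rw [pairing_comm, h.pairing_runFlow_succ, hinner.1, hcorner.1, hw1]
    norm_num
  · rw [pairing_comm, h.pairing_runFlow_succ, hinner.2, hcorner.2, hz1]
    norm_num

end Arms

section Sparse

variable {a : ℤ → ℕ} {P : Finset ℤ} {X Y : ℤ}

/-- A vertex of weight `-2` or `-4`, or one of two adjacent vertices of weight `-3`. -/
def IsSeed (a : ℤ → ℕ) (P : Finset ℤ) (Y : ℤ) : Prop :=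
  Y ∈ P ∧ (a Y = 2 ∨ a Y = 4 ∨ a Y = 3 ∧ (Y + 1 ∈ P ∧ a (Y + 1) = 3 ∨ Y - 1 ∈ P ∧ a (Y - 1) = 3))

/-- A vertex that is far from all seeds, and is isolated unless its weight is at most `-5`. -/
structure IsSparse (a : ℤ → ℕ) (P : Finset ℤ) (X : ℤ) : Prop where
  mem : X ∈ P
  far : ∀ Y, IsSeed a P Y → X + 2 < Y ∨ Y + 2 < X
  big : 5 ≤ a X ∨ X - 1 ∉ P ∧ X + 1 ∉ P

theorem IsSparse.three_le (hX : IsSparse a P X) (h2 : ∀ i ∈ P, 2 ≤ a i) (hY : Y ∈ P)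
    (h1 : X ≤ Y + 2) (h1' : Y ≤ X + 2) : 3 ≤ a Y ∧ a Y ≠ 4 := by
  have hns : ¬ IsSeed a P Y := fun h => by
    have := hX.far Y h
    omega
  have h2Y := h2 Y hY
  have hne2 : a Y ≠ 2 := fun h => hns ⟨hY, Or.inl h⟩
  exact ⟨by omega, fun h => hns ⟨hY, Or.inr (Or.inl h)⟩⟩

theorem IsSparse.three_le_card_own (hX : IsSparse a P X) (h2 : ∀ i ∈ P, 2 ≤ a i) :
    3 ≤ (own (block a) P X).card := by
  have hadd := card_own_add h2 hX.mem
  have h3 := hX.three_le h2 hX.mem (by omega) (by omega)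
  rcases hX.big with h | ⟨h, h'⟩
  · split_ifs at hadd <;> omega
  · rw [if_neg h, if_neg h'] at hadd
    omega

theorem exists_isFlow_unit_own_left (h2 : ∀ i ∈ P, 2 ≤ a i) (hX : X ∈ P) (h3 : 3 ≤ a X)
    (hX' : X - 1 ∈ P) : ∃ y, IsFlow (block a) P y ∧ y (X, 1) = 1 ∧
      ∀ c ∈ own (block a) P X, c ≠ (X, 1) → y c = 0 := by
  obtain ⟨i, h⟩ := exists_isRun_left h2 hX h3 hX'
  refine ⟨(-((X - i).negOnePow : ℤ)) • runFlow a P i X, (isFlow_runFlow h).smul _, ?_,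
    fun c hc hne => ?_⟩
  · rw [Pi.smul_apply, runFlow_apply_right h.lt hX, smul_eq_mul, neg_mul_neg,
      ← abs_mul_abs_self, Int.abs_negOnePow, one_mul]
  · by_contra h0
    rcases eq_of_runFlow_ne_zero_of_mem_own h2 h hX h3 hc
      (fun h => h0 (by rw [Pi.smul_apply, h, smul_zero])) with ⟨h', -⟩ | ⟨-, h'⟩
    · exact h.lt.ne' h'
    · exact hne h'

theorem exists_isFlow_unit_own_right (h2 : ∀ i ∈ P, 2 ≤ a i) (hX : X ∈ P) (h3 : 3 ≤ a X)
    (hX' : X + 1 ∈ P) : ∃ y, IsFlow (block a) P y ∧ y (X, a X - 2) = 1 ∧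
      ∀ c ∈ own (block a) P X, c ≠ (X, a X - 2) → y c = 0 := by
  obtain ⟨j, h⟩ := exists_isRun_right h2 (fun _ => h3) hX' fun h => absurd hX h
  refine ⟨runFlow a P X j, isFlow_runFlow h, runFlow_apply_left hX h3, fun c hc hne => ?_⟩
  by_contra h0
  rcases eq_of_runFlow_ne_zero_of_mem_own h2 h hX h3 hc h0 with ⟨-, h'⟩ | ⟨h', -⟩
  · exact hne h'
  · exact h.lt.ne h'

variable {J : Type*} [Fintype J] {φ : (ℤ × ℕ → ℤ) → J → ℤ} {U : ℤ × ℕ → J → ℤ}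
  {τ : (ℤ × ℕ → ℤ) → ℤ} {i : ℤ}

theorem IsSparse.exists_isUnits (hX : IsSparse a P X) (h2 : ∀ i ∈ P, 2 ≤ a i)
    (hφ : IsFlowIsometry (block a) P φ) : ∃ U τ, IsUnits (block a) P φ X U τ := by
  have hcard := hX.three_le_card_own h2
  have h3 := (hX.three_le h2 hX.mem (by omega) (by omega)).1
  by_cases hl : X - 1 ∈ P
  · obtain ⟨y, hy⟩ := exists_isFlow_unit_own_left h2 hX.mem h3 hl
    exact hφ.exists_isUnits hX.mem (mem_own_left h2 hX.mem h3) hcard fun _ => ⟨y, hy⟩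
  by_cases hr : X + 1 ∈ P
  · obtain ⟨y, hy⟩ := exists_isFlow_unit_own_right h2 hX.mem h3 hr
    exact hφ.exists_isUnits hX.mem (mem_own_right h2 hX.mem h3) hcard fun _ => ⟨y, hy⟩
  refine hφ.exists_isUnits hX.mem (mem_own_left h2 hX.mem h3) hcard fun h4 => ?_
  have hadd := card_own_add h2 hX.mem
  rw [if_neg hl, if_neg hr, h4] at hadd
  exact absurd hadd.symm (hX.three_le h2 hX.mem (by omega) (by omega)).2

end Sparse

section EqualityCase

variable {ι α J : Type*} [DecidableEq ι] [DecidableEq α] [Fintype J] {B : ι → Finset α}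
  {P : Finset ι} {X Y : ι} {x y : α → ℤ} {φ : (α → ℤ) → J → ℤ} {U V : α → J → ℤ}
  {τ σ : (α → ℤ) → ℤ}

/-- The norm of `φ x` is then exhausted by its products with the units in `S`, all equal to
`τ x`. -/
theorem IsUnits.card_dvd_pairing (hU : IsUnits B P φ X U τ) (hφ : IsFlowIsometry B P φ)
    (hx : IsFlow B P x) (hy : IsFlow B P y) {S : Finset α} (hS : S ⊆ own B P X)
    (hxS : ∀ c ∈ S, x c = 0) (hyS : ∀ c ∈ S, y c = 0)
    (hle : pairing B P x x ≤ S.card * τ x ^ 2) : (S.card : ℤ) ∣ pairing B P y x := by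
  have horth : IsOrthonormalOn S U := fun c hc d hd => hU.orthonormal c (hS hc) d (hS hd)
  have hxU : ∀ c ∈ S, φ x ⬝ᵥ U c = τ x := fun c hc => by
    rw [hU.dotProduct_eq x hx c (hS hc), hxS c hc, zero_add]
  have hyU : ∀ c ∈ S, φ y ⬝ᵥ U c = τ y := fun c hc => by
    rw [hU.dotProduct_eq y hy c (hS hc), hyS c hc, zero_add]
  have heq := horth.dotProduct_eq_sum_of_dotProduct_self_le (x := φ x) (by
    rw [hφ x x hx hx, Finset.sum_congr rfl fun c hc => congrArg (· ^ 2) (hxU c hc),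
      Finset.sum_const, nsmul_eq_mul]
    exact hle) (φ y)
  rw [hφ y x hy hx, Finset.sum_congr rfl fun c hc => by rw [hxU c hc, hyU c hc],
    Finset.sum_const, nsmul_eq_mul] at heq
  exact heq ▸ dvd_mul_right _ _

theorem IsUnits.apply_diff (hU : IsUnits B P φ X U τ) (hφ : IsFlowIsometry B P φ) (hX : X ∈ P)
    (hcard : 3 ≤ (own B P X).card) {c d : α} (hc : c ∈ own B P X) (hd : d ∈ own B P X) :
    φ (diff c d) = U c - U d := by
  have hf : IsFlow B P (diff c d) := isFlow_diff hc hd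
  have hdot : ∀ e ∈ own B P X, φ (diff c d) ⬝ᵥ U e = diff c d e := fun e he => by
    rw [hU.dotProduct_eq _ hf e he, hU.tau_diff hφ hcard hX hc hd, add_zero]
  rw [← sub_eq_zero, ← dotProduct_self_eq_zero]
  simp only [sub_dotProduct, dotProduct_sub]
  rw [dotProduct_comm (U c) (φ _), dotProduct_comm (U d) (φ _), hdot c hc, hdot d hd,
    hφ _ _ hf hf, pairing_diff hX hc hd, hU.orthonormal c hc c hc, hU.orthonormal c hc d hd,
    hU.orthonormal d hd c hc, hU.orthonormal d hd d hd]
  simp only [diff_apply, eq_comm (a := d), if_true]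
  ring

/-- A unit at `Y` has the same product with all units at `X`, so this product is zero. -/
theorem IsUnits.dotProduct_eq_zero (hU : IsUnits B P φ X U τ) (hV : IsUnits B P φ Y V σ)
    (hφ : IsFlowIsometry B P φ) (hX : X ∈ P) (hne : X ≠ Y)
    (h3 : 3 ≤ (own B P X).card) (h3' : 3 ≤ (own B P Y).card) {c d : α} (hc : c ∈ own B P X)
    (hd : d ∈ own B P Y) : U c ⬝ᵥ V d = 0 := by
  have hd_ne : ∀ e ∈ own B P X, d ≠ e := by
    rintro e he rfl
    exact hne (eq_of_mem_own_of_mem_own hX he hd)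
  have hconst : ∀ e ∈ own B P X, V d ⬝ᵥ U e = V d ⬝ᵥ U c := fun e he => by
    have h := hV.dotProduct_eq _ (isFlow_diff hc he) d hd
    rw [hV.tau_diff hφ h3' hX hc he, hU.apply_diff hφ hX h3 hc he, sub_dotProduct, diff_apply,
      if_neg (hd_ne c hc), if_neg (hd_ne e he), dotProduct_comm, dotProduct_comm (U e)] at h
    linarith
  have hb := hU.orthonormal.sum_sq_dotProduct_le (V d)
  rw [Finset.sum_congr rfl fun e he => congrArg (· ^ 2) (hconst e he), hV.orthonormal d hd d hd,
    if_pos rfl, Finset.sum_const, nsmul_eq_mul] at hb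
  have : (3 : ℤ) ≤ (own B P X).card := by exact_mod_cast h3
  rw [dotProduct_comm]
  by_contra h0
  have : 0 < (V d ⬝ᵥ U c) ^ 2 := by positivity
  nlinarith

end EqualityCase

section SparseRun

variable {a : ℤ → ℕ} {P : Finset ℤ} {X i : ℤ} {J : Type*} [Fintype J]
  {φ : (ℤ × ℕ → ℤ) → J → ℤ} {U : ℤ × ℕ → J → ℤ} {τ : (ℤ × ℕ → ℤ) → ℤ}

theorem pairing_eq_zero_of_le_of_lt {n : ℤ} {x y : ℤ × ℕ → ℤ}
    (hx : ∀ p ∈ P, p ≤ n → ∀ c ∈ block a p, x c = 0)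
    (hy : ∀ p ∈ P, n < p → ∀ c ∈ block a p, y c = 0) : pairing (block a) P x y = 0 :=
  pairing_eq_zero fun p hp c hc => (le_or_gt p n).imp (hx p hp · c hc) (hy p hp · c hc)

theorem IsSparse.five_le_of_eq_three {Y Z : ℤ} (hX : IsSparse a P X) (h2 : ∀ i ∈ P, 2 ≤ a i)
    (hY : Y ∈ P) (hZ : Z ∈ P) (hYZ : Z = Y + 1 ∨ Z = Y - 1) (hY' : X ≤ Y + 2 ∧ Y ≤ X + 2)
    (hZ' : X ≤ Z + 2 ∧ Z ≤ X + 2) (h3 : a Y = 3) : 5 ≤ a Z := by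
  have h4 := hX.three_le h2 hZ hZ'.1 hZ'.2
  have hne : a Z ≠ 3 := fun h => by
    have hYs : IsSeed a P Y := ⟨hY, Or.inr (Or.inr ⟨h3, hYZ.imp
      (fun e => by rw [← e]; exact ⟨hZ, h⟩) (fun e => by rw [← e]; exact ⟨hZ, h⟩)⟩)⟩
    have := hX.far Y hYs
    omega
  omega

theorem pairing_arms_eq_zero {w z w' z' : ℤ × ℕ → ℤ} (hrun : IsRun a P (i + 1) (i + 1 + 1))
    (hrun' : IsRun a P i (i + 1)) (h4 : 4 ≤ a (i + 1))
    (hR : ∀ p ∈ P, p ≤ i + 1 → ∀ c ∈ block a p, w c = 0 ∧ z c = 0)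
    (hL : ∀ p ∈ P, i < p → ∀ c ∈ block a p, w' c = 0 ∧ z' c = 0) :
    ∀ x ∈ ({runFlow a P (i + 1) (i + 1 + 1), w, z} : Set (ℤ × ℕ → ℤ)),
      ∀ y ∈ ({runFlow a P i (i + 1), w', z'} : Set (ℤ × ℕ → ℤ)), pairing (block a) P x y = 0 := by
  simp only [Set.mem_insert_iff, Set.mem_singleton_iff, forall_eq_or_imp, forall_eq]
  have hw := fun p hp (hle : p ≤ i + 1) c hc => (hR p hp hle c hc).1
  have hz := fun p hp (hle : p ≤ i + 1) c hc => (hR p hp hle c hc).2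
  have hw' := fun p hp (hlt : i < p) c hc => (hL p hp hlt c hc).1
  have hz' := fun p hp (hlt : i < p) c hc => (hL p hp hlt c hc).2
  have hv : ∀ p ∈ P, p ≤ i → ∀ c ∈ block a p, runFlow a P (i + 1) (i + 1 + 1) c = 0 :=
    fun p _ hle c hc => runFlow_eq_zero_of_lt (by omega) (by omega) hc
  have hv' : ∀ p ∈ P, i + 1 < p → ∀ c ∈ block a p, runFlow a P i (i + 1) c = 0 :=
    fun p _ hlt c hc => runFlow_eq_zero_of_gt hlt (by omega) hc
  refine ⟨⟨?_, pairing_eq_zero_of_le_of_lt hv hw', pairing_eq_zero_of_le_of_lt hv hz'⟩,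
    ⟨pairing_eq_zero_of_le_of_lt hw hv', ?_, ?_⟩, pairing_eq_zero_of_le_of_lt hz hv', ?_, ?_⟩
  · rw [hrun.pairing_runFlow_succ, hrun'.runFlow_succ]
    simp [show a (i + 1) - 2 ≠ 1 by omega, show a (i + 1) - 2 ≠ 0 by omega,
      show i + 1 + 1 ≠ i by omega]
  all_goals
    refine pairing_eq_zero_of_le_of_lt (n := i) (fun p hp hle => ?_) ‹_›
    first | exact hw p hp (by omega) | exact hz p hp (by omega)

theorem IsSparse.tau_ne_neg_one_of_card_eq_three (hX : IsSparse a P (i + 1))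
    (h2 : ∀ i ∈ P, 2 ≤ a i) (hU : IsUnits (block a) P φ (i + 1) U τ)
    (hφ : IsFlowIsometry (block a) P φ) (h5 : 5 ≤ a (i + 1))
    (hcard : (own (block a) P (i + 1)).card = 3) :
    τ (runFlow a P (i + 1) (i + 1 + 1)) ≠ -1 ∧ τ (runFlow a P i (i + 1)) ≠ -1 := by
  have hadd := card_own_add h2 hX.mem
  rw [hcard, add_sub_cancel_right] at hadd
  obtain ⟨hl, hr⟩ : i ∈ P ∧ i + 1 + 1 ∈ P := by
    split_ifs at hadd with hl hr hr <;> first | exact ⟨hl, hr⟩ | omega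
  have h3 := hX.three_le h2 hX.mem (by omega) (by omega)
  have hl3 := hX.three_le h2 hl (by omega) (by omega)
  have hr3 := hX.three_le h2 hr (by omega) (by omega)
  obtain ⟨w, z, R, hR⟩ := exists_isArm_right h2 hX.mem hr h3.1 hr3.1 fun h h' =>
    hX.five_le_of_eq_three h2 hr h' (by omega) (by omega) (by omega) h
  obtain ⟨w', z', L, hL⟩ := exists_isArm_left h2 hX.mem hl h3.1 hl3.1 fun h h' =>
    hX.five_le_of_eq_three h2 hl h' (by omega) (by omega) (by omega) h
  have hm := mem_own_right h2 hX.mem h3.1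
  have hm' := mem_own_left h2 hX.mem h3.1
  have hne : (i + 1, a (i + 1) - 2) ≠ (i + 1, 1) := by
    simp only [ne_eq, Prod.mk.injEq, true_and]
    omega
  have horth := pairing_arms_eq_zero (isRun_succ hX.mem hr h3.1 hr3.1)
    (isRun_succ hl hX.mem hl3.1 h3.1) (by omega) hR hL
  exact ⟨hU.tau_ne_neg_one hφ hcard R L hm hm' hne horth,
    hU.tau_ne_neg_one hφ hcard L R hm' hm hne.symm fun x hx y hy =>
      (pairing_comm _ _).trans (horth y hy x hx)⟩

/-- Equality holds in Bessel's inequality, so the image of the run flow is a combination of the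
three units with equal coefficients and `3` divides its pairings with flows away from them. -/
theorem IsUnits.false_of_runFlow_eq_zero (hU : IsUnits (block a) P φ X U τ)
    (hφ : IsFlowIsometry (block a) P φ) (h2 : ∀ i ∈ P, 2 ≤ a i) (hX : X ∈ P)
    (h : IsRun a P i (i + 1)) (hτ : τ (runFlow a P i (i + 1)) ≠ 0) {S : Finset (ℤ × ℕ)}
    (hS : S ⊆ own (block a) P X) (hcard : S.card = 3)
    (h0 : ∀ c ∈ S, runFlow a P i (i + 1) c = 0) : False := by
  obtain ⟨y, hy, hy1, hyX⟩ := h.exists_isFlow_pairing_eq_one h2 hX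
  have hpos : 0 < τ (runFlow a P i (i + 1)) ^ 2 := by positivity
  have := hU.card_dvd_pairing hφ (isFlow_runFlow h) hy hS h0
    (fun c hc => hyX c (Finset.sdiff_subset (hS hc)))
    (by rw [h.pairing_runFlow_succ_self, hcard]; push_cast; linarith)
  rw [hy1, hcard] at this
  norm_num at this

theorem IsSparse.false_of_runFlow_eq_single (hX : IsSparse a P X) (h2 : ∀ i ∈ P, 2 ≤ a i)
    (hU : IsUnits (block a) P φ X U τ) (hφ : IsFlowIsometry (block a) P φ)
    (h : IsRun a P i (i + 1)) (hXi : X = i ∨ X = i + 1)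
    (hτ : τ (runFlow a P i (i + 1)) ≠ 0) {e : ℤ × ℕ} (he : e ∈ own (block a) P X)
    (he1 : runFlow a P i (i + 1) e = 1)
    (h0 : ∀ c ∈ own (block a) P X, c ≠ e → runFlow a P i (i + 1) c = 0) : False := by
  obtain ⟨hi, hi'⟩ := h.nonempty rfl
  have hcard := hX.three_le_card_own h2
  have hb := hU.sq_add_card_sub_one_mul_sq_le_pairing hφ (isFlow_runFlow h) he h0
  rw [h.pairing_runFlow_succ_self, he1] at hb
  have h5 : 5 ≤ a X := hX.big.resolve_right fun hn => by
    rcases hXi with rfl | rfl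
    · exact hn.2 hi'
    · exact hn.1 (by simpa using hi)
  have hτ1 : τ (runFlow a P i (i + 1)) = -1 := by
    set t := τ (runFlow a P i (i + 1))
    have hb' : (1 + t) ^ 2 + 2 * t ^ 2 ≤ 3 := by nlinarith
    have : t ≤ 0 := by by_contra h; nlinarith
    have : -1 ≤ t := by by_contra h; nlinarith
    omega
  have hcases : (own (block a) P X).card = 3 ∨ (own (block a) P X).card = 4 := by
    rw [hτ1] at hb
    omega
  rcases hcases with hs | hs
  · rcases hXi with rfl | rfl
    · obtain ⟨i, rfl⟩ : ∃ n, X = n + 1 := ⟨X - 1, by ring⟩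
      exact (hX.tau_ne_neg_one_of_card_eq_three h2 hU hφ h5 hs).1 hτ1
    · exact (hX.tau_ne_neg_one_of_card_eq_three h2 hU hφ h5 hs).2 hτ1
  · exact hU.false_of_runFlow_eq_zero hφ h2 hX.mem h hτ (Finset.erase_subset e _)
      (by rw [Finset.card_erase_of_mem he, hs])
      fun c hc => h0 c (Finset.mem_of_mem_erase hc) (Finset.ne_of_mem_erase hc)

theorem IsSparse.tau_runFlow_succ_eq_zero (hX : IsSparse a P X) (h2 : ∀ i ∈ P, 2 ≤ a i)
    (hU : IsUnits (block a) P φ X U τ) (hφ : IsFlowIsometry (block a) P φ)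
    (h : IsRun a P i (i + 1)) : τ (runFlow a P i (i + 1)) = 0 := by
  by_contra hτ
  have hX3 := (hX.three_le h2 hX.mem (by omega) (by omega)).1
  obtain ⟨hi, hi'⟩ := h.nonempty rfl
  by_cases h0 : ∀ c ∈ own (block a) P X, runFlow a P i (i + 1) c = 0
  · have hb := hU.card_mul_sq_le_pairing hφ (isFlow_runFlow h) h0
    have hpos : 0 < τ (runFlow a P i (i + 1)) ^ 2 := by positivity
    have hcard := hX.three_le_card_own h2
    have : ((own (block a) P X).card : ℤ) ≤ 3 := by
      rw [h.pairing_runFlow_succ_self] at hb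
      nlinarith
    exact hU.false_of_runFlow_eq_zero hφ h2 hX.mem h hτ subset_rfl (by omega) h0
  · push Not at h0
    obtain ⟨e, he, he0⟩ := h0
    have hends := eq_of_runFlow_ne_zero_of_mem_own h2 h hX.mem hX3 (c := e) he he0
    refine hX.false_of_runFlow_eq_single h2 hU hφ h (hends.imp And.left And.left) hτ he ?_
      fun c hc hne => by
        by_contra hc0
        have := eq_of_runFlow_ne_zero_of_mem_own h2 h hX.mem hX3 hc hc0
        grind
    rcases hends with ⟨rfl, rfl⟩ | ⟨rfl, rfl⟩
    · exact runFlow_apply_left hi hX3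
    · rw [runFlow_apply_right (lt_add_one i) hi', add_sub_cancel_left, Int.negOnePow_one]
      simp

end SparseRun

section Count

variable {a : ℤ → ℕ} {P S F : Finset ℤ} {X i j : ℤ} {k : ℕ} {J : Type*} [Fintype J]
  {φ : (ℤ × ℕ → ℤ) → J → ℤ} {U : ℤ → ℤ × ℕ → J → ℤ} {τ : ℤ → (ℤ × ℕ → ℤ) → ℤ}

theorem IsRun.right_unique {j' : ℤ} (h : IsRun a P i j) (h' : IsRun a P i j') : j = j' := by
  wlog hlt : j < j' generalizing j j'
  · rcases (not_lt.1 hlt).eq_or_lt with rfl | hlt'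
    · rfl
    · exact (this h' h hlt').symm
  obtain ⟨hmem, htwo⟩ := h'.two j h.lt hlt
  have := h.right hmem
  omega

theorem five_le_or_of_not_isSeed (h2 : ∀ i ∈ P, 2 ≤ a i) (hX : X ∈ P) (h : ¬ IsSeed a P X) :
    5 ≤ a X ∨ a X = 3 ∧ ∀ Z ∈ P, Z = X - 1 ∨ Z = X + 1 → a Z ≠ 3 := by
  have hX2 := h2 X hX
  have hne2 : a X ≠ 2 := fun hX' => h ⟨hX, Or.inl hX'⟩
  have hne4 : a X ≠ 4 := fun hX' => h ⟨hX, Or.inr (Or.inl hX')⟩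
  rcases (show 5 ≤ a X ∨ a X = 3 by omega) with h5 | h3
  · exact Or.inl h5
  · refine Or.inr ⟨h3, fun Z hZ hZX hZ3 => h ⟨hX, Or.inr (Or.inr ⟨h3, ?_⟩)⟩⟩
    rcases hZX with rfl | rfl
    · exact Or.inr ⟨hZ, hZ3⟩
    · exact Or.inl ⟨hZ, hZ3⟩

theorem exists_isSparse_near (h2 : ∀ i ∈ P, 2 ≤ a i) (hX : X ∈ P)
    (hfar : ∀ Y, IsSeed a P Y → X + 3 < Y ∨ Y + 3 < X) :
    ∃ Z, IsSparse a P Z ∧ X ≤ Z + 1 ∧ Z ≤ X + 1 := by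
  have hseed : ∀ Z, X ≤ Z + 1 → Z ≤ X + 1 → ¬ IsSeed a P Z := fun Z h h' hZ => by
    have := hfar Z hZ
    omega
  have hfar' : ∀ Z, X ≤ Z + 1 → Z ≤ X + 1 → ∀ Y, IsSeed a P Y → Z + 2 < Y ∨ Y + 2 < Z :=
    fun Z h h' Y hY => by
      have := hfar Y hY
      omega
  rcases five_le_or_of_not_isSeed h2 hX (hseed X (by omega) (by omega)) with h5 | ⟨-, h3⟩
  · exact ⟨X, ⟨hX, hfar' X (by omega) (by omega), Or.inl h5⟩, by omega, by omega⟩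
  by_cases hZ : ∃ Z ∈ P, Z = X - 1 ∨ Z = X + 1
  · obtain ⟨Z, hZ, hZX⟩ := hZ
    have hle : X ≤ Z + 1 ∧ Z ≤ X + 1 := by omega
    have h5 := (five_le_or_of_not_isSeed h2 hZ (hseed Z hle.1 hle.2)).resolve_right fun h =>
      h3 Z hZ hZX h.1
    exact ⟨Z, ⟨hZ, hfar' Z hle.1 hle.2, Or.inl h5⟩, hle⟩
  · push Not at hZ
    exact ⟨X, ⟨hX, hfar' X (by omega) (by omega), Or.inr
      ⟨fun h => (hZ _ h).1 rfl, fun h => (hZ _ h).2 rfl⟩⟩, by omega, by omega⟩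

theorem exists_isPack_of_isSeed (hS : ∀ s ∈ S, IsSeed a P s)
    (hsep : ∀ s ∈ S, ∀ t ∈ S, s < t → s + 4 ≤ t) : ∃ T, IsPack a P T ∧ T.card = S.card := by
  have hex : ∀ s ∈ S, ∃ p, (p = s ∨ p = s - 1) ∧ p ∈ P ∧
      (a p = 2 ∨ a p = 4 ∨ a p = 3 ∧ p + 1 ∈ P ∧ a (p + 1) = 3) := fun s hs => by
    obtain ⟨hP, h | h | ⟨h3, h | h⟩⟩ := hS s hs
    · exact ⟨s, Or.inl rfl, hP, Or.inl h⟩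
    · exact ⟨s, Or.inl rfl, hP, Or.inr (Or.inl h)⟩
    · exact ⟨s, Or.inl rfl, hP, Or.inr (Or.inr ⟨h3, h⟩)⟩
    · exact ⟨s - 1, Or.inr rfl, h.1, Or.inr (Or.inr ⟨h.2, by simp [hP, h3]⟩)⟩
  choose! f hf using hex
  have hlt : ∀ s ∈ S, ∀ t ∈ S, s < t → f s + 3 ≤ f t := fun s hs t ht hst => by
    have := hsep s hs t ht hst
    have := (hf s hs).1
    have := (hf t ht).1
    omega
  refine ⟨S.image f, ⟨Finset.forall_mem_image.2 fun s hs => (hf s hs).2,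
    Finset.forall_mem_image.2 fun s hs => Finset.forall_mem_image.2 fun t ht h => ?_⟩,
    Finset.card_image_of_injOn fun s hs t ht hst => ?_⟩ <;>
  rcases lt_trichotomy s t with hst | rfl | hst
  all_goals
    first
    | rfl
    | omega
    | have := hlt s hs t ht hst
      omega
    | have := hlt t ht s hs hst
      omega

theorem exists_spaced_subset (A : Finset ℤ) : ∃ S ⊆ A, (∀ s ∈ S, ∀ t ∈ S, s < t → s + 4 ≤ t) ∧
    ∀ t ∈ A, ∃ s ∈ S, s ≤ t ∧ t ≤ s + 3 := by
  induction hn : A.card using Nat.strong_induction_on generalizing A with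
  | _ n ih =>
  rcases A.eq_empty_or_nonempty with rfl | hA
  · exact ⟨∅, by simp⟩
  set m := A.min' hA
  have hm : m ∈ A := A.min'_mem hA
  obtain ⟨S, hS, hsep, hcover⟩ := ih _ (by
    rw [← hn]
    exact Finset.card_lt_card (Finset.filter_ssubset.2 ⟨m, hm, by simp⟩))
    (A.filter fun t => m + 4 ≤ t) rfl
  have hS' : ∀ s ∈ S, m + 4 ≤ s := fun s hs => (Finset.mem_filter.1 (hS hs)).2
  refine ⟨insert m S, Finset.insert_subset hm (hS.trans (Finset.filter_subset _ _)),
    fun s hs t ht hst => ?_, fun t ht => ?_⟩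
  · rw [Finset.mem_insert] at hs ht
    rcases hs with rfl | hs <;> rcases ht with rfl | ht
    · omega
    · exact hS' t ht
    · have := hS' s hs
      omega
    · exact hsep s hs t ht hst
  · by_cases h : m + 4 ≤ t
    · obtain ⟨s, hs, hst⟩ := hcover t (Finset.mem_filter.2 ⟨ht, h⟩)
      exact ⟨s, Finset.mem_insert_of_mem hs, hst⟩
    · exact ⟨m, Finset.mem_insert_self _ _, A.min'_le t ht, by omega⟩

theorem isOrthonormalOn_sigma_own (h2 : ∀ i ∈ P, 2 ≤ a i) (hφ : IsFlowIsometry (block a) P φ)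
    (hF : ∀ X ∈ F, IsSparse a P X) (hU : ∀ X ∈ F, IsUnits (block a) P φ X (U X) (τ X)) :
    IsOrthonormalOn (F.sigma fun X => own (block a) P X) fun p => U p.1 p.2 := by
  rintro ⟨X, c⟩ hc ⟨Y, d⟩ hd
  obtain ⟨hX, hc⟩ := Finset.mem_sigma.1 hc
  obtain ⟨hY, hd⟩ := Finset.mem_sigma.1 hd
  by_cases hXY : X = Y
  · subst hXY
    simpa using (hU X hX).orthonormal c hc d hd
  · simpa [hXY] using (hU X hX).dotProduct_eq_zero (hU Y hY) hφ (hF X hX).mem hXY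
      ((hF X hX).three_le_card_own h2) ((hF Y hY).three_le_card_own h2) hc hd

theorem IsSparse.runFlow_eq_zero (hX : IsSparse a P X) (h2 : ∀ i ∈ P, 2 ≤ a i)
    (h : IsRun a P i j) (hij : i + 1 < j) {c : ℤ × ℕ} (hc : c ∈ own (block a) P X) :
    runFlow a P i j c = 0 := by
  have hseed : ∀ p, i < p → p < j → IsSeed a P p := fun p hp hp' =>
    ⟨(h.two p hp hp').1, Or.inl (h.two p hp hp').2⟩
  have hfar := hX.far (i + 1) (hseed _ (by omega) hij)
  have hfar' := hX.far (j - 1) (hseed _ (by omega) (by omega))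
  by_contra h0
  have := eq_of_runFlow_ne_zero_of_mem_own h2 h hX.mem
    (hX.three_le h2 hX.mem (by omega) (by omega)).1 hc h0
  omega

theorem card_isSparse_le_of_isRun (h2 : ∀ i ∈ P, 2 ≤ a i) (hφ : IsFlowIsometry (block a) P φ)
    (h : IsRun a P i j) (hF : ∀ X ∈ F, IsSparse a P X)
    (hU : ∀ X ∈ F, IsUnits (block a) P φ X (U X) (τ X))
    (hτ : ∀ X ∈ F, τ X (runFlow a P i j) ≠ 0) : (F.card : ℤ) ≤ (j - i) / 2 := by
  have hij := h.lt
  rcases F.eq_empty_or_nonempty with rfl | ⟨X₀, hX₀⟩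
  · rw [Finset.card_empty]
    omega
  have hj : i + 1 ≠ j := by
    rintro rfl
    exact hτ X₀ hX₀ ((hF X₀ hX₀).tau_runFlow_succ_eq_zero h2 (hU X₀ hX₀) hφ h)
  have hb := (isOrthonormalOn_sigma_own h2 hφ hF hU).sum_sq_dotProduct_le (φ (runFlow a P i j))
  rw [hφ _ _ (isFlow_runFlow h) (isFlow_runFlow h), Finset.sum_sigma] at hb
  have hle : ∑ _X ∈ F, (3 : ℤ) ≤
      ∑ X ∈ F, ∑ c ∈ own (block a) P X, (φ (runFlow a P i j) ⬝ᵥ U X c) ^ 2 := by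
    refine Finset.sum_le_sum fun X hX => ?_
    have hzero := fun c (hc : c ∈ own (block a) P X) =>
      (hF X hX).runFlow_eq_zero h2 h (by omega) hc
    have h3 : (3 : ℤ) ≤ (own (block a) P X).card := by
      exact_mod_cast (hF X hX).three_le_card_own h2
    have hpos : 0 < τ X (runFlow a P i j) ^ 2 := by
      have := hτ X hX
      positivity
    calc (3 : ℤ) ≤ ∑ c ∈ own (block a) P X, τ X (runFlow a P i j) ^ 2 := by
          rw [Finset.sum_const, nsmul_eq_mul]
          nlinarith
      _ = _ := Finset.sum_congr rfl fun c hc => by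
          rw [(hU X hX).dotProduct_eq _ (isFlow_runFlow h) c hc, hzero c hc, zero_add]
  have hcard := (hle.trans hb).trans (pairing_runFlow_le h)
  rw [Finset.sum_const, nsmul_eq_mul] at hcard
  omega

theorem card_isSparse_le (h2 : ∀ i ∈ P, 2 ≤ a i) (h : Minimal (Compressible (block a) · k) P)
    (hpack : ∀ T, IsPack a P T → T.card ≤ k) (hF : ∀ X ∈ F, IsSparse a P X) : F.card ≤ k := by
  classical
  obtain ⟨J, _, φ, hφ, hJ⟩ := h.prop
  have hex : ∀ X ∈ F, ∃ U τ i j, IsUnits (block a) P φ X U τ ∧ IsRun a P i j ∧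
      τ (runFlow a P i j) ≠ 0 := fun X hX => by
    obtain ⟨U, τ, hU⟩ := (hF X hX).exists_isUnits h2 hφ
    obtain ⟨i, j, hij, hτ⟩ := hU.exists_run h2 h hφ hJ (hF X hX).mem
      ((hF X hX).three_le_card_own h2)
    exact ⟨U, τ, i, j, hU, hij, hτ⟩
  choose! U τ i j hU hij hτ using hex
  have hend : ∀ p ∈ F.image i, ∃ q, IsRun a P p q :=
    Finset.forall_mem_image.2 fun X hX => ⟨j X, hij X hX⟩
  choose! q hq using hend
  have hk := hpack _ (isPack_biUnion_runPack hq)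
  zify at hk ⊢
  rw [card_biUnion_runPack hq] at hk
  refine le_trans ?_ hk
  rw [Finset.card_eq_sum_card_image i F, Nat.cast_sum]
  refine Finset.sum_le_sum fun p hp => card_isSparse_le_of_isRun h2 hφ (hq p hp)
    (fun X hX => hF X (Finset.mem_filter.1 hX).1) (fun X hX => hU X (Finset.mem_filter.1 hX).1)
    fun X hX => ?_
  obtain ⟨hXF, rfl⟩ := Finset.mem_filter.1 hX
  rw [(hq _ hp).right_unique (hij X hXF)]
  exact hτ X hXF

theorem card_le_thirteen_mul (h2 : ∀ i ∈ P, 2 ≤ a i) (h : Minimal (Compressible (block a) · k) P)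
    (hpack : ∀ T, IsPack a P T → T.card ≤ k) : P.card ≤ 13 * k := by
  classical
  set C := P.filter fun X => IsSparse a P X
  obtain ⟨S, hS, hsep, hcover⟩ := exists_spaced_subset (P.filter fun X => IsSeed a P X)
  obtain ⟨T, hT, hTS⟩ :=
    exists_isPack_of_isSeed (fun s hs => (Finset.mem_filter.1 (hS hs)).2) hsep
  have hSk : S.card ≤ k := hTS ▸ hpack T hT
  have hCk : C.card ≤ k := card_isSparse_le h2 h hpack fun X hX => (Finset.mem_filter.1 hX).2
  have hsub : P ⊆ (C.biUnion fun Z => Finset.Icc (Z - 1) (Z + 1)) ∪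
      S.biUnion fun s => Finset.Icc (s - 3) (s + 6) := fun X hX => by
    rw [Finset.mem_union, Finset.mem_biUnion, Finset.mem_biUnion]
    by_cases hfar : ∀ Y, IsSeed a P Y → X + 3 < Y ∨ Y + 3 < X
    · obtain ⟨Z, hZ, hXZ⟩ := exists_isSparse_near h2 hX hfar
      exact Or.inl ⟨Z, Finset.mem_filter.2 ⟨hZ.mem, hZ⟩, Finset.mem_Icc.2 (by omega)⟩
    · push Not at hfar
      obtain ⟨Y, hY, hXY⟩ := hfar
      obtain ⟨s, hs, hsY⟩ := hcover Y (Finset.mem_filter.2 ⟨hY.1, hY⟩)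
      exact Or.inr ⟨s, hs, Finset.mem_Icc.2 (by omega)⟩
  have hcard := Finset.card_biUnion_le_card_mul C (fun Z => Finset.Icc (Z - 1) (Z + 1)) 3
    fun Z _ => by rw [Int.card_Icc]; omega
  have hcard' := Finset.card_biUnion_le_card_mul S (fun s => Finset.Icc (s - 3) (s + 6)) 10
    fun s _ => by rw [Int.card_Icc]; omega
  have := (Finset.card_le_card hsub).trans (Finset.card_union_le _ _)
  omega

theorem card_le_and_weight_le (h2 : ∀ i ∈ P, 2 ≤ a i)
    (h : Minimal (Compressible (block a) · k) P) (hk : 1 ≤ k) :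
    P.card ≤ 13 * k ∧ ∀ i ∈ P, a i ≤ 2 * k + 7 := by
  rcases pack_card_le_or h with hpack | ⟨hcard, hweight⟩
  · exact ⟨card_le_thirteen_mul h2 h hpack, fun i hi => weight_le h2 h hpack hi⟩
  · exact ⟨by omega, fun i hi => (hweight i hi).trans (by omega)⟩

end Count

section Duality

variable {l l' : List ℕ} {o : ℤ} {n : ℕ} {x y f g : ℤ × ℕ → ℤ}

/-- Pairs of lists of weights that are dual to each other in the sense of Riemenschneider. -/
inductive DualPair : List ℕ → List ℕ → Prop
  | base : DualPair [2] [2]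
  | left {l l' : List ℕ} {b : ℕ} : DualPair l (b :: l') → DualPair (2 :: l) ((b + 1) :: l')
  | right {l l' : List ℕ} {n b : ℕ} :
      DualPair ((n + 2) :: l) (b :: l') → DualPair ((n + 3) :: l) (2 :: b :: l')

/-- The sum over the coordinates covered by the blocks of a chain of weights that starts at the
position `o`. -/
def chainSum : ℤ → List ℕ → (ℤ × ℕ → ℤ) → ℤ
  | o, [], f => f (o, 0)
  | o, a :: l, f => ∑ t ∈ Finset.range (a - 1), f (o, t) + chainSum (o + 1) l f

/-- The flows for the blocks of a chain of weights that starts at the position `o`. -/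
def IsChainFlow : ℤ → List ℕ → (ℤ × ℕ → ℤ) → Prop
  | _, [], _ => True
  | o, a :: l, x =>
    x (o + 1, 0) + ∑ t ∈ Finset.range (a - 1), x (o, t) = 0 ∧ IsChainFlow (o + 1) l x

/-- The negative of the intersection form of the linear plumbing with a given list of weights. -/
def chainForm : List ℕ → (ℕ → ℤ) → (ℕ → ℤ) → ℤ
  | [], _, _ => 0
  | [b], c, d => b * c 0 * d 0
  | b :: b' :: l, c, d => b * c 0 * d 0 - c 0 * d 1 - c 1 * d 0 +
      chainForm (b' :: l) (fun s => c (s + 1)) (fun s => d (s + 1))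

theorem chainForm_succ_head (b : ℕ) (l : List ℕ) (c d : ℕ → ℤ) :
    chainForm ((b + 1) :: l) c d = chainForm (b :: l) c d + c 0 * d 0 := by
  cases l <;> simp only [chainForm] <;> push_cast <;> ring

theorem sq_le_chainForm : ∀ {l : List ℕ} {b : ℕ} {c : ℕ → ℤ}, (∀ e ∈ b :: l, 2 ≤ e) →
    c 0 ^ 2 ≤ chainForm (b :: l) c c
  | [], b, c, h => by
    have hb : (2 : ℤ) ≤ b := by exact_mod_cast h b List.mem_cons_self
    simp only [chainForm]
    nlinarith [sq_nonneg (c 0)]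
  | b' :: l, b, c, h => by
    have hb : (2 : ℤ) ≤ b := by exact_mod_cast h b List.mem_cons_self
    have htail := sq_le_chainForm (c := fun s => c (s + 1)) (List.forall_mem_of_forall_mem_cons h)
    simp only [chainForm, zero_add] at htail ⊢
    nlinarith [sq_nonneg (c 0), sq_nonneg (c 0 - c 1)]

theorem chainForm_nonneg : ∀ {l : List ℕ} {c : ℕ → ℤ}, (∀ e ∈ l, 2 ≤ e) → 0 ≤ chainForm l c c
  | [], _, _ => le_rfl
  | _ :: _, c, h => (sq_nonneg (c 0)).trans (sq_le_chainForm h)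

theorem eq_zero_of_chainForm_eq_zero : ∀ {l : List ℕ} {c : ℕ → ℤ}, (∀ e ∈ l, 2 ≤ e) →
    chainForm l c c = 0 → ∀ s < l.length, c s = 0
  | [], _, _, _, _, hs => absurd hs (Nat.not_lt_zero _)
  | b :: l, c, h, h0, s, hs => by
    have hc0 : c 0 = 0 :=
      pow_eq_zero_iff two_ne_zero |>.1 <| le_antisymm (h0 ▸ sq_le_chainForm h) (sq_nonneg _)
    match s, l with
    | 0, _ => exact hc0
    | s + 1, [] => exact absurd (Nat.lt_of_succ_lt_succ hs) (Nat.not_lt_zero _)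
    | s + 1, b' :: l =>
      refine eq_zero_of_chainForm_eq_zero (c := fun s => c (s + 1))
        (List.forall_mem_of_forall_mem_cons h) ?_ s (Nat.lt_of_succ_lt_succ hs)
      simpa only [chainForm, hc0, mul_zero, zero_mul, sub_zero, zero_add] using h0

theorem chainSum_congr : ∀ {l : List ℕ} {o : ℤ}, (∀ p t, o ≤ p → f (p, t) = g (p, t)) →
    chainSum o l f = chainSum o l g
  | [], o, h => h o 0 le_rfl
  | _ :: _, o, h => congrArg₂ (· + ·) (Finset.sum_congr rfl fun t _ => h o t le_rfl)
      (chainSum_congr fun p t hp => h p t (by omega))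

theorem IsChainFlow.congr : ∀ {l : List ℕ} {o : ℤ}, IsChainFlow o l x →
    (∀ p t, o ≤ p → x (p, t) = y (p, t)) → IsChainFlow o l y
  | [], _, _, _ => trivial
  | _ :: _, o, hx, h => by
    refine ⟨?_, hx.2.congr fun p t hp => h p t (by omega)⟩
    rw [← hx.1, h (o + 1) 0 (by omega), Finset.sum_congr rfl fun t _ => h o t le_rfl]

theorem chainSum_add_two_cons :
    chainSum o ((n + 2) :: l) f =
      ∑ t ∈ Finset.range n, f (o, t + 1) + f (o, 0) + chainSum (o + 1) l f := by
  rw [chainSum, Nat.add_sub_assoc (by omega), Finset.sum_range_succ']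

theorem chainSum_add_three_cons :
    chainSum o ((n + 3) :: l) f =
      ∑ t ∈ Finset.range n, f (o, t + 1) + f (o, n + 1) + f (o, 0) + chainSum (o + 1) l f := by
  rw [chainSum_add_two_cons, Finset.sum_range_succ]

theorem isChainFlow_add_two_cons :
    IsChainFlow o ((n + 2) :: l) x ↔
      x (o + 1, 0) + (∑ t ∈ Finset.range n, x (o, t + 1) + x (o, 0)) = 0 ∧
        IsChainFlow (o + 1) l x := by
  rw [IsChainFlow, Nat.add_sub_assoc (by omega), Finset.sum_range_succ']

theorem isChainFlow_add_three_cons :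
    IsChainFlow o ((n + 3) :: l) x ↔
      x (o + 1, 0) + (∑ t ∈ Finset.range n, x (o, t + 1) + x (o, n + 1) + x (o, 0)) = 0 ∧
        IsChainFlow (o + 1) l x := by
  rw [isChainFlow_add_two_cons, Finset.sum_range_succ]

theorem DualPair.chainSum_one (h : DualPair l l') (o : ℤ) :
    chainSum o l (fun _ => 1) = l.length + l'.length := by
  induction h generalizing o with
  | base => rfl
  | left _ ih =>
    rw [chainSum, ih]
    simp only [Nat.add_one_sub_one, Finset.range_one, Finset.sum_singleton, List.length_cons]
    push_cast
    ring
  | right _ ih =>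
    have := ih o
    rw [chainSum_add_two_cons] at this
    rw [chainSum_add_three_cons]
    simp only [List.length_cons] at this ⊢
    push_cast at this ⊢
    linarith

/-- Splits the first coordinate at the position `o` into `s` and the rest, which becomes the new
coordinate `(o, n + 1)`. -/
def splitHead (o : ℤ) (n : ℕ) (s : ℤ) (x : ℤ × ℕ → ℤ) : ℤ × ℕ → ℤ :=
  Function.update (Function.update x (o, n + 1) (x (o, 0) - s)) (o, 0) s

/-- Adds the coordinate `(o, n + 1)` to the first coordinate at the position `o`; this undoes
`splitHead`. -/
def mergeHead (o : ℤ) (n : ℕ) (x : ℤ × ℕ → ℤ) : ℤ × ℕ → ℤ :=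
  Function.update x (o, 0) (x (o, 0) + x (o, n + 1))

theorem splitHead_zero (o : ℤ) (n : ℕ) (s : ℤ) (x : ℤ × ℕ → ℤ) :
    splitHead o n s x (o, 0) = s :=
  Function.update_self ..

theorem splitHead_last (o : ℤ) (n : ℕ) (s : ℤ) (x : ℤ × ℕ → ℤ) :
    splitHead o n s x (o, n + 1) = x (o, 0) - s := by
  rw [splitHead, Function.update_of_ne (by simp), Function.update_self]

theorem splitHead_of_lt {s : ℤ} {t : ℕ} (ht : t < n) :
    splitHead o n s x (o, t + 1) = x (o, t + 1) := by
  rw [splitHead, Function.update_of_ne (by simp), Function.update_of_ne (by simp [ht.ne])]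

theorem splitHead_of_ne {s p : ℤ} {t : ℕ} (hp : p ≠ o) : splitHead o n s x (p, t) = x (p, t) := by
  rw [splitHead, Function.update_of_ne (by simp [hp]), Function.update_of_ne (by simp [hp])]

theorem mergeHead_zero (o : ℤ) (n : ℕ) (x : ℤ × ℕ → ℤ) :
    mergeHead o n x (o, 0) = x (o, 0) + x (o, n + 1) :=
  Function.update_self ..

theorem mergeHead_of_ne {c : ℤ × ℕ} (hc : c ≠ (o, 0)) : mergeHead o n x c = x c :=
  Function.update_of_ne hc ..

theorem IsChainFlow.splitHead (hx : IsChainFlow o ((n + 2) :: l) x) (s : ℤ) :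
    IsChainFlow o ((n + 3) :: l) (splitHead o n s x) := by
  rw [isChainFlow_add_two_cons] at hx
  refine isChainFlow_add_three_cons.2
    ⟨?_, hx.2.congr fun p t hp => (splitHead_of_ne (by omega)).symm⟩
  rw [splitHead_zero, splitHead_last, splitHead_of_ne (by omega),
    Finset.sum_congr rfl fun t ht => splitHead_of_lt (Finset.mem_range.1 ht)]
  linarith [hx.1]

theorem IsChainFlow.mergeHead (hx : IsChainFlow o ((n + 3) :: l) x) :
    IsChainFlow o ((n + 2) :: l) (mergeHead o n x) := by
  rw [isChainFlow_add_three_cons] at hx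
  refine isChainFlow_add_two_cons.2
    ⟨?_, hx.2.congr fun p t hp => (mergeHead_of_ne (by simp; omega)).symm⟩
  rw [mergeHead_zero, mergeHead_of_ne (by simp),
    Finset.sum_congr rfl fun t _ => mergeHead_of_ne (by simp)]
  linarith [hx.1]

theorem chainSum_splitHead (s r : ℤ) :
    chainSum o ((n + 3) :: l) (fun c => splitHead o n s x c * splitHead o n r y c) =
      chainSum o ((n + 2) :: l) (fun c => x c * y c) - x (o, 0) * y (o, 0) + s * r +
        (x (o, 0) - s) * (y (o, 0) - r) := by
  rw [chainSum_add_three_cons, chainSum_add_two_cons,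
    chainSum_congr (g := fun c => x c * y c) fun p t hp => by
      rw [splitHead_of_ne (by omega), splitHead_of_ne (by omega)],
    Finset.sum_congr rfl fun t ht => by
      rw [splitHead_of_lt (Finset.mem_range.1 ht), splitHead_of_lt (Finset.mem_range.1 ht)]]
  simp only [splitHead_zero, splitHead_last]
  ring

theorem chainSum_mergeHead :
    chainSum o ((n + 2) :: l) (fun c => mergeHead o n x c * mergeHead o n y c) =
      chainSum o ((n + 3) :: l) (fun c => x c * y c) + x (o, 0) * y (o, n + 1) +
        x (o, n + 1) * y (o, 0) := by
  rw [chainSum_add_two_cons, chainSum_add_three_cons,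
    chainSum_congr (g := fun c => x c * y c) fun p t hp => by
      rw [mergeHead_of_ne (by simp; omega), mergeHead_of_ne (by simp; omega)],
    Finset.sum_congr rfl fun t _ => by
      rw [mergeHead_of_ne (by simp), mergeHead_of_ne (by simp)]]
  simp only [mergeHead_zero]
  ring

theorem DualPair.exists_toFlow (h : DualPair l l') (o : ℤ) :
    ∃ (ε : ℤ) (T : (ℕ → ℤ) → ℤ × ℕ → ℤ), ε * ε = 1 ∧
      (∀ c, IsChainFlow o l (T c) ∧ T c (o, 0) = ε * c 0) ∧
      ∀ c d, chainSum o l (fun e => T c e * T d e) = chainForm l' c d := by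
  induction h generalizing o with
  | base =>
    refine ⟨1, fun c e => if e = (o, 0) then c 0 else -c 0, by norm_num, fun c => ⟨?_, by simp⟩,
      fun c d => ?_⟩
    · simp [IsChainFlow]
    · simp only [chainSum, chainForm, Nat.add_one_sub_one, Finset.sum_range_one, if_pos,
        if_neg (show ((o + 1, 0) : ℤ × ℕ) ≠ (o, 0) by simp)]
      push_cast
      ring
  | @left l l' b _ ih =>
    obtain ⟨ε, T, hε, hT, hTT⟩ := ih (o + 1)
    let T' (c : ℕ → ℤ) : ℤ × ℕ → ℤ := Function.update (T c) (o, 0) (-T c (o + 1, 0))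
    have hT'o : ∀ c, T' c (o, 0) = -ε * c 0 := fun c => by
      simp only [T', Function.update_self, (hT c).2, neg_mul]
    have hT' : ∀ c p t, o + 1 ≤ p → T c (p, t) = T' c (p, t) := fun c p t hp =>
      (Function.update_of_ne (by simp; omega) ..).symm
    refine ⟨-ε, T', by rwa [neg_mul_neg], fun c => ⟨⟨?_, (hT c).1.congr (hT' c)⟩, hT'o c⟩,
      fun c d => ?_⟩
    · simp only [Nat.add_one_sub_one, Finset.sum_range_one, hT'o, ← hT' c (o + 1) 0 le_rfl,
        (hT c).2, neg_mul, add_neg_cancel]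
    · have htail : chainSum (o + 1) l (fun e => T' c e * T' d e) = chainForm (b :: l') c d :=
        hTT c d ▸ chainSum_congr fun p t hp =>
          (congrArg₂ (· * ·) (hT' c p t hp) (hT' d p t hp)).symm
      rw [chainForm_succ_head, chainSum, htail, Nat.add_one_sub_one, Finset.sum_range_one, hT'o,
        hT'o]
      linear_combination (c 0 * d 0) * hε
  | right _ ih =>
    obtain ⟨ε, T, hε, hT, hTT⟩ := ih o
    refine ⟨ε, fun c => splitHead o _ (ε * c 0) (T fun s => c (s + 1)), hε,
      fun c => ⟨(hT _).1.splitHead _, splitHead_zero ..⟩, fun c d => ?_⟩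
    rw [chainSum_splitHead, hTT, (hT _).2, (hT _).2, chainForm]
    push_cast
    linear_combination (2 * c 0 * d 0 - c 0 * d 1 - c 1 * d 0) * hε

theorem DualPair.exists_ofFlow (h : DualPair l l') (o : ℤ) :
    ∃ (ε : ℤ) (C : (ℤ × ℕ → ℤ) → ℕ → ℤ), ε * ε = 1 ∧
      (∀ x, IsChainFlow o l x → x (o, 0) = ε * C x 0) ∧
      ∀ x y, IsChainFlow o l x → IsChainFlow o l y →
        chainForm l' (C x) (C y) = chainSum o l (fun e => x e * y e) := by
  induction h generalizing o with
  | base =>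
    refine ⟨1, fun x _ => x (o, 0), by norm_num, fun x _ => (one_mul _).symm, fun x y hx hy => ?_⟩
    simp only [IsChainFlow, chainSum, chainForm, Nat.add_one_sub_one, Finset.sum_range_one,
      and_true, Nat.cast_ofNat, ← eq_neg_iff_add_eq_zero] at hx hy ⊢
    rw [hx, hy]
    ring
  | left _ ih =>
    obtain ⟨ε, C, hε, hC, hCC⟩ := ih (o + 1)
    have hhead : ∀ x, IsChainFlow o (2 :: _) x → x (o, 0) = -ε * C x 0 := fun x hx => by
      have := hx.1
      rw [hC x hx.2, Nat.add_one_sub_one, Finset.sum_range_one] at this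
      linarith
    refine ⟨-ε, C, by rwa [neg_mul_neg], hhead, fun x y hx hy => ?_⟩
    rw [chainForm_succ_head, hCC x y hx.2 hy.2, chainSum, Nat.add_one_sub_one,
      Finset.sum_range_one, hhead x hx, hhead y hy]
    linear_combination (-(C x 0 * C y 0)) * hε
  | @right l l' n b _ ih =>
    obtain ⟨ε, C, hε, hC, hCC⟩ := ih o
    let C' (x : ℤ × ℕ → ℤ) (s : ℕ) : ℤ := Nat.casesOn s (ε * x (o, 0)) (C (mergeHead o n x))
    refine ⟨ε, C', hε, fun x _ => ?_, fun x y hx hy => ?_⟩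
    · exact (by rw [← mul_assoc, hε, one_mul] : x (o, 0) = ε * (ε * x (o, 0)))
    · have hx0 := hC _ hx.mergeHead
      have hy0 := hC _ hy.mergeHead
      rw [mergeHead_zero] at hx0 hy0
      have hsum := hCC _ _ hx.mergeHead hy.mergeHead
      rw [chainSum_mergeHead] at hsum
      have hform : chainForm (2 :: b :: l') (C' x) (C' y) = 2 * (ε * x (o, 0)) * (ε * y (o, 0)) -
          ε * x (o, 0) * C (mergeHead o n y) 0 - C (mergeHead o n x) 0 * (ε * y (o, 0)) +
          chainForm (b :: l') (C (mergeHead o n x)) (C (mergeHead o n y)) := rfl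
      linear_combination hform + hsum + (2 * x (o, 0) * y (o, 0)) * hε + x (o, 0) * hy0 +
        y (o, 0) * hx0

end Duality

section ContinuedFractions

variable {p q : ℕ} {b : ℕ} {l : List ℕ}

theorem hjExpansion_add (p : ℕ) (hq : 0 < q) (h : hjExpansion p q = b :: l) :
    hjExpansion (p + q) q = (b + 1) :: l := by
  obtain ⟨q, rfl⟩ := Nat.exists_eq_add_one.2 hq
  rw [hjExpansion, List.cons.injEq] at h ⊢
  rwa [add_right_comm p (q + 1) q, Nat.add_div_right _ (Nat.succ_pos q), Nat.add_mod_right,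
    Nat.succ.injEq]

theorem hjExpansion_eq_cons {r : ℕ} (hr : r < q) (h : p + r = b * q) :
    hjExpansion p q = b :: hjExpansion q r := by
  obtain ⟨q, rfl⟩ := Nat.exists_eq_add_one.2 (Nat.zero_lt_of_lt hr)
  have hpq : p + q = (q - r) + (q + 1) * b := by
    rw [mul_comm]
    omega
  rw [hjExpansion, hpq, Nat.add_mul_div_left _ _ (Nat.succ_pos q), Nat.add_mul_mod_self_left,
    Nat.div_eq_of_lt (by omega), Nat.mod_eq_of_lt (by omega), zero_add, Nat.sub_sub_self (by omega)]

theorem exists_hjExpansion_eq_cons (p : ℕ) (hq : 0 < q) : ∃ b l, hjExpansion p q = b :: l :=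
  List.exists_cons_of_ne_nil ((hjExpansion_eq_nil_iff p q).not.2 hq.ne')

theorem dualPair_hjExpansion_of_lt_two_mul (hqp : q < p) (h : p < 2 * q)
    (hd : DualPair (hjExpansion q (2 * q - p)) (hjExpansion q (p - q))) :
    DualPair (hjExpansion p q) (hjExpansion p (p - q)) := by
  obtain ⟨b, l, hb⟩ := exists_hjExpansion_eq_cons q (Nat.sub_pos_of_lt hqp)
  have hadd := hjExpansion_add q (Nat.sub_pos_of_lt hqp) hb
  rw [Nat.add_sub_cancel' hqp.le] at hadd
  rw [hadd, hjExpansion_eq_cons (r := 2 * q - p) (b := 2) (by omega) (by omega)]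
  exact (hb ▸ hd).left

theorem dualPair_hjExpansion_of_two_mul_lt (hq : 0 < q) (h : 2 * q < p)
    (hd : DualPair (hjExpansion (p - q) q) (hjExpansion (p - q) (p - q - q))) :
    DualPair (hjExpansion p q) (hjExpansion p (p - q)) := by
  obtain ⟨b, l, hb⟩ := exists_hjExpansion_eq_cons (p - q) hq
  obtain ⟨b', l', hb'⟩ := exists_hjExpansion_eq_cons (p - q) (q := p - q - q) (by omega)
  obtain ⟨n, rfl⟩ := Nat.exists_eq_add_of_le' <|
    two_le_of_mem_hjExpansion (show q < p - q by omega) b (hb ▸ List.mem_cons_self)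
  have hadd := hjExpansion_add (p - q) hq hb
  rw [Nat.sub_add_cancel (by omega)] at hadd
  rw [hb, hb'] at hd
  rw [hadd, hjExpansion_eq_cons (q := p - q) (r := p - q - q) (b := 2) (by omega) (by omega), hb']
  exact hd.right

theorem dualPair_hjExpansion (hq : 0 < q) (hqp : q < p) (hc : Nat.Coprime p q) :
    DualPair (hjExpansion p q) (hjExpansion p (p - q)) := by
  induction p using Nat.strong_induction_on generalizing q with
  | _ p ih =>
  rcases lt_trichotomy p (2 * q) with h | rfl | h
  · have hsub : q - (2 * q - p) = p - q := by omega
    refine dualPair_hjExpansion_of_lt_two_mul hqp h <|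
      hsub ▸ ih q hqp (by omega) (by omega) ?_
    have hcop := (Nat.coprime_self_sub_right (Nat.sub_le_of_le_add (by omega))).2
      ((Nat.coprime_sub_self_right hqp.le).2 hc.symm)
    rwa [show q - (p - q) = 2 * q - p by omega] at hcop
  · obtain rfl : q = 1 := Nat.Coprime.eq_one_of_dvd hc.symm (dvd_mul_left q 2)
    rw [hjExpansion_eq_cons (q := 1) (r := 0) (b := 2) (by omega) (by omega), hjExpansion]
    exact DualPair.base
  · exact dualPair_hjExpansion_of_two_mul_lt hq h <|
      ih (p - q) (by omega) hq (by omega) ((Nat.coprime_sub_self_left hqp.le).2 hc)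

theorem dualPair_coeffs (L : LensSpace) : DualPair L.coeffs L.reverse.coeffs :=
  dualPair_hjExpansion L.q_pos L.q_lt_p L.coprime

theorem exists_coeffs_eq : ∀ {l : List ℕ}, l ≠ [] → (∀ b ∈ l, 2 ≤ b) →
    ∃ L : LensSpace, L.coeffs = l
  | [], hl, _ => absurd rfl hl
  | [b], _, h => by
    have hb := h b List.mem_cons_self
    refine ⟨⟨b, 1, by omega, by omega, Nat.coprime_one_right b⟩, ?_⟩
    rw [LensSpace.coeffs, hjExpansion_eq_cons (r := 0) (b := b) Nat.one_pos (mul_one b).symm,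
      hjExpansion]
  | b :: b' :: l, _, h => by
    obtain ⟨L, hL⟩ :=
      exists_coeffs_eq (List.cons_ne_nil b' l) (List.forall_mem_of_forall_mem_cons h)
    have hlt := L.q_lt_p
    have hle : 2 * L.p ≤ b * L.p := Nat.mul_le_mul_right _ (h b List.mem_cons_self)
    have hq : L.q ≤ b * L.p := by omega
    refine ⟨⟨b * L.p - L.q, L.p, by omega, by omega, ?_⟩, ?_⟩
    · rw [← Nat.isCoprime_iff_coprime, Nat.cast_sub hq, sub_eq_add_neg, add_comm]
      push_cast
      exact IsCoprime.add_mul_right_left_iff.2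
        (Nat.isCoprime_iff_coprime.2 L.coprime).symm.neg_left
    · rw [LensSpace.coeffs, hjExpansion_eq_cons hlt (Nat.sub_add_cancel hq)]
      exact congrArg _ hL

end ContinuedFractions

section Placement

variable {a : ℤ → ℕ} {o e : ℤ} {l : List ℕ} {x : ℤ × ℕ → ℤ}

/-- The weights at the positions from `o` on are the entries of the list `l`. -/
def HasWeights (a : ℤ → ℕ) (o : ℤ) (l : List ℕ) : Prop :=
  ∀ s (hs : s < l.length), a (o + s) = l[s]

theorem hasWeights_cons {b : ℕ} :
    HasWeights a o (b :: l) ↔ a o = b ∧ HasWeights a (o + 1) l := by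
  refine ⟨fun h => ⟨?_, fun s hs => ?_⟩, fun h s hs => ?_⟩
  · simpa using h 0 (Nat.succ_pos _)
  · have := h (s + 1) (Nat.succ_lt_succ hs)
    rwa [Nat.cast_succ, add_comm (s : ℤ), ← add_assoc] at this
  · cases s with
    | zero => rw [Nat.cast_zero, add_zero, h.1, List.getElem_cons_zero]
    | succ s =>
      rw [Nat.cast_succ, add_comm (s : ℤ), ← add_assoc, h.2 s (Nat.lt_of_succ_lt_succ hs),
        List.getElem_cons_succ]

theorem mem_Ico_iff_eq_or_mem_Ico (h : o < e) {p : ℤ} :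
    p ∈ Finset.Ico o e ↔ p = o ∨ p ∈ Finset.Ico (o + 1) e := by
  simp only [Finset.mem_Ico]
  omega

theorem isChainFlow_iff (h : HasWeights a o l) :
    IsChainFlow o l x ↔ IsFlow (block a) (Finset.Ico o (o + l.length)) x := by
  induction l generalizing o with
  | nil => simp [IsChainFlow, IsFlow]
  | cons b l ih =>
    obtain ⟨hb, hl⟩ := hasWeights_cons.1 h
    rw [IsChainFlow, ih hl, List.length_cons, Nat.cast_succ, add_comm (l.length : ℤ), ← add_assoc]
    simp only [IsFlow, mem_Ico_iff_eq_or_mem_Ico (show o < o + 1 + l.length by omega),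
      forall_eq_or_imp, sum_block, hb]

theorem biUnion_block_Ico (h : o + 1 < e) (h2 : 2 ≤ a (o + 1)) :
    (Finset.Ico o e).biUnion (block a) =
      (Finset.range (a o - 1)).image (o, ·) ∪ (Finset.Ico (o + 1) e).biUnion (block a) := by
  have hmem : (o + 1, 0) ∈ (Finset.Ico (o + 1) e).biUnion (block a) :=
    Finset.mem_biUnion.2 ⟨o + 1, Finset.left_mem_Ico.2 h, left_mem_block h2⟩
  rw [← Finset.insert_Ico_add_one_left_eq_Ico (by omega), Finset.biUnion_insert, block,
    Finset.insert_union, Finset.insert_eq_of_mem (Finset.mem_union_right _ hmem)]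

theorem mem_Icc_of_mem_biUnion_block_Ico {c : ℤ × ℕ}
    (hc : c ∈ (Finset.Ico o e).biUnion (block a)) : c.1 ∈ Finset.Icc o e := by
  obtain ⟨i, hi, hci⟩ := Finset.mem_biUnion.1 hc
  rw [Finset.mem_Ico] at hi
  rw [Finset.mem_Icc]
  rcases mem_block.1 hci with rfl | ⟨rfl, -⟩
  · exact ⟨by omega, by omega⟩
  · exact ⟨hi.1, hi.2.le⟩

theorem sum_biUnion_block_Ico (h : o + 1 < e) (h2 : 2 ≤ a (o + 1)) (f : ℤ × ℕ → ℤ) :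
    ∑ c ∈ (Finset.Ico o e).biUnion (block a), f c =
      ∑ t ∈ Finset.range (a o - 1), f (o, t) +
        ∑ c ∈ (Finset.Ico (o + 1) e).biUnion (block a), f c := by
  have hdisj : Disjoint ((Finset.range (a o - 1)).image (o, ·))
      ((Finset.Ico (o + 1) e).biUnion (block a)) := by
    simp only [Finset.disjoint_left, Finset.forall_mem_image]
    intro t _ ht
    have := Finset.mem_Icc.1 (mem_Icc_of_mem_biUnion_block_Ico ht)
    omega
  rw [biUnion_block_Ico h h2, Finset.sum_union hdisj, Finset.sum_image (by simp)]

theorem chainSum_eq (f : ℤ × ℕ → ℤ) : ∀ {l : List ℕ} {o : ℤ}, l ≠ [] → (∀ b ∈ l, 2 ≤ b) →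
    HasWeights a o l →
      chainSum o l f = ∑ c ∈ (Finset.Ico o (o + l.length)).biUnion (block a), f c
  | [], _, hl, _, _ => absurd rfl hl
  | [b], o, _, _, h => by
    rw [List.length_singleton, Nat.cast_one, ← Order.succ_eq_add_one,
      Finset.Ico_succ_right_eq_Icc, Finset.Icc_self, Finset.singleton_biUnion, sum_block,
      (hasWeights_cons.1 h).1, chainSum, chainSum, add_comm]
  | b :: b' :: l, o, _, h2, h => by
    obtain ⟨hb, hl⟩ := hasWeights_cons.1 h
    have hb' := (hasWeights_cons.1 hl).1
    rw [sum_biUnion_block_Ico (by simp only [List.length_cons]; omega)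
      (by rw [hb']; exact h2 b' (by simp)), chainSum,
      chainSum_eq f (List.cons_ne_nil b' l) (List.forall_mem_of_forall_mem_cons h2) hl, hb,
      List.length_cons, List.length_cons, List.length_cons]
    push_cast
    rw [add_assoc o 1, add_comm 1]

end Placement

section Chains

variable {a : ℤ → ℕ} {m N : ℕ} {l l' : Fin m → List ℕ} {x : ℤ × ℕ → ℤ}

/-- The weights when the `i`-th chain is placed at the positions from `i * N` on. -/
def chainWeight (N : ℕ) (l : Fin m → List ℕ) (p : ℤ) : ℕ :=
  if h : (p / N).toNat < m then (l ⟨_, h⟩).getD (p % N).toNat 0 else 0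

/-- The positions of the `i`-th chain. -/
noncomputable def chainRun (N : ℕ) (l : Fin m → List ℕ) (i : Fin m) : Finset ℤ :=
  Finset.Ico (i * N : ℤ) (i * N + (l i).length)

/-- The positions of all chains. -/
noncomputable def chainPositions (N : ℕ) (l : Fin m → List ℕ) : Finset ℤ :=
  Finset.univ.biUnion (chainRun N l)

/-- The function that is given by `x i` on the coordinates of the `i`-th chain. -/
def glue (N : ℕ) (x : Fin m → ℤ × ℕ → ℤ) (c : ℤ × ℕ) : ℤ :=
  if h : (c.1 / N).toNat < m then x ⟨_, h⟩ c else 0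

theorem mul_add_ediv_eq {i s : ℤ} (h0 : 0 ≤ s) (h : s < N) : (i * N + s) / N = i := by
  rw [add_comm, Int.add_mul_ediv_right _ _ (by omega), Int.ediv_eq_zero_of_lt h0 h, zero_add]

theorem mul_add_emod_eq {i s : ℤ} (h0 : 0 ≤ s) (h : s < N) : (i * N + s) % N = s := by
  rw [add_comm, Int.add_mul_emod_self_right, Int.emod_eq_of_lt h0 h]

theorem hasWeights_chainWeight (hN : ∀ i, (l i).length < N) (i : Fin m) :
    HasWeights (chainWeight N l) (i * N) (l i) := fun s hs => by
  have hs0 : (0 : ℤ) ≤ s := s.cast_nonneg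
  have hsN : (s : ℤ) < N := by exact_mod_cast hs.trans (hN i)
  simp only [chainWeight, mul_add_ediv_eq hs0 hsN, mul_add_emod_eq hs0 hsN, Int.toNat_natCast,
    Fin.is_lt, dif_pos, Fin.eta]
  exact List.getD_eq_getElem _ _ hs

theorem glue_eq (hN : ∀ i, (l i).length < N) (x : Fin m → ℤ × ℕ → ℤ) {i : Fin m} {c : ℤ × ℕ}
    (hc : c ∈ (chainRun N l i).biUnion (block a)) : glue N x c = x i c := by
  have hlt := hN i
  have hmem := Finset.mem_Icc.1 (mem_Icc_of_mem_biUnion_block_Ico hc)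
  have hdiv : c.1 / N = i := by
    rw [← mul_add_ediv_eq (N := N) (i := i) (s := c.1 - i * N) (by omega) (by omega),
      add_sub_cancel]
  simp only [glue, hdiv, Int.toNat_natCast, Fin.is_lt, dif_pos, Fin.eta]

theorem separated_chainRun (hN : ∀ i, (l i).length < N) {i j : Fin m} (hij : i ≠ j) :
    Separated (chainRun N l i) (chainRun N l j) := by
  have hlt : ∀ i j : Fin m, i < j → ∀ p ∈ chainRun N l i, ∀ q ∈ chainRun N l j, p + 2 ≤ q := by
    intro i j hij p hp q hq
    rw [chainRun, Finset.mem_Ico] at hp hq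
    have hi := hN i
    have hmul : ((i : ℤ) + 1) * N ≤ j * N :=
      mul_le_mul_of_nonneg_right (by exact_mod_cast hij) N.cast_nonneg
    rw [add_one_mul] at hmul
    omega
  intro p hp q hq
  exact (lt_or_gt_of_ne hij).imp (hlt i j · p hp q hq) (hlt j i · q hq p hp)

theorem sum_biUnion_block_chainPositions (hN : ∀ i, (l i).length < N) (f : ℤ × ℕ → ℤ) :
    ∑ c ∈ (chainPositions N l).biUnion (block a), f c =
      ∑ i, ∑ c ∈ (chainRun N l i).biUnion (block a), f c := by
  rw [chainPositions, Finset.biUnion_biUnion]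
  exact Finset.sum_biUnion fun i _ j _ hij => (separated_chainRun hN hij).disjoint_biUnion_block

theorem isFlow_chainPositions :
    IsFlow (block a) (chainPositions N l) x ↔ ∀ i, IsFlow (block a) (chainRun N l i) x := by
  simp only [IsFlow, chainPositions, Finset.mem_biUnion, Finset.mem_univ, true_and,
    forall_exists_index]
  exact forall_comm

theorem DualPair.ne_nil {l l' : List ℕ} : DualPair l l' → l ≠ []
  | base | left _ | right _ => List.cons_ne_nil _ _

section Dual

variable (hN : ∀ i, (l i).length < N) (hd : ∀ i, DualPair (l i) (l' i))
  (h2 : ∀ i, ∀ b ∈ l i, 2 ≤ b)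

include hN hd h2

theorem sum_chainPositions_eq_sum_chainSum (f : ℤ × ℕ → ℤ) :
    ∑ c ∈ (chainPositions N l).biUnion (block (chainWeight N l)), f c =
      ∑ i : Fin m, chainSum (i * N) (l i) f := by
  rw [sum_biUnion_block_chainPositions hN]
  exact Finset.sum_congr rfl fun i _ =>
    (chainSum_eq f (hd i).ne_nil (h2 i) (hasWeights_chainWeight hN i)).symm

theorem card_biUnion_block_chainPositions :
    (((chainPositions N l).biUnion (block (chainWeight N l))).card : ℤ) =
      ∑ i, ((l i).length + (l' i).length : ℤ) := by
  rw [Finset.card_eq_sum_ones, Nat.cast_sum, Nat.cast_one,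
    sum_chainPositions_eq_sum_chainSum hN hd h2]
  exact Finset.sum_congr rfl fun i _ => (hd i).chainSum_one _

theorem exists_toFlow : ∃ T : (Fin m → ℕ → ℤ) → ℤ × ℕ → ℤ,
    (∀ c, IsFlow (block (chainWeight N l)) (chainPositions N l) (T c)) ∧
      ∀ c d, pairing (block (chainWeight N l)) (chainPositions N l) (T c) (T d) =
        ∑ i, chainForm (l' i) (c i) (d i) := by
  choose ε T _ hT hTT using fun i => (hd i).exists_toFlow (i * N)
  have hglue : ∀ (c : Fin m → ℕ → ℤ) i, ∀ e ∈ (chainRun N l i).biUnion (block (chainWeight N l)),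
      glue N (fun i => T i (c i)) e = T i (c i) e := fun c i e he => glue_eq hN _ he
  refine ⟨fun c => glue N fun i => T i (c i), fun c => isFlow_chainPositions.2 fun i => ?_,
    fun c d => ?_⟩
  · exact ((isChainFlow_iff (hasWeights_chainWeight hN i)).1 (hT i (c i)).1).congr
      fun e he => (hglue c i e he).symm
  · rw [pairing, sum_biUnion_block_chainPositions hN]
    refine Finset.sum_congr rfl fun i _ => ?_
    rw [← hTT, chainSum_eq _ (hd i).ne_nil (h2 i) (hasWeights_chainWeight hN i)]
    exact Finset.sum_congr rfl fun e he => congrArg₂ (· * ·) (hglue c i e he) (hglue d i e he)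

theorem exists_ofFlow : ∃ C : (ℤ × ℕ → ℤ) → Fin m → ℕ → ℤ,
    ∀ x y, IsFlow (block (chainWeight N l)) (chainPositions N l) x →
      IsFlow (block (chainWeight N l)) (chainPositions N l) y →
        ∑ i, chainForm (l' i) (C x i) (C y i) =
          pairing (block (chainWeight N l)) (chainPositions N l) x y := by
  choose ε C _ _ hCC using fun i => (hd i).exists_ofFlow (i * N)
  refine ⟨fun x i => C i x, fun x y hx hy => ?_⟩
  have hflow : ∀ x, IsFlow (block (chainWeight N l)) (chainPositions N l) x →
      ∀ i : Fin m, IsChainFlow (i * N) (l i) x := fun x hx i =>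
    (isChainFlow_iff (hasWeights_chainWeight hN i)).2 (isFlow_chainPositions.1 hx i)
  rw [pairing, sum_chainPositions_eq_sum_chainSum hN hd h2]
  exact Finset.sum_congr rfl fun i _ => hCC i x y (hflow x hx i) (hflow y hy i)

end Dual

end Chains

section LensSpaces

variable {m n N k : ℕ} (L : Fin m → LensSpace)

theorem two_le_of_mem_coeffs (L : LensSpace) : ∀ b ∈ L.coeffs, 2 ≤ b :=
  two_le_of_mem_hjExpansion L.q_lt_p

theorem sum_eq_chainForm : ∀ {l : List ℕ} (c d : ℕ → ℤ),
    ∑ s : Fin l.length, ∑ t : Fin l.length, c s * (if s = t then (l.get s : ℤ) else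
      if s.val + 1 = t.val ∨ t.val + 1 = s.val then -1 else 0) * d t = chainForm l c d
  | [], _, _ => rfl
  | [b], c, d => by
    rw [chainForm, mul_comm (b : ℤ)]
    exact (Fin.sum_univ_one _).trans (Fin.sum_univ_one _)
  | b :: b' :: l, c, d => by
    rw [chainForm, ← sum_eq_chainForm]
    simp only [List.length_cons, Fin.sum_univ_succ, Finset.sum_add_distrib]
    simp [Fin.ext_iff]
    ring_nf

theorem intersectionForm_apply (c d : Fin m → ℕ → ℤ) :
    (canonicalPlumbingGraph L).intersectionForm (fun v => c v.1 v.2) (fun v => d v.1 v.2) =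
      -∑ i, chainForm (L i).coeffs (c i) (d i) := by
  classical
  refine (@Matrix.toBilin'_apply _ _ _ _ (fun a b => Classical.propDecidable (a = b))
    _ _ _).trans ?_
  rw [Fintype.sum_sigma, ← Finset.sum_neg_distrib]
  refine Finset.sum_congr rfl fun i _ => ?_
  rw [← sum_eq_chainForm, ← Finset.sum_neg_distrib]
  refine Finset.sum_congr rfl fun s _ => ?_
  rw [Fintype.sum_sigma, Fintype.sum_eq_single i, ← Finset.sum_neg_distrib]
  · refine Finset.sum_congr rfl fun t _ => ?_
    simp only [Matrix.of_apply, canonicalPlumbingGraph, Sigma.mk.injEq, heq_eq_eq, true_and]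
    split_ifs <;> ring
  · intro j hj
    refine Finset.sum_eq_zero fun t _ => ?_
    simp only [Matrix.of_apply, canonicalPlumbingGraph, Sigma.mk.injEq, hj.symm, false_and,
      if_false, mul_zero, zero_mul]

/-- The extension by zero of a function on the vertices of a disjoint union of paths. -/
def extendZero {l : Fin m → List ℕ} (c : (Σ i : Fin m, Fin (l i).length) → ℤ) (i : Fin m)
    (s : ℕ) : ℤ :=
  if h : s < (l i).length then c ⟨i, s, h⟩ else 0

theorem extendZero_apply {l : Fin m → List ℕ} (c : (Σ i : Fin m, Fin (l i).length) → ℤ)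
    (v : Σ i : Fin m, Fin (l i).length) : extendZero c v.1 v.2 = c v :=
  dif_pos v.2.2

theorem intersectionForm_eq_neg_sum (c d : (Σ i : Fin m, Fin (L i).coeffs.length) → ℤ) :
    (canonicalPlumbingGraph L).intersectionForm c d =
      -∑ i, chainForm (L i).coeffs (extendZero c i) (extendZero d i) := by
  rw [← intersectionForm_apply]
  congr 2 <;> exact funext fun v => (extendZero_apply _ v).symm

theorem eq_zero_of_intersectionForm_eq_zero {c : (Σ i : Fin m, Fin (L i).coeffs.length) → ℤ}
    (h : (canonicalPlumbingGraph L).intersectionForm c c = 0) : c = 0 := by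
  rw [intersectionForm_eq_neg_sum, neg_eq_zero, Finset.sum_eq_zero_iff_of_nonneg fun i _ =>
    chainForm_nonneg (two_le_of_mem_coeffs (L i))] at h
  funext v
  rw [← extendZero_apply c v]
  exact eq_zero_of_chainForm_eq_zero (two_le_of_mem_coeffs (L v.1)) (h v.1 (Finset.mem_univ _))
    v.2 v.2.2

theorem bettiTwo_canonicalPlumbingGraph :
    (canonicalPlumbingGraph L).bettiTwo = ∑ i, (L i).coeffs.length := by
  rw [WeightedGraph.bettiTwo, Module.finrank_fintype_fun_eq_card, Fintype.card_sigma]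
  simp only [Fintype.card_fin]

theorem standardNegativeForm_apply (x y : Fin n → ℤ) :
    standardNegativeForm n x y = -(x ⬝ᵥ y) := by
  rw [standardNegativeForm, Matrix.toBilin'_apply', Matrix.neg_mulVec, Matrix.one_mulVec,
    dotProduct_neg]

theorem map_add_of_dotProduct_eq {M J : Type*} [AddCommGroup M] [Fintype J]
    (B : LinearMap.BilinForm ℤ M) {f : M → J → ℤ} (h : ∀ x y, f x ⬝ᵥ f y = B x y) (x y : M) :
    f (x + y) = f x + f y := by
  rw [← sub_eq_zero, ← dotProduct_self_eq_zero]
  simp only [sub_dotProduct, dotProduct_sub, add_dotProduct, dotProduct_add, h, map_add,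
    LinearMap.add_apply]
  ring

theorem latticeEmbeds_standardNegativeForm_iff {M : Type*} [AddCommGroup M]
    {B : LinearMap.BilinForm ℤ M} (hB : ∀ x, B x x = 0 → x = 0) :
    LatticeEmbeds B (standardNegativeForm n) ↔
      ∃ f : M → Fin n → ℤ, ∀ x y, f x ⬝ᵥ f y = (-B) x y := by
  simp only [LatticeEmbeds, standardNegativeForm_apply, LinearMap.neg_apply, neg_eq_iff_eq_neg]
  refine ⟨fun ⟨f, _, hf⟩ => ⟨f, hf⟩, fun ⟨f, hf⟩ => ?_⟩
  refine ⟨(AddMonoidHom.mk' f (map_add_of_dotProduct_eq (-B) hf)).toIntLinearMap, ?_, hf⟩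
  refine (injective_iff_map_eq_zero _).2 fun x hx => hB x ?_
  rw [← neg_eq_zero, ← hf, show f x = 0 from hx, dotProduct_zero]

theorem compressible_iff_exists_fin {α ι : Type*} [DecidableEq α] {B : ι → Finset α}
    {P : Finset ι} : Compressible B P k ↔ ∃ n, n + k = (P.biUnion B).card ∧
      ∃ φ : (α → ℤ) → Fin n → ℤ, IsFlowIsometry B P φ := by
  constructor
  · rintro ⟨J, _, φ, hφ, hJ⟩
    refine ⟨_, hJ, fun x j => φ x ((Fintype.equivFin J).symm j), fun x y hx hy => ?_⟩
    rw [← hφ x y hx hy]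
    exact (Fintype.equivFin J).symm.sum_comp fun j => φ x j * φ y j
  · rintro ⟨n, hn, φ, hφ⟩
    exact ⟨Fin n, inferInstance, φ, hφ, by rwa [Fintype.card_fin]⟩

section Chains

variable {L} (hN : ∀ i, (L i).coeffs.length < N)

include hN

theorem exists_isFlowIsometry_iff_latticeEmbeds :
    (∃ φ : (ℤ × ℕ → ℤ) → Fin n → ℤ,
      IsFlowIsometry (block (chainWeight N fun i => (L i).coeffs))
        (chainPositions N fun i => (L i).coeffs) φ) ↔
      LatticeEmbeds (dualPlumbingGraph L).intersectionForm (standardNegativeForm n) := by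
  have hd i := dualPair_coeffs (L i)
  have h2 i := two_le_of_mem_coeffs (L i)
  rw [dualPlumbingGraph, latticeEmbeds_standardNegativeForm_iff fun c =>
    eq_zero_of_intersectionForm_eq_zero _]
  constructor
  · rintro ⟨φ, hφ⟩
    obtain ⟨T, hT, hTT⟩ := exists_toFlow hN hd h2
    refine ⟨fun c => φ (T (extendZero c)), fun c d => ?_⟩
    rw [hφ _ _ (hT _) (hT _), hTT, LinearMap.neg_apply, LinearMap.neg_apply,
      intersectionForm_eq_neg_sum, neg_neg]
  · rintro ⟨f, hf⟩
    obtain ⟨C, hC⟩ := exists_ofFlow hN hd h2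
    refine ⟨fun x => f fun v => C x v.1 v.2, fun x y hx hy => ?_⟩
    rw [hf, LinearMap.neg_apply, LinearMap.neg_apply, intersectionForm_apply, neg_neg, hC x y hx hy]

theorem propertyX_iff_not_compressible :
    PropertyX k L ↔ ¬ Compressible (block (chainWeight N fun i => (L i).coeffs))
      (chainPositions N fun i => (L i).coeffs) k := by
  have hrank : (((canonicalPlumbingGraph L).bettiTwo : ℤ) + (dualPlumbingGraph L).bettiTwo) =
      ((chainPositions N fun i => (L i).coeffs).biUnion
        (block (chainWeight N fun i => (L i).coeffs))).card := by
    rw [card_biUnion_block_chainPositions hN (fun i => dualPair_coeffs (L i))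
      fun i => two_le_of_mem_coeffs (L i), dualPlumbingGraph, bettiTwo_canonicalPlumbingGraph,
      bettiTwo_canonicalPlumbingGraph, Finset.sum_add_distrib, Nat.cast_sum, Nat.cast_sum]
  rw [PropertyX, not_iff_not, hrank, compressible_iff_exists_fin]
  refine exists_congr fun n => and_congr ?_ (exists_isFlowIsometry_iff_latticeEmbeds hN).symm
  omega

end Chains

end LensSpaces

end LinearPlumbing

namespace WeightedGraph

variable {U V W : Type*} {F : WeightedGraph U} {G : WeightedGraph V} {H : WeightedGraph W}

theorem IsIsomorphic.refl (G : WeightedGraph V) : G.IsIsomorphic G :=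
  ⟨SimpleGraph.Iso.refl, fun _ => rfl⟩

theorem IsIsomorphic.symm (h : G.IsIsomorphic H) : H.IsIsomorphic G := by
  obtain ⟨f, hf⟩ := h
  exact ⟨f.symm, fun v => by rw [← hf, RelIso.apply_symm_apply]⟩

theorem IsIsomorphic.trans (h : F.IsIsomorphic G) (h' : G.IsIsomorphic H) : F.IsIsomorphic H := by
  obtain ⟨f, hf⟩ := h
  obtain ⟨g, hg⟩ := h'
  exact ⟨f.trans g, fun v => by rw [RelIso.trans_apply, hg, hf]⟩

theorem IsIsomorphic.isInducedSubgraph (h : G.IsIsomorphic H) : G.IsInducedSubgraph H := by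
  obtain ⟨f, hf⟩ := h
  exact ⟨f.toEmbedding, hf⟩

theorem IsInducedSubgraph.trans (h : F.IsInducedSubgraph G) (h' : G.IsInducedSubgraph H) :
    F.IsInducedSubgraph H := by
  obtain ⟨f, hf⟩ := h
  obtain ⟨g, hg⟩ := h'
  exact ⟨f.trans g, fun v => by rw [RelEmbedding.trans_apply, hg, hf]⟩

theorem exists_isIsomorphic_fin [Fintype V] (G : WeightedGraph V) :
    ∃ G' : WeightedGraph (Fin (Fintype.card V)), G'.IsIsomorphic G := by
  let e := (Fintype.equivFin V).symm
  exact ⟨⟨G.graph.comap e, fun v => G.weight (e v)⟩, ⟨e, Iff.rfl⟩, fun _ => rfl⟩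

theorem finite_setOf_weight_le (n : ℕ) (b : ℤ) :
    {G : WeightedGraph (Fin n) | ∀ v, |G.weight v| ≤ b}.Finite := by
  have hinj : Function.Injective fun G : WeightedGraph (Fin n) => (G.graph, G.weight) := by
    rintro ⟨g, w⟩ ⟨g', w'⟩ h
    simpa using h
  refine ((Set.finite_univ.prod (Set.Finite.pi fun _ : Fin n => Set.finite_Icc (-b) b)).preimage
    hinj.injOn).subset fun G hG => ?_
  exact ⟨Set.mem_univ _, fun v _ => abs_le.1 (hG v)⟩

theorem finite_setOf_card_le_and_weight_le (N : ℕ) (b : ℤ) :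
    {G : Σ n : ℕ, WeightedGraph (Fin n) | G.1 ≤ N ∧ ∀ v, |G.2.weight v| ≤ b}.Finite := by
  refine ((Set.finite_Iic N).biUnion fun n _ =>
    (finite_setOf_weight_le n b).image (Sigma.mk n)).subset ?_
  rintro ⟨n, G⟩ ⟨hn, hw⟩
  exact Set.mem_biUnion (show n ∈ Set.Iic N from hn) ⟨G, hw, rfl⟩

/-- Isomorphism of weighted graphs with vertex sets `Fin n`, as an equivalence relation. -/
def isomorphismSetoid : Setoid (Σ n : ℕ, WeightedGraph (Fin n)) where
  r G H := G.2.IsIsomorphic H.2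
  iseqv := ⟨fun G => .refl G.2, .symm, .trans⟩

theorem exists_finset_pairwise_not_isIsomorphic {A : Set (Σ n : ℕ, WeightedGraph (Fin n))}
    (hA : A.Finite) : ∃ S : Finset (Σ n : ℕ, WeightedGraph (Fin n)), (∀ G ∈ S, G ∈ A) ∧
      (∀ G ∈ S, ∀ H ∈ S, G.2.IsIsomorphic H.2 → G = H) ∧
      ∀ G ∈ A, ∃ H ∈ S, H.2.IsIsomorphic G.2 := by
  obtain ⟨B, hBA, hB, himage⟩ :=
    (A.surjOn_image (Quotient.mk isomorphismSetoid)).exists_subset_injOn_image_eq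
  have hmem : ∀ G, G ∈ (hA.subset hBA).toFinset ↔ G ∈ B := fun G => Set.Finite.mem_toFinset _
  refine ⟨(hA.subset hBA).toFinset, fun G hG => hBA ((hmem G).1 hG), fun G hG H hH h =>
    hB ((hmem G).1 hG) ((hmem H).1 hH) (Quotient.sound h), fun G hG => ?_⟩
  obtain ⟨H, hH, hHG⟩ := himage.superset ⟨G, hG, rfl⟩
  exact ⟨H, (hmem H).2 hH, Quotient.exact hHG⟩

end WeightedGraph

namespace LinearPlumbing

section RunDecomposition

variable {a : ℤ → ℕ} {P : Finset ℤ} {m : ℕ} {L : Fin m → LensSpace} {o : Fin m → ℤ}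

/-- The vertices of a weighted graph are identified with the positions in `P`, so that the adjacent
vertices are those at consecutive positions. -/
structure IsModel {V : Type*} (G : WeightedGraph V) (a : ℤ → ℕ) (P : Finset ℤ) (f : V → ℤ) :
    Prop where
  inj : Function.Injective f
  mem : ∀ p, p ∈ P ↔ ∃ v, f v = p
  adj : ∀ u v, G.graph.Adj u v ↔ (f v = f u + 1 ∨ f u = f v + 1)
  weight : ∀ v, G.weight v = -(a (f v) : ℤ)

/-- The maximal runs of consecutive positions in `P` start at the positions `o i`, and the weights
along the run from `o i` on are the coefficients of the lens space `L i`. -/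
structure IsRunDecomposition (a : ℤ → ℕ) (P : Finset ℤ) (L : Fin m → LensSpace) (o : Fin m → ℤ) :
    Prop where
  injective : Function.Injective o
  exists_eq : ∀ p ∈ P, p - 1 ∉ P → ∃ i, o i = p
  sub_one_notMem : ∀ i, o i - 1 ∉ P
  add_mem : ∀ i (s : ℕ), s < (L i).coeffs.length → o i + s ∈ P
  add_length_notMem : ∀ i, o i + (L i).coeffs.length ∉ P
  hasWeights : ∀ i, HasWeights a (o i) (L i).coeffs

theorem exists_forall_lt_add_mem (P : Finset ℤ) (p : ℤ) :
    ∃ n : ℕ, (∀ s < n, p + (s : ℕ) ∈ P) ∧ p + n ∉ P := by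
  classical
  have hex : ∃ n : ℕ, p + n ∉ P := by
    by_contra! h
    obtain ⟨b, hb⟩ := P.bddAbove
    have := hb (h (b - p + 1).toNat)
    omega
  exact ⟨Nat.find hex, fun s hs => not_not.1 (Nat.find_min hex hs), Nat.find_spec hex⟩

theorem exists_lensSpace_hasWeights (h2 : ∀ p ∈ P, 2 ≤ a p) {p : ℤ} (hp : p ∈ P) :
    ∃ L : LensSpace, HasWeights a p L.coeffs ∧ (∀ s : ℕ, s < L.coeffs.length → p + s ∈ P) ∧
      p + L.coeffs.length ∉ P := by
  obtain ⟨n, hmem, hn⟩ := exists_forall_lt_add_mem P p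
  have hn0 : n ≠ 0 := by
    rintro rfl
    exact hn (by rwa [Nat.cast_zero, add_zero])
  obtain ⟨L, hL⟩ := exists_coeffs_eq (l := (List.range n).map fun s : ℕ => a (p + s))
    (by simpa using hn0) <| List.forall_mem_map.2 fun s hs =>
      h2 _ (hmem s (List.mem_range.1 hs))
  have hlen : L.coeffs.length = n := by rw [hL, List.length_map, List.length_range]
  exact ⟨L, fun s hs => by simp [hL], fun s hs => hmem s (hlen ▸ hs), hlen ▸ hn⟩

theorem exists_isRunDecomposition (h2 : ∀ p ∈ P, 2 ≤ a p) :
    ∃ (m : ℕ) (L : Fin m → LensSpace) (o : Fin m → ℤ), IsRunDecomposition a P L o := by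
  let S := P.filter fun p => p - 1 ∉ P
  let e := S.equivFin
  have hS : ∀ i, (e.symm i : ℤ) ∈ P ∧ (e.symm i : ℤ) - 1 ∉ P := fun i =>
    Finset.mem_filter.1 (e.symm i).2
  choose L hw hmem hend using fun i => exists_lensSpace_hasWeights h2 (hS i).1
  exact ⟨S.card, L, fun i => e.symm i, Subtype.val_injective.comp e.symm.injective,
    fun p hp hp' => ⟨e ⟨p, Finset.mem_filter.2 ⟨hp, hp'⟩⟩, by rw [e.symm_apply_apply]⟩,
    fun i => (hS i).2, hmem, hend, hw⟩

theorem IsRunDecomposition.add_one_lt_length (h : IsRunDecomposition a P L o) {i : Fin m} {s : ℕ}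
    (hs : s < (L i).coeffs.length) (hmem : o i + s + 1 ∈ P) : s + 1 < (L i).coeffs.length := by
  refine lt_of_le_of_ne hs fun heq => h.add_length_notMem i ?_
  rwa [← heq, Nat.cast_succ, ← add_assoc]

theorem IsRunDecomposition.le_of_add_eq (h : IsRunDecomposition a P L o) {i j : Fin m} {s t : ℕ}
    (hs : s < (L i).coeffs.length) (hst : o i + s = o j + t) : o j ≤ o i := by
  by_contra! hlt
  have hmem := h.add_mem i (o j - 1 - o i).toNat (by omega)
  rw [show o i + ((o j - 1 - o i).toNat : ℤ) = o j - 1 by omega] at hmem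
  exact h.sub_one_notMem j hmem

theorem IsRunDecomposition.eq_and_eq (h : IsRunDecomposition a P L o) {i j : Fin m} {s t : ℕ}
    (hs : s < (L i).coeffs.length) (ht : t < (L j).coeffs.length) (hst : o i + s = o j + t) :
    i = j ∧ s = t := by
  have ho := (h.le_of_add_eq ht hst.symm).antisymm (h.le_of_add_eq hs hst)
  exact ⟨h.injective ho, by omega⟩

theorem IsRunDecomposition.exists_add_eq (h : IsRunDecomposition a P L o) {p : ℤ} (hp : p ∈ P) :
    ∃ v : Σ i : Fin m, Fin (L i).coeffs.length, o v.1 + (v.2 : ℕ) = p := by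
  have hstart : ∀ q ∈ P, q - 1 ∉ P →
      ∃ v : Σ i : Fin m, Fin (L i).coeffs.length, o v.1 + (v.2 : ℕ) = q := fun q hq hq' => by
    obtain ⟨i, rfl⟩ := h.exists_eq q hq hq'
    have hpos : 0 < (L i).coeffs.length := Nat.pos_of_ne_zero fun h0 =>
      h.add_length_notMem i (by rwa [h0, Nat.cast_zero, add_zero])
    exact ⟨⟨i, 0, hpos⟩, by simp only [Nat.cast_zero, add_zero]⟩
  obtain ⟨b, hb⟩ := P.bddBelow
  have hbp := hb hp
  induction p, hbp using Int.leInduction with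
  | base => exact hstart b hp fun hb' => by linarith [hb hb']
  | succ p hbp ih =>
    by_cases hp' : p ∈ P
    · obtain ⟨⟨i, s⟩, rfl⟩ := ih hp'
      exact ⟨⟨i, s + 1, h.add_one_lt_length s.2 hp⟩, by push_cast; ring⟩
    · exact hstart (p + 1) hp (by rwa [add_sub_cancel_right])

theorem IsRunDecomposition.isModel (h : IsRunDecomposition a P L o) :
    IsModel (canonicalPlumbingGraph L) a P fun v => o v.1 + (v.2 : ℕ) where
  inj := by
    rintro ⟨i, s⟩ ⟨j, t⟩ hst
    obtain ⟨rfl, hst⟩ := h.eq_and_eq s.2 t.2 hst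
    rw [Fin.ext hst]
  mem p := ⟨fun hp => h.exists_add_eq hp, fun ⟨v, hv⟩ => hv ▸ h.add_mem v.1 v.2 v.2.2⟩
  adj := by
    have hsucc : ∀ (i j : Fin m) (s : Fin (L i).coeffs.length) (t : Fin (L j).coeffs.length),
        o j + t.val = o i + s.val + 1 ↔ i = j ∧ s.val + 1 = t.val := by
      refine fun i j s t => ⟨fun hst => ?_, ?_⟩
      · exact h.eq_and_eq (h.add_one_lt_length s.2 (hst ▸ h.add_mem j t t.2)) t.2
          (by push_cast; linarith)
      · rintro ⟨rfl, hst⟩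
        rw [← hst]
        push_cast
        ring
    rintro ⟨i, s⟩ ⟨j, t⟩
    simp only [canonicalPlumbingGraph, hsucc, eq_comm (a := j), and_or_left]
  weight v := by
    rw [h.hasWeights v.1 v.2 v.2.2]
    rfl

end RunDecomposition

section LensSpaceModel

variable {m N : ℕ}

theorem eq_and_eq_of_mul_add_eq {i j : Fin m} {s t : ℕ} (hs : s < N) (ht : t < N)
    (h : (i * N + s : ℤ) = j * N + t) : i = j ∧ s = t := by
  have hs' : (s : ℤ) < N := by exact_mod_cast hs
  have ht' : (t : ℤ) < N := by exact_mod_cast ht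
  have hdiv := mul_add_ediv_eq (i := i) s.cast_nonneg hs'
  have hmod := mul_add_emod_eq (i := i) s.cast_nonneg hs'
  rw [h, mul_add_ediv_eq t.cast_nonneg ht'] at hdiv
  rw [h, mul_add_emod_eq t.cast_nonneg ht'] at hmod
  exact ⟨Fin.ext (by exact_mod_cast hdiv.symm), by exact_mod_cast hmod.symm⟩

theorem mem_chainPositions {l : Fin m → List ℕ} {p : ℤ} :
    p ∈ chainPositions N l ↔ ∃ i, ∃ s < (l i).length, (i * N + s : ℤ) = p := by
  simp only [chainPositions, Finset.mem_biUnion, Finset.mem_univ, true_and, chainRun,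
    Finset.mem_Ico]
  refine exists_congr fun i => ⟨fun hp => ⟨(p - i * N).toNat, by omega⟩, ?_⟩
  rintro ⟨s, hs, rfl⟩
  omega

theorem isRunDecomposition_chainPositions {L : Fin m → LensSpace}
    (hN : ∀ i, (L i).coeffs.length < N) :
    IsRunDecomposition (chainWeight N fun i => (L i).coeffs)
      (chainPositions N fun i => (L i).coeffs) L fun i => i * N where
  injective i j h :=
    (eq_and_eq_of_mul_add_eq (s := 0) (t := 0) (Nat.zero_lt_of_lt (hN i))
      (Nat.zero_lt_of_lt (hN i)) (by simpa using h)).1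
  exists_eq p hp hp' := by
    obtain ⟨i, s, hs, rfl⟩ := mem_chainPositions.1 hp
    refine ⟨i, ?_⟩
    cases s with
    | zero => rw [Nat.cast_zero, add_zero]
    | succ s =>
      exact absurd (mem_chainPositions.2 ⟨i, s, Nat.lt_of_succ_lt hs, by push_cast; ring⟩) hp'
  sub_one_notMem i h := by
    obtain ⟨j, s, hs, hst⟩ := mem_chainPositions.1 h
    exact Nat.succ_ne_zero s (eq_and_eq_of_mul_add_eq (i := j) (j := i) (t := 0)
      (lt_of_le_of_lt hs (hN j)) (Nat.zero_lt_of_lt (hN i)) (by push_cast; linarith)).2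
  add_mem i s hs := mem_chainPositions.2 ⟨i, s, hs, rfl⟩
  add_length_notMem i h := by
    obtain ⟨j, s, hs, hst⟩ := mem_chainPositions.1 h
    obtain ⟨rfl, rfl⟩ := eq_and_eq_of_mul_add_eq (hs.trans (hN j)) (hN i) hst
    exact lt_irrefl _ hs
  hasWeights := hasWeights_chainWeight hN

theorem exists_isModel (L : Fin m → LensSpace) : ∃ (a : ℤ → ℕ) (P : Finset ℤ)
    (f : (Σ i : Fin m, Fin (L i).coeffs.length) → ℤ), IsModel (canonicalPlumbingGraph L) a P f ∧
      (∀ p ∈ P, 2 ≤ a p) ∧ ∀ k, PropertyX k L ↔ ¬ Compressible (block a) P k := by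
  obtain ⟨N, hN⟩ : ∃ N, ∀ i, (L i).coeffs.length < N :=
    ⟨∑ i, (L i).coeffs.length + 1, fun i => Nat.lt_succ_of_le <|
      Finset.single_le_sum (f := fun i => (L i).coeffs.length) (fun _ _ => Nat.zero_le _)
        (Finset.mem_univ i)⟩
  refine ⟨_, _, _, (isRunDecomposition_chainPositions hN).isModel, fun p hp => ?_,
    fun k => propertyX_iff_not_compressible hN⟩
  obtain ⟨i, s, hs, rfl⟩ := mem_chainPositions.1 hp
  rw [hasWeights_chainWeight hN i s hs]
  exact two_le_of_mem_coeffs (L i) _ (List.getElem_mem _)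

end LensSpaceModel

section MinimalConfigurations

open WeightedGraph

variable {V W : Type*} {G : WeightedGraph V} {H : WeightedGraph W} {a a' : ℤ → ℕ}
  {P P' : Finset ℤ} {f : V → ℤ} {f' : W → ℤ} {k m n : ℕ} {L : Fin m → LensSpace}
  {L' : Fin n → LensSpace}

theorem isMinimalConfiguration_of_isIsomorphic (hG : IsMinimalConfiguration k G)
    (h : G.IsIsomorphic H) : IsMinimalConfiguration k H := by
  obtain ⟨⟨m, L, hL, hX⟩, hmin⟩ := hG
  exact ⟨⟨m, L, h.symm.trans hL, hX⟩, fun m' L' hX' hL' =>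
    (hmin m' L' hX' (hL'.trans h.symm.isInducedSubgraph)).trans h⟩

theorem IsModel.compressible_image (hG : IsModel G a P f) (hH : IsModel H a' P' f')
    (h2 : ∀ p ∈ P, 2 ≤ a p) (g : G.graph ↪g H.graph) (hg : ∀ v, H.weight (g v) = G.weight v)
    (h : Compressible (block a) P k) :
    ∃ Q ⊆ P', Compressible (block a') Q k ∧ ∀ p ∈ Q, ∃ v, f' (g v) = p := by
  let F : ℤ → ℤ := Function.extend f (f' ∘ g) 0
  have hF : ∀ v, F (f v) = f' (g v) := fun v => hG.inj.extend_apply _ _ v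
  have himage : ∀ p ∈ P.image F, ∃ v, f' (g v) = p := fun p hp => by
    obtain ⟨q, hq, rfl⟩ := Finset.mem_image.1 hp
    obtain ⟨v, rfl⟩ := (hG.mem q).1 hq
    exact ⟨v, (hF v).symm⟩
  refine ⟨P.image F, fun p hp => ?_, h.image_block h2 ?_ ?_ ?_, himage⟩
  · obtain ⟨v, rfl⟩ := himage p hp
    exact (hH.mem _).2 ⟨g v, rfl⟩
  · intro p hp q hq hpq
    obtain ⟨u, rfl⟩ := (hG.mem p).1 hp
    obtain ⟨v, rfl⟩ := (hG.mem q).1 hq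
    rw [hF, hF] at hpq
    rw [g.injective (hH.inj hpq)]
  · intro p hp q hq
    obtain ⟨u, rfl⟩ := (hG.mem p).1 hp
    obtain ⟨v, rfl⟩ := (hG.mem q).1 hq
    rw [hF, hF, ← hG.adj, ← hH.adj, g.map_adj_iff]
  · intro p hp
    obtain ⟨v, rfl⟩ := (hG.mem p).1 hp
    have hweight := hg v
    rw [hG.weight, hH.weight] at hweight
    rw [hF]
    omega

theorem IsModel.compressible_of_isInducedSubgraph (hG : IsModel G a P f) (hH : IsModel H a' P' f')
    (h2 : ∀ p ∈ P, 2 ≤ a p) (hGH : G.IsInducedSubgraph H) (h : Compressible (block a) P k) :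
    Compressible (block a') P' k := by
  obtain ⟨g, hg⟩ := hGH
  obtain ⟨Q, hQ, hc, -⟩ := hG.compressible_image hH h2 g hg h
  exact hc.superset hQ

theorem IsModel.isInducedSubgraph_of_subset (hG : IsModel G a P f) (hH : IsModel H a P' f')
    (h : P ⊆ P') : G.IsInducedSubgraph H := by
  choose g hg using fun v => (hH.mem _).1 (h ((hG.mem (f v)).2 ⟨v, rfl⟩))
  have hinj : Function.Injective g := fun u v huv => hG.inj (by rw [← hg, ← hg, huv])
  refine ⟨⟨⟨g, hinj⟩, fun {u v} => ?_⟩, fun v => ?_⟩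
  · change H.graph.Adj (g u) (g v) ↔ _
    rw [hH.adj, hG.adj, hg, hg]
  · change H.weight (g v) = _
    rw [hH.weight, hG.weight, hg]

theorem IsModel.card_eq [Fintype V] (h : IsModel G a P f) : Fintype.card V = P.card := by
  rw [← Finset.card_univ, ← Finset.card_image_of_injective _ h.inj]
  exact congrArg Finset.card (Finset.ext fun p => by simp [h.mem])

theorem propertyX_iff_of_isModel {f : (Σ i : Fin m, Fin (L i).coeffs.length) → ℤ}
    (h : IsModel (canonicalPlumbingGraph L) a P f) (h2 : ∀ p ∈ P, 2 ≤ a p) :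
    PropertyX k L ↔ ¬ Compressible (block a) P k := by
  obtain ⟨a', P', f', h', h2', hX⟩ := exists_isModel L
  have hrefl := (IsIsomorphic.refl (canonicalPlumbingGraph L)).isInducedSubgraph
  rw [hX, not_iff_not]
  exact ⟨h'.compressible_of_isInducedSubgraph h h2' hrefl,
    h.compressible_of_isInducedSubgraph h' h2 hrefl⟩

theorem not_propertyX_of_isInducedSubgraph (hX : ¬ PropertyX k L)
    (h : (canonicalPlumbingGraph L).IsInducedSubgraph (canonicalPlumbingGraph L')) :
    ¬ PropertyX k L' := by
  obtain ⟨a, P, f, hm, h2, hL⟩ := exists_isModel L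
  obtain ⟨a', P', f', hm', -, hL'⟩ := exists_isModel L'
  rw [hL, not_not] at hX
  rw [hL', not_not]
  exact hm.compressible_of_isInducedSubgraph hm' h2 h hX

theorem isMinimalConfiguration_of_minimal {f : (Σ i : Fin m, Fin (L i).coeffs.length) → ℤ}
    (hf : IsModel (canonicalPlumbingGraph L) a P f) (h2 : ∀ p ∈ P, 2 ≤ a p)
    (hP : Minimal (Compressible (block a) · k) P) :
    IsMinimalConfiguration k (canonicalPlumbingGraph L) := by
  refine ⟨⟨m, L, .refl _, ?_⟩, fun m' L' hX ⟨g, hg⟩ => ?_⟩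
  · rw [propertyX_iff_of_isModel hf h2, not_not]
    exact hP.prop
  · obtain ⟨a', P', f', hf', h2', hX'⟩ := exists_isModel L'
    rw [hX', not_not] at hX
    obtain ⟨Q, hQ, hc, hQg⟩ := hf'.compressible_image hf h2' g hg hX
    have hsurj : Function.Surjective g := fun w => by
      obtain ⟨v, hv⟩ := hQg (f w) (hP.le_of_le hc hQ ((hf.mem _).2 ⟨w, rfl⟩))
      exact ⟨v, hf.inj hv⟩
    exact ⟨RelIso.ofSurjective g hsurj, hg⟩

theorem exists_isMinimalConfiguration_isInducedSubgraph (hk : 0 < k) (hX : ¬ PropertyX k L) :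
    ∃ (n : ℕ) (G : WeightedGraph (Fin n)), IsMinimalConfiguration k G ∧
      G.IsInducedSubgraph (canonicalPlumbingGraph L) ∧ n ≤ 13 * k ∧
      ∀ v, |G.weight v| ≤ 2 * (k : ℤ) + 7 := by
  obtain ⟨a, P, f, hf, h2, hL⟩ := exists_isModel L
  rw [hL, not_not] at hX
  obtain ⟨Q, hQP, hQ⟩ := exists_minimal_le_of_wellFoundedLT (Compressible (block a) · k) P hX
  replace h2 : ∀ p ∈ Q, 2 ≤ a p := fun p hp => h2 p (hQP hp)
  obtain ⟨hcard, hweight⟩ := card_le_and_weight_le h2 hQ hk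
  obtain ⟨m', L', o, hruns⟩ := exists_isRunDecomposition h2
  have hf' := hruns.isModel
  obtain ⟨G, g, hg⟩ := exists_isIsomorphic_fin (canonicalPlumbingGraph L')
  have hG : G.IsIsomorphic (canonicalPlumbingGraph L') := ⟨g, hg⟩
  refine ⟨_, G, isMinimalConfiguration_of_isIsomorphic (isMinimalConfiguration_of_minimal hf' h2 hQ)
    hG.symm, hG.isInducedSubgraph.trans (hf'.isInducedSubgraph_of_subset hf hQP),
    hf'.card_eq.trans_le hcard, fun v => ?_⟩
  rw [← hg, hf'.weight, abs_neg, Nat.abs_cast]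
  exact_mod_cast hweight _ ((hf'.mem _).2 ⟨g v, rfl⟩)

end MinimalConfigurations

end LinearPlumbing

theorem theoremA (k : ℕ) (hk : 0 < k) :
    ∃ S : Finset (Σ n : ℕ, WeightedGraph (Fin n)),
      (∀ G ∈ S, IsMinimalConfiguration k G.2) ∧
      (∀ G ∈ S, ∀ H ∈ S, G.2.IsIsomorphic H.2 → G = H) ∧
      (∀ (m : ℕ) (L : Fin m → LensSpace),
        PropertyX k L ↔ ∀ G ∈ S, ¬ G.2.IsInducedSubgraph (canonicalPlumbingGraph L)) ∧
      (∀ G ∈ S, ∀ v : Fin G.1, |G.2.weight v| ≤ 2 * (k : ℤ) + 7) ∧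
      (∀ G ∈ S, G.1 ≤ 13 * k) := by
  have hfin :=
    (WeightedGraph.finite_setOf_card_le_and_weight_le (13 * k) (2 * k + 7)).inter_of_right
      {G | IsMinimalConfiguration k G.2}
  obtain ⟨S, hS, hinj, hrep⟩ := WeightedGraph.exists_finset_pairwise_not_isIsomorphic hfin
  refine ⟨S, fun G hG => (hS G hG).1, hinj, fun m L => ⟨fun hX G hG hGL => ?_, fun h => ?_⟩,
    fun G hG => (hS G hG).2.2, fun G hG => (hS G hG).2.1⟩
  · obtain ⟨⟨m', L', hL', hX'⟩, -⟩ := (hS G hG).1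
    exact LinearPlumbing.not_propertyX_of_isInducedSubgraph hX'
      (hL'.symm.isInducedSubgraph.trans hGL) hX
  · by_contra hX
    obtain ⟨n, G, hG, hGL, hn, hw⟩ :=
      LinearPlumbing.exists_isMinimalConfiguration_isInducedSubgraph hk hX
    obtain ⟨H, hH, hHG⟩ := hrep ⟨n, G⟩ ⟨hG, hn, hw⟩
    exact h H hH (hHG.isInducedSubgraph.trans hGL)
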